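/- A (directed) temporal graph $\mathcal G=(V,\mathcal E,T)$ consists of a finite vertex set $V=\{0,\dots,n-1\}$, a number $T\in\mathbb N$ and a set $\mathcal E\subseteq\{(u,v,t)\mid u,v\in V,\ u\ne v,\ t\in\{1,\dots,T\}\}$ of $M$ time arcs. A temporal walk from $s$ to $z$ is a sequence $W=(e_1,\dots,e_k)$, $k\ge 1$, of time arcs $e_i=(v_{i-1},v_i,t_i)\in\mathcal E$ with $v_0=s$, $v_k=z$ and $t_1\le t_2\le\dots\le t_k$. It has length $k$, arrival time $t_k$ and duration $t_k-t_1$; it is a path if $v_0,\dots,v_k$ are distinct, strict if $t_1<\dots<t_k$, and $\Delta$-restless if $t_{i+1}-t_i\le\Delta$ for all $1\le i<k$. For a set $\mathcal W$ of temporal walks let $\sigma_{sz}$ be the number of walks from $s$ to $z$ in $\mathcal W$, let $\sigma_{sz}(v)$ be the number of those among them that visit $v$, and let $\delta_{sz}(v)=\sigma_{sz}(v)/\sigma_{sz}$ if $\sigma_{sz}\neq0$ and $\delta_{sz}(v)=0$ otherwise. The temporal betweenness centrality of $v$ with respect to $\mathcal W$ is $\sum_{s\ne v\ne z}\delta_{sz}(v)$,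 the sum over all $s\in V\setminus\{v\}$ and $z\in V\setminus\{v\}$ (where $s=z$ is allowed). Statement. For each of the following five choices of $\mathcal W$ there is an algorithm that, given $\mathcal G$ (with its arcs listed in any order), computes the temporal betweenness centrality with respect to $\mathcal W$ of all vertices in $O(n^2MT^2)$ time if $M\ge1$, and in $O(n+1)$ time if $M=0$: 1. foremost temporal walks: for all $s,z$, the temporal walks from $s$ to $z$ of minimum arrival time, provided that $\mathcal G$ has only finitely many such walks in total (otherwise the centrality is not defined); 2. shortest temporal paths: for all $s,z$, the temporal paths from $s$ to $z$ of minimum length; 3. shortest fastest temporal paths: for all $s,z$, the paths of minimum length among the temporal paths from $s$ to $z$ of minimum duration; 4. shortest restless temporal walks: for all $s,z$, the $\Delta$-restless temporal walks from $s$ to $z$ of minimum length, where $\Delta\in\mathbb N$ is part of the input and the constant in the running time does not depend on it; 5. strict prefix-foremost temporal paths: the strict temporal paths all of whose non-empty prefixes (including the path itself) have minimum arrival time among all strict temporal paths with the same first and the same last vertex. Time is counted as the number of unit-cost steps of a random access machine with addition, subtraction, comparison and indirect addressing on natural numbers and with $+,-,\cdot,/$ on rational numbers (which do not influence the control flow).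 -/

import Mathlib

/-! Part 1: temporal graphs, temporal walks and temporal betweenness centrality. -/

/-- The transition from `src` to `dst` at time step `time`, on the vertex set `Fin n`. -/
structure TimeArc (n : ℕ) where
  src : Fin n
  dst : Fin n
  time : ℕ

/-- A directed temporal graph with vertex set `{0, …, n - 1}`, time steps `1, …, T` and a finite
set of time arcs without self-loops. -/
structure TemporalGraph where
  n : ℕ
  T : ℕ
  arcs : Finset (TimeArc n)
  loopless : ∀ e ∈ arcs, e.src ≠ e.dst
  time_pos : ∀ e ∈ arcs, 1 ≤ e.time
  time_le : ∀ e ∈ arcs, e.time ≤ T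

/-- The number of time arcs of a temporal graph. -/
def TemporalGraph.M (G : TemporalGraph) : ℕ := G.arcs.card

namespace TransitionSeq

variable {n : ℕ}

/-- The vertices of a sequence of transitions: the starting point of the first transition,
followed by the endpoints of all transitions. -/
def vertices : List (TimeArc n) → List (Fin n)
  | [] => []
  | e :: W => e.src :: (e :: W).map TimeArc.dst

/-- The time step of the first transition. -/
def departure (W : List (TimeArc n)) : ℕ := (W.head?.map TimeArc.time).getD 0

/-- The time step of the last transition. -/
def arrival (W : List (TimeArc n)) : ℕ := (W.getLast?.map TimeArc.time).getD 0

/-- The difference between the time steps of the last and of the first transition (time steps do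
not decrease along a temporal walk, so that the subtraction does not truncate). -/
def duration (W : List (TimeArc n)) : ℕ := arrival W - departure W

/-- Every vertex is visited at most once. -/
def IsPath (W : List (TimeArc n)) : Prop := (vertices W).Nodup

/-- The time steps of consecutive transitions increase. -/
def IsStrict (W : List (TimeArc n)) : Prop := W.IsChain (fun e f => e.time < f.time)

/-- The time steps of consecutive transitions differ by at most `Δ`. -/
def IsRestless (Δ : ℕ) (W : List (TimeArc n)) : Prop :=
  W.IsChain (fun e f => f.time ≤ e.time + Δ)

end TransitionSeq

namespace TemporalGraph

open TransitionSeq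

variable (G : TemporalGraph)

/-- `W` is a temporal walk of `G`: consecutive transitions fit together and respect time. -/
def IsTemporalWalk (W : List (TimeArc G.n)) : Prop :=
  (∀ e ∈ W, e ∈ G.arcs) ∧ W.IsChain (fun e f => e.dst = f.src ∧ e.time ≤ f.time)

/-- `W` is a temporal walk from `s` to `z`; in particular it has at least one transition. -/
def IsWalkFromTo (s z : Fin G.n) (W : List (TimeArc G.n)) : Prop :=
  G.IsTemporalWalk W ∧ W.head?.map TimeArc.src = some s ∧ W.getLast?.map TimeArc.dst = some z

/-- The walks that, among all temporal walks of the class `P` with the same first vertex and the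
same last vertex, have the minimum value of `c`.  (Equivalently, the optimal walks of the cost
function that is `c` on `P` and infinite outside `P`.) -/
def minimizers (P : List (TimeArc G.n) → Prop) (c : List (TimeArc G.n) → ℕ) :
    Set (List (TimeArc G.n)) :=
  {W | ∃ s z, G.IsWalkFromTo s z W ∧ P W ∧
    ∀ W', G.IsWalkFromTo s z W' → P W' → c W ≤ c W'}

/-- Temporal walks that arrive as early as possible. -/
def foremostWalks : Set (List (TimeArc G.n)) := G.minimizers (fun _ => True) arrival

/-- Temporal paths with as few transitions as possible. -/
def shortestPaths : Set (List (TimeArc G.n)) := G.minimizers IsPath List.length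

/-- Temporal paths of minimum duration. -/
def fastestPaths : Set (List (TimeArc G.n)) := G.minimizers IsPath duration

/-- Temporal paths that are shortest among all fastest temporal paths. -/
def shortestFastestPaths : Set (List (TimeArc G.n)) :=
  G.minimizers (fun W => W ∈ G.fastestPaths) List.length

/-- Temporal walks that are shortest among all `Δ`-restless temporal walks. -/
def shortestRestlessWalks (Δ : ℕ) : Set (List (TimeArc G.n)) :=
  G.minimizers (IsRestless Δ) List.length

/-- Strict temporal paths that arrive as early as possible among the strict temporal paths. -/
def strictForemostPaths : Set (List (TimeArc G.n)) :=
  G.minimizers (fun W => IsPath W ∧ IsStrict W) arrival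

/-- Strict foremost temporal paths all of whose nonempty prefixes are strict foremost, too. -/
def strictPrefixForemostPaths : Set (List (TimeArc G.n)) :=
  {W | W ∈ G.strictForemostPaths ∧ ∀ Q, Q ≠ [] → Q <+: W → Q ∈ G.strictForemostPaths}

/-- The number of walks from `s` to `z` in `𝒲`. -/
noncomputable def walkCount (𝒲 : Set (List (TimeArc G.n))) (s z : Fin G.n) : ℕ :=
  {W | W ∈ 𝒲 ∧ G.IsWalkFromTo s z W}.ncard

/-- The number of walks from `s` to `z` in `𝒲` that go through the vertex `v`. -/
noncomputable def walkCountThrough (𝒲 : Set (List (TimeArc G.n))) (s z v : Fin G.n) : ℕ :=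
  {W | W ∈ 𝒲 ∧ G.IsWalkFromTo s z W ∧ v ∈ vertices W}.ncard

/-- The pair dependency of `s` and `z` on `v`. -/
noncomputable def pairDependency (𝒲 : Set (List (TimeArc G.n))) (s z v : Fin G.n) : ℚ :=
  if G.walkCount 𝒲 s z = 0 then 0
  else (G.walkCountThrough 𝒲 s z v : ℚ) / (G.walkCount 𝒲 s z : ℚ)

/-- Temporal betweenness centrality of `v` with respect to `𝒲`: the sum of the pair dependencies
over all `s ≠ v` and all `z ≠ v`. -/
noncomputable def betweenness (𝒲 : Set (List (TimeArc G.n))) (v : Fin G.n) : ℚ :=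
  ∑ s : Fin G.n, ∑ z : Fin G.n, if s ≠ v ∧ z ≠ v then G.pairDependency 𝒲 s z v else 0

end TemporalGraph

/-! Part 2: a random access machine, programmed in a structured language.

A program is a finite text.  It works on scalar registers and arrays of natural numbers (addition
and truncated subtraction, comparisons, indirect addressing), which alone steer the control flow,
and on arrays of rational numbers (the four basic arithmetic operations), which hold walk counts
and their quotients.  Every node of an expression and every executed instruction costs one step. -/

namespace RAM

/-- The memory: registers `reg x`, array cells `arr a i` and rational array cells `num a i`. -/
structure State where
  reg : ℕ → ℕ
  arr : ℕ → ℕ → ℕ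
  num : ℕ → ℕ → ℚ

/-- Expressions for natural numbers. -/
inductive NatExpr where
  | const (c : ℕ)
  | reg (x : ℕ)
  | load (a : ℕ) (i : NatExpr)
  | add (d e : NatExpr)
  | sub (d e : NatExpr)

/-- Expressions for rational numbers. -/
inductive RatExpr where
  | zero
  | one
  | load (a : ℕ) (i : NatExpr)
  | add (p q : RatExpr)
  | sub (p q : RatExpr)
  | mul (p q : RatExpr)
  | div (p q : RatExpr)

/-- Conditions compare natural numbers only. -/
inductive Cond where
  | lt (d e : NatExpr)
  | eq (d e : NatExpr)
  | not (b : Cond)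
  | and (b c : Cond)

/-- Programs. -/
inductive Prog where
  | skip
  | assign (x : ℕ) (e : NatExpr)
  | store (a : ℕ) (i e : NatExpr)
  | storeNum (a : ℕ) (i : NatExpr) (q : RatExpr)
  | seq (p q : Prog)
  | ite (b : Cond) (p q : Prog)
  | while (b : Cond) (p : Prog)

namespace NatExpr

def eval (st : State) : NatExpr → ℕ
  | const c => c
  | reg x => st.reg x
  | load a i => st.arr a (eval st i)
  | add d e => eval st d + eval st e
  | sub d e => eval st d - eval st e

def cost : NatExpr → ℕ
  | const _ => 1
  | reg _ => 1
  | load _ i => cost i + 1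
  | add d e => cost d + cost e + 1
  | sub d e => cost d + cost e + 1

end NatExpr

namespace RatExpr

/-- The value of an expression; as everywhere in Lean, `p / 0 = 0`. -/
def eval (st : State) : RatExpr → ℚ
  | zero => 0
  | one => 1
  | load a i => st.num a (i.eval st)
  | add p q => eval st p + eval st q
  | sub p q => eval st p - eval st q
  | mul p q => eval st p * eval st q
  | div p q => eval st p / eval st q

def cost : RatExpr → ℕ
  | zero => 1
  | one => 1
  | load _ i => i.cost + 1
  | add p q => cost p + cost q + 1
  | sub p q => cost p + cost q + 1
  | mul p q => cost p + cost q + 1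
  | div p q => cost p + cost q + 1

end RatExpr

namespace Cond

def Holds (st : State) : Cond → Prop
  | lt d e => d.eval st < e.eval st
  | eq d e => d.eval st = e.eval st
  | not b => ¬ Holds st b
  | and b c => Holds st b ∧ Holds st c

def cost : Cond → ℕ
  | lt d e => d.cost + e.cost + 1
  | eq d e => d.cost + e.cost + 1
  | not b => cost b + 1
  | and b c => cost b + cost c + 1

end Cond

def State.setReg (st : State) (x v : ℕ) : State :=
  { st with reg := Function.update st.reg x v }

def State.setArr (st : State) (a i v : ℕ) : State :=
  { st with arr := Function.update st.arr a (Function.update (st.arr a) i v) }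

def State.setNum (st : State) (a i : ℕ) (q : ℚ) : State :=
  { st with num := Function.update st.num a (Function.update (st.num a) i q) }

/-- `Exec p st k st'`: started in the memory `st`, the program `p` halts after exactly `k` steps
with the memory `st'`. -/
inductive Exec : Prog → State → ℕ → State → Prop
  | skip (st : State) : Exec .skip st 1 st
  | assign (x : ℕ) (e : NatExpr) (st : State) :
      Exec (.assign x e) st (e.cost + 1) (st.setReg x (e.eval st))
  | store (a : ℕ) (i e : NatExpr) (st : State) :
      Exec (.store a i e) st (i.cost + e.cost + 1) (st.setArr a (i.eval st) (e.eval st))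
  | storeNum (a : ℕ) (i : NatExpr) (q : RatExpr) (st : State) :
      Exec (.storeNum a i q) st (i.cost + q.cost + 1) (st.setNum a (i.eval st) (q.eval st))
  | seq {p q : Prog} {st st₁ st₂ : State} {k l : ℕ} :
      Exec p st k st₁ → Exec q st₁ l st₂ → Exec (.seq p q) st (k + l) st₂
  | ite_true {b : Cond} {p q : Prog} {st st' : State} {k : ℕ} :
      b.Holds st → Exec p st k st' → Exec (.ite b p q) st (b.cost + k + 1) st'
  | ite_false {b : Cond} {p q : Prog} {st st' : State} {k : ℕ} :
      ¬ b.Holds st → Exec q st k st' → Exec (.ite b p q) st (b.cost + k + 1) st'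
  | while_true {b : Cond} {p : Prog} {st st₁ st₂ : State} {k l : ℕ} :
      b.Holds st → Exec p st k st₁ → Exec (.while b p) st₁ l st₂ →
      Exec (.while b p) st (b.cost + k + l + 1) st₂
  | while_false {b : Cond} {p : Prog} {st : State} :
      ¬ b.Holds st → Exec (.while b p) st (b.cost + 1) st

end RAM

/-! Part 3: the computational problem. -/

namespace TemporalGraph

/-- The input: registers `0, 1, 2, 3` hold `n`, `T`, `M` and the parameter `Δ`; the arrays
`0, 1, 2` hold the starting points, endpoints and time steps of the arcs, in the order of the
list `L`.  All other memory cells are zero. -/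
def input (G : TemporalGraph) (Δ : ℕ) (L : List (TimeArc G.n)) : RAM.State where
  reg x := if x = 0 then G.n else if x = 1 then G.T else if x = 2 then G.M
    else if x = 3 then Δ else 0
  arr a i := if a = 0 then (L[i]?.map (fun e => (e.src : ℕ))).getD 0
    else if a = 1 then (L[i]?.map (fun e => (e.dst : ℕ))).getD 0
    else if a = 2 then (L[i]?.map TimeArc.time).getD 0 else 0
  num _ _ := 0

/-- The program `p`, given `G` (with its arcs listed in any order) and `Δ`, halts after at most
`k` steps and leaves the betweenness of every vertex `v` with respect to `𝒲` in cell `v` of the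
rational array `0`. -/
def ComputesBetweennessWithin (G : TemporalGraph) (Δ : ℕ) (𝒲 : Set (List (TimeArc G.n)))
    (p : RAM.Prog) (k : ℕ) : Prop :=
  ∀ L : List (TimeArc G.n), L.Nodup → (∀ e, e ∈ L ↔ e ∈ G.arcs) →
    ∃ (steps : ℕ) (st : RAM.State), RAM.Exec p (G.input Δ L) steps st ∧ steps ≤ k ∧
      ∀ v : Fin G.n, st.num 0 v = G.betweenness 𝒲 v

/-- The size `n² M T²`.  In a graph with at least one arc it is at least `n + 1`, so that the maximum
is `n² M T²` itself; in a graph without arcs it is the size `n + 1` of the output. -/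
def timeScale (G : TemporalGraph) : ℕ := max (G.n ^ 2 * G.M * G.T ^ 2) (G.n + 1)

end TemporalGraph

/-!
All five algorithms are instances of one program `mainProg`; its parameters are listed in `Variant`.

**State graph.** A walk from `s` is followed in the graph whose nodes are the pairs `(v, t)`: the
walk is at the vertex `v` and has arrived there at time `t`; it begins in `(s, 0)`. An edge is a
time arc together with the time of arrival at its tail, so that there are at most `M (T + 1)` edges, and
the conditions on consecutive time steps (order, strictness, bounded waiting) become a condition on
single edges, `EdgeOK`. Walks are stored in reverse there, as this makes extending them a `cons`.
The admissible temporal walks are exactly the trails of this graph (`trail_iff_isAdmissible`).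

**Optimal walks form an acyclic graph.** Rounds of the algorithm of Bellman and Ford give every
state a rank (`Prepared.ranked`): the least length of a walk to it or, for foremost walks, the
greatest one, which is correct at all states on the way to an earliest arrival. From the ranks one
reads off the least cost of a walk from `s` to each vertex (`BestFor.isOptimal_iff`). An edge is
active if the rank of its head exceeds that of its tail, by exactly one where least lengths are
concerned; for prefix-foremost walks, the time at its tail must also be the earliest arrival there.
All optimal walks use only active edges, and conversely a walk along active edges whose last edge
has the least cost is optimal
(`Ranked.optTrail_iff_of_shortest`, `Ranked.optTrail_iff_of_foremost`). Sorting the active edges by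
the ranks of their heads takes no more than another series of rounds.

**Counting.** Along the sorted active edges the number of walks to each state is obtained by adding
to the value at the head of an edge the value at its tail. The proof runs the same recursion with
multisets of walks, where every walk appears exactly once (`count_walksTo`), and then takes
cardinalities. `foldl_countStep` obtains the numbers `σ` of optimal walks. With a second value for
each vertex `v`, the number of walks that visit `v`, `foldl_dependencyStep` obtains the quotients
that the betweenness of `v` sums up; the sum over `v` at each active edge costs a factor `n`, but is
executed only once for each active edge, whereas there are at least `n` rounds anyway.
For fastest walks all this is done separately for each departure time `t₀ + 1`. An optimal walk
belongs to exactly one departure time, so that the counts add up (`Setup.sum_ncard`).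

**From paths to walks.** The program counts walks, whereas three of the five classes consist of
paths. If waiting times are not bounded, then a walk that visits a vertex twice can be cut short
(`exists_cut`), which neither postpones the arrival nor prolongs the duration but lowers the length.
Hence shortest walks, also those of minimum duration, are paths if `s ≠ z`; and if all prefixes of a
walk arrive as early as possible and the times increase strictly, then no vertex other than `s` is
entered twice, and entering `s` is ruled out by assigning it the arrival time `0`.
Bounded waiting times do not allow such shortcuts at a vertex, but they do at a state, and so
shortest restless walks have length at most `n (T + 1)`. If there are only finitely many foremost
walks, then none of them visits a state twice, as the part between the two visits could be repeated
(`exists_longer`); so their length is bounded in the same way, and the greatest lengths exist. The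
structure `Realizes` collects what the program has to know about a class of walks.

**Running time.** For each of the `n` starting points and each of the departure times the edges are
scanned in a number of rounds that exceeds the relevant lengths by a constant. There are `n + 3`
rounds for each of `T` departure times, or `n (T + 1) + 3` rounds for a single class of departure
times. In both cases this makes `O(n T)` scans of `M (T + 1)` edges, hence `O(n² M T²)` steps in
total.
-/

/-! ### Running times of structured programs -/

namespace RAM

/-- Started in `st`, the program `p` halts with the memory `st'` after at most `c` steps. -/
def Run (p : Prog) (st : State) (c : ℕ) (st' : State) : Prop :=
  ∃ k, k ≤ c ∧ Exec p st k st'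

namespace Run

variable {p q : Prog} {st st₁ st₂ st' : State} {b : Cond} {c d : ℕ}

theorem mono (h : Run p st c st') (hcd : c ≤ d) : Run p st d st' := by
  obtain ⟨k, hk, he⟩ := h
  exact ⟨k, hk.trans hcd, he⟩

theorem skip (st : State) : Run .skip st 1 st := ⟨_, le_rfl, .skip st⟩

theorem assign (x : ℕ) (e : NatExpr) (st : State) :
    Run (.assign x e) st (e.cost + 1) (st.setReg x (e.eval st)) := ⟨_, le_rfl, .assign x e st⟩

theorem store (a : ℕ) (i e : NatExpr) (st : State) :
    Run (.store a i e) st (i.cost + e.cost + 1) (st.setArr a (i.eval st) (e.eval st)) :=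
  ⟨_, le_rfl, .store a i e st⟩

theorem storeNum (a : ℕ) (i : NatExpr) (q : RatExpr) (st : State) :
    Run (.storeNum a i q) st (i.cost + q.cost + 1) (st.setNum a (i.eval st) (q.eval st)) :=
  ⟨_, le_rfl, .storeNum a i q st⟩

theorem seq (hp : Run p st c st₁) (hq : Run q st₁ d st₂) : Run (.seq p q) st (c + d) st₂ := by
  obtain ⟨k, hk, he⟩ := hp
  obtain ⟨l, hl, hf⟩ := hq
  exact ⟨k + l, add_le_add hk hl, .seq he hf⟩

theorem ite_pos (hb : b.Holds st) (hp : Run p st c st') :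
    Run (.ite b p q) st (b.cost + c + 1) st' := by
  obtain ⟨k, hk, he⟩ := hp
  exact ⟨_, by omega, .ite_true hb he⟩

theorem ite_neg (hb : ¬ b.Holds st) (hq : Run q st c st') :
    Run (.ite b p q) st (b.cost + c + 1) st' := by
  obtain ⟨k, hk, he⟩ := hq
  exact ⟨_, by omega, .ite_false hb he⟩

/-- A conditional without an alternative. -/
theorem guarded {P : Prop} [Decidable P] (hb : b.Holds st ↔ P) (hp : P → Run p st c st₁)
    (hc : 1 ≤ c) : Run (.ite b p .skip) st (b.cost + c + 1) (if P then st₁ else st) := by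
  by_cases h : P
  · rw [if_pos h]
    exact ite_pos (hb.2 h) (hp h)
  · rw [if_neg h]
    exact (ite_neg (fun h' => h (hb.1 h')) (skip st)).mono (by omega)

end Run

/-- The loop in which register `x` runs through all numbers below the content of register `y`.
The counter `x` has to be `0` at the start and is `0` again at the end. -/
def Prog.forLoop (x y : ℕ) (p : Prog) : Prog :=
  .seq (.while (.lt (.reg x) (.reg y)) (.seq p (.assign x (.add (.reg x) (.const 1)))))
    (.assign x (.const 0))

@[simp] theorem State.setReg_self (st : State) (x v : ℕ) : (st.setReg x v).reg x = v := by
  simp [State.setReg]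

theorem State.setReg_of_ne (st : State) {x y : ℕ} (v : ℕ) (h : y ≠ x) :
    (st.setReg x v).reg y = st.reg y := by
  simp [State.setReg, Function.update_of_ne h]

@[simp] theorem State.setReg_setReg (st : State) (x v w : ℕ) :
    (st.setReg x v).setReg x w = st.setReg x w := by
  simp [State.setReg]

theorem State.setReg_eq_self (st : State) {x v : ℕ} (h : st.reg x = v) : st.setReg x v = st := by
  subst h
  simp [State.setReg]

/-- The rule for counting loops, with an invariant `I` that is a relation, and with a bound `D i`
on the total costs of the first `i` iterations. -/
theorem Run.forLoop_total {x y N : ℕ} {p : Prog} (hxy : y ≠ x) (hN : 1 ≤ N) (D : ℕ → ℕ)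
    (I : ℕ → State → Prop) (hI : ∀ i st, I i st → st.reg x = 0 ∧ st.reg y = N)
    (hp : ∀ i st, i < N → I i st → ∃ st' d, 1 ≤ d ∧ D i + d ≤ D (i + 1) ∧
      I (i + 1) st' ∧ Run p (st.setReg x i) d (st'.setReg x i))
    {st : State} (h0 : I 0 st) :
    ∃ st', I N st' ∧ Run (.forLoop x y p) st (20 * D N) st' := by
  have key : ∀ d i st, i + d = N → I i st → ∃ st' k, I N st' ∧ 9 * D i + k ≤ 9 * D N ∧ 9 * d ≤ k ∧
      Run (.while (.lt (.reg x) (.reg y)) (.seq p (.assign x (.add (.reg x) (.const 1)))))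
        (st.setReg x i) (k + 4) (st'.setReg x N) := by
    intro d
    induction d with
    | zero =>
      intro i st hi h
      obtain rfl : i = N := by omega
      refine ⟨st, 0, h, by omega, by omega, _, ?_, Exec.while_false ?_⟩
      · simp [Cond.cost, NatExpr.cost]
      · simp [Cond.Holds, NatExpr.eval, State.setReg_of_ne _ _ hxy, (hI _ _ h).2]
    | succ d ih =>
      intro i st hi h
      obtain ⟨st₁, c, hc, hD, h₁, k, hk, he⟩ := hp i st (by omega) h
      obtain ⟨st₂, m, h₂, hm, hdm, l, hl, hf⟩ := ih (i + 1) st₁ (by omega) h₁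
      have ha := Exec.assign x (.add (.reg x) (.const 1)) (st₁.setReg x i)
      simp only [NatExpr.eval, State.setReg_self, State.setReg_setReg] at ha
      refine ⟨st₂, m + 9 * c, h₂, by omega, by omega, _, ?_,
        Exec.while_true ?_ (Exec.seq he ha) hf⟩
      · simp only [Cond.cost, NatExpr.cost]
        omega
      · simp only [Cond.Holds, NatExpr.eval, State.setReg_of_ne _ _ hxy, (hI _ _ h).2,
          State.setReg_self]
        omega
  obtain ⟨st', k, h', hk, hNk, hr⟩ := key N 0 st (by omega) h0
  refine ⟨st', h', ?_⟩
  rw [State.setReg_eq_self st (hI _ _ h0).1] at hr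
  have := hr.seq (Run.assign x (.const 0) _)
  simp only [NatExpr.eval, State.setReg_setReg, State.setReg_eq_self st' (hI _ _ h').1] at this
  refine this.mono ?_
  simp only [NatExpr.cost]
  omega

/-- The rule for counting loops, with an invariant that is a relation. -/
theorem Run.forLoop_inv {x y N c : ℕ} {p : Prog} (hxy : y ≠ x) (hN : 1 ≤ N) (hc : 1 ≤ c)
    (I : ℕ → State → Prop) (hI : ∀ i st, I i st → st.reg x = 0 ∧ st.reg y = N)
    (hp : ∀ i st, i < N → I i st →
      ∃ st', I (i + 1) st' ∧ Run p (st.setReg x i) c (st'.setReg x i))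
    {st : State} (h0 : I 0 st) :
    ∃ st', I N st' ∧ Run (.forLoop x y p) st (20 * (N * c)) st' := by
  refine Run.forLoop_total hxy hN (fun i => i * c) I hI (fun i st hi h => ?_) h0
  obtain ⟨st', h', hr⟩ := hp i st hi h
  exact ⟨st', c, hc, (Nat.succ_mul i c).ge, h', hr⟩

/-- The rule for counting loops, with the exact memory before each iteration, and with a bound
`D i` on the total costs of the first `i` iterations. -/
theorem Run.forLoop_sum {x y N : ℕ} {p : Prog} (hxy : y ≠ x) (hN : 1 ≤ N) (D : ℕ → ℕ)
    (g : ℕ → State) (hg : ∀ i, (g i).reg x = 0 ∧ (g i).reg y = N)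
    (hp : ∀ i < N, ∃ d, 1 ≤ d ∧ D i + d ≤ D (i + 1) ∧
      Run p ((g i).setReg x i) d ((g (i + 1)).setReg x i)) :
    Run (.forLoop x y p) (g 0) (20 * D N) (g N) := by
  obtain ⟨st', rfl, h⟩ := Run.forLoop_total hxy hN D (fun i st => st = g i)
    (by rintro i st rfl; exact hg i)
    (by
      rintro i st hi rfl
      obtain ⟨d, h1, h2, h3⟩ := hp i hi
      exact ⟨_, d, h1, h2, rfl, h3⟩) (st := g 0) rfl
  exact h

/-- The rule for counting loops, with the exact memory before each iteration. -/
theorem Run.forLoop {x y N c : ℕ} {p : Prog} (hxy : y ≠ x) (hN : 1 ≤ N) (hc : 1 ≤ c)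
    (g : ℕ → State) (hg : ∀ i, (g i).reg x = 0 ∧ (g i).reg y = N)
    (hp : ∀ i < N, Run p ((g i).setReg x i) c ((g (i + 1)).setReg x i)) :
    Run (.forLoop x y p) (g 0) (20 * (N * c)) (g N) :=
  Run.forLoop_sum hxy hN (fun i => i * c) g hg
    fun i hi => ⟨c, hc, (Nat.succ_mul i c).ge, hp i hi⟩

end RAM

namespace TemporalBetweenness

open RAM

/-! ### The state graph -/

/-- The parameters in which the five algorithms differ. -/
structure Variant where
  /-- The least difference between consecutive time steps: `1` for strict walks, `0` otherwise. -/
  gap : ℕ := 0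
  /-- The time steps of consecutive transitions may differ by at most the input parameter. -/
  restless : Bool := false
  /-- Walks with different departure times are treated separately, and the duration counts. -/
  multi : Bool := false
  /-- Walks are compared by their arrival time, and states are ranked by the length of a longest
  walk; otherwise the length counts, and states are ranked by the length of a shortest walk. -/
  foremost : Bool := false
  /-- Walks that return to their starting point at the end count. -/
  closed : Bool := false
  /-- All prefixes of an optimal walk have to be optimal. -/
  prefixOpt : Bool := false

namespace Variant

variable (c : Variant)

/-- The greatest admissible difference between consecutive time steps. -/
def lim (T Δ : ℕ) : ℕ := if c.restless then Δ else T

/-- A number that the lengths of all relevant walks stay below. -/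
def rounds (n T : ℕ) : ℕ := if c.restless || c.foremost then n * (T + 1) + 3 else n + 3

/-- The number of classes of departure times. -/
def starts (T : ℕ) : ℕ := if c.multi then T else 1

end Variant

/-- An edge of the state graph: the pair `(f, t)` stands for the use of the time arc `f` in the
state `(f.src, t)`, which leads to the state `(f.dst, f.time)`.  The starting point of all walks
is the state `(s, 0)`. -/
abbrev Edge (n : ℕ) := TimeArc n × ℕ

variable {n : ℕ}

/-- The state in which the time arc of the edge is used. -/
def tail (e : Edge n) : ℕ × ℕ := (e.1.src, e.2)

/-- The state that the edge leads to. -/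
def head (e : Edge n) : ℕ × ℕ := (e.1.dst, e.1.time)

/-- The edge can be used on walks from `s` whose departure time is in class `t₀`. -/
def EdgeOK (c : Variant) (lim s t₀ : ℕ) (e : Edge n) : Prop :=
  (e.2 = 0 ∧ (e.1.src : ℕ) = s ∧ (c.multi = true → e.1.time = t₀ + 1)) ∨
    (0 < e.2 ∧ e.2 + c.gap ≤ e.1.time ∧ e.1.time ≤ e.2 + lim)

instance (c : Variant) (lim s t₀ : ℕ) (e : Edge n) : Decidable (EdgeOK c lim s t₀ e) := by
  unfold EdgeOK; infer_instance

/-- The edges of the state graph for walks from `s` with departure time in class `t₀`. -/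
def edges (c : Variant) (T lim : ℕ) (L : List (TimeArc n)) (s t₀ : ℕ) : List (Edge n) :=
  L.flatMap fun f => ((List.range (T + 1)).map fun t => (f, t)).filter
    fun e => decide (EdgeOK c lim s t₀ e)

/-- The edge yields a better rank of its head.  The rank of a state is `0` as long as the state has
not been reached, and one more than the length of a walk to it afterwards. -/
def Improves (c : Variant) (φ : ℕ × ℕ → ℕ) (e : Edge n) : Prop :=
  φ (tail e) ≠ 0 ∧ (φ (head e) = 0 ∨
    if c.foremost then φ (head e) < φ (tail e) + 1 else φ (tail e) + 1 < φ (head e))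

instance (c : Variant) (φ : ℕ × ℕ → ℕ) (e : Edge n) : Decidable (Improves c φ e) := by
  unfold Improves; infer_instance

/-- One relaxation step of the algorithm of Bellman and Ford. -/
def relax (c : Variant) (φ : ℕ × ℕ → ℕ) (e : Edge n) : ℕ × ℕ → ℕ :=
  if Improves c φ e then Function.update φ (head e) (φ (tail e) + 1) else φ

/-- The cost of a best walk that ends with the transition `f`, in terms of the ranks. -/
def key (c : Variant) (R t₀ : ℕ) (φ : ℕ × ℕ → ℕ) (f : TimeArc n) : ℕ :=
  if c.foremost then f.time
  else if c.multi then (f.time - (t₀ + 1)) * (R + 1) + φ (f.dst, f.time) else φ (f.dst, f.time)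

/-- Optimal walks continue from the tail of the edge to its head. -/
def Active (c : Variant) (φ : ℕ × ℕ → ℕ) (best : ℕ → ℕ) (e : Edge n) : Prop :=
  φ (tail e) ≠ 0 ∧ if c.foremost then φ (tail e) < φ (head e) ∧
    (c.prefixOpt = true → e.2 = 0 ∨ best e.1.src = e.2) else φ (tail e) + 1 = φ (head e)

instance (c : Variant) (φ : ℕ × ℕ → ℕ) (best : ℕ → ℕ) (e : Edge n) :
    Decidable (Active c φ best e) := by
  unfold Active; infer_instance

/-- The active edges, sorted by the ranks of their heads. -/
def sortedEdges (c : Variant) (R : ℕ) (φ : ℕ × ℕ → ℕ) (best : ℕ → ℕ) (E : List (Edge n)) :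
    List (Edge n) :=
  (List.range R).flatMap fun r => E.filter
    fun e => decide (Active c φ best e ∧ φ (head e) = r + 1)

/-! ### The layout of the memory -/

/-- The part of the memory that the main part of the algorithm only reads. -/
structure Consts where
  (n T M Δ T1 Q lim R T0 acc : ℕ)
  (src dst tim row slab wgt : ℕ → ℕ)

/-- The part of the memory that the main part of the algorithm modifies: the loop counters, the
least cost of a walk to each vertex, the rank of each state, the betweenness, the number of
optimal walks to each vertex, and for each state the number of walks to it, in total and through
each vertex. -/
structure Mem where
  (s t₀ j t r v : ℕ)
  best : ℕ → ℕ
  phi : ℕ × ℕ → ℕ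
  (out sig : ℕ → ℚ)
  Y : ℕ × ℕ → ℚ
  Z : ℕ → ℕ × ℕ → ℚ

/-- The state `(v, t)` is stored in cell `v * (T + 1) + t`. -/
def node (T i : ℕ) : ℕ × ℕ := (i / (T + 1), i % (T + 1))

/-- The machine state that stores the constants `K` and the variables `μ`. The registers `10` to
`15` are loop counters. -/
def toState (K : Consts) (μ : Mem) : State where
  reg x := match x with
    | 0 => K.n | 1 => K.T | 2 => K.M | 3 => K.Δ | 4 => K.T1 | 5 => K.Q | 6 => K.lim | 7 => K.R
    | 8 => K.T0 | 9 => K.acc | 10 => μ.s | 11 => μ.t₀ | 12 => μ.j | 13 => μ.t | 14 => μ.r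
    | 15 => μ.v | _ => 0
  arr a := match a with
    | 0 => K.src | 1 => K.dst | 2 => K.tim | 3 => K.row | 4 => K.slab | 5 => K.wgt
    | 6 => μ.best | 7 => fun i => μ.phi (node K.T i) | _ => fun _ => 0
  num a := match a with
    | 0 => μ.out | 1 => μ.sig | 2 => fun i => μ.Y (node K.T i)
    | 3 => fun i => μ.Z (i / (K.n * (K.T + 1))) (node K.T (i % (K.n * (K.T + 1))))
    | _ => fun _ => 0

variable (K : Consts) (μ : Mem)

theorem setReg_toState {st' : State} (x v : ℕ) (h : (toState K μ).arr = st'.arr)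
    (h' : (toState K μ).num = st'.num)
    (hr : ∀ y, st'.reg y = if y = x then v else (toState K μ).reg y) :
    (toState K μ).setReg x v = st' := by
  cases st'
  simp only [State.setReg, State.mk.injEq]
  refine ⟨?_, h, h'⟩
  funext y
  rw [Function.update_apply]
  exact (hr y).symm

theorem setReg_s (x : ℕ) : (toState K μ).setReg 10 x = toState K { μ with s := x } :=
  setReg_toState _ _ _ _ rfl rfl fun y => by
    by_cases h : y = 10
    · subst h; rfl
    · rw [if_neg h]; dsimp only [toState]; split <;> first | rfl | contradiction

theorem setReg_t₀ (x : ℕ) : (toState K μ).setReg 11 x = toState K { μ with t₀ := x } :=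
  setReg_toState _ _ _ _ rfl rfl fun y => by
    by_cases h : y = 11
    · subst h; rfl
    · rw [if_neg h]; dsimp only [toState]; split <;> first | rfl | contradiction

theorem setReg_j (x : ℕ) : (toState K μ).setReg 12 x = toState K { μ with j := x } :=
  setReg_toState _ _ _ _ rfl rfl fun y => by
    by_cases h : y = 12
    · subst h; rfl
    · rw [if_neg h]; dsimp only [toState]; split <;> first | rfl | contradiction

theorem setReg_t (x : ℕ) : (toState K μ).setReg 13 x = toState K { μ with t := x } :=
  setReg_toState _ _ _ _ rfl rfl fun y => by
    by_cases h : y = 13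
    · subst h; rfl
    · rw [if_neg h]; dsimp only [toState]; split <;> first | rfl | contradiction

theorem setReg_r (x : ℕ) : (toState K μ).setReg 14 x = toState K { μ with r := x } :=
  setReg_toState _ _ _ _ rfl rfl fun y => by
    by_cases h : y = 14
    · subst h; rfl
    · rw [if_neg h]; dsimp only [toState]; split <;> first | rfl | contradiction

theorem setReg_v (x : ℕ) : (toState K μ).setReg 15 x = toState K { μ with v := x } :=
  setReg_toState _ _ _ _ rfl rfl fun y => by
    by_cases h : y = 15
    · subst h; rfl
    · rw [if_neg h]; dsimp only [toState]; split <;> first | rfl | contradiction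

theorem node_add {T a t : ℕ} (ht : t ≤ T) : node T (a * (T + 1) + t) = (a, t) := by
  have ht' : t < T + 1 := by omega
  simp only [node, Prod.mk.injEq]
  constructor
  · rw [mul_comm, Nat.mul_add_div (by omega), Nat.div_eq_of_lt ht', add_zero]
  · rw [mul_comm, Nat.mul_add_mod, Nat.mod_eq_of_lt ht']

theorem node_injective (T : ℕ) : Function.Injective (node T) := fun i j h => by
  simp only [node, Prod.mk.injEq] at h
  rw [← Nat.div_add_mod i (T + 1), h.1, h.2, Nat.div_add_mod]

theorem update_comp_node {α : Type*} {T i : ℕ} {q : ℕ × ℕ} (hq : node T i = q) (f : ℕ × ℕ → α)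
    (x : α) : Function.update (fun i => f (node T i)) i x =
      fun i => Function.update f q x (node T i) := by
  subst hq
  exact (Function.update_comp_eq_of_injective f (node_injective T) i x).symm

theorem setArr_best (i x : ℕ) :
    (toState K μ).setArr 6 i x = toState K { μ with best := Function.update μ.best i x } := by
  simp only [State.setArr, toState, State.mk.injEq, true_and, and_true]
  funext a
  by_cases h : a = 6
  · subst h; rfl
  · rw [Function.update_of_ne h]; split <;> first | rfl | contradiction

theorem setArr_phi {i : ℕ} {q : ℕ × ℕ} (x : ℕ) (hq : node K.T i = q) :
    (toState K μ).setArr 7 i x = toState K { μ with phi := Function.update μ.phi q x } := by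
  simp only [State.setArr, toState, State.mk.injEq, true_and, and_true]
  funext a
  by_cases h : a = 7
  · subst h
    rw [Function.update_self]
    exact update_comp_node hq _ _
  · rw [Function.update_of_ne h]; split <;> first | rfl | contradiction

theorem setNum_out (i : ℕ) (x : ℚ) :
    (toState K μ).setNum 0 i x = toState K { μ with out := Function.update μ.out i x } := by
  simp only [State.setNum, toState, State.mk.injEq, true_and]
  funext a
  by_cases h : a = 0
  · subst h; rfl
  · rw [Function.update_of_ne h]; split <;> first | rfl | contradiction

theorem setNum_sig (i : ℕ) (x : ℚ) :
    (toState K μ).setNum 1 i x = toState K { μ with sig := Function.update μ.sig i x } := by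
  simp only [State.setNum, toState, State.mk.injEq, true_and]
  funext a
  by_cases h : a = 1
  · subst h; rfl
  · rw [Function.update_of_ne h]; split <;> first | rfl | contradiction

theorem setNum_Y {i : ℕ} {q : ℕ × ℕ} (x : ℚ) (hq : node K.T i = q) :
    (toState K μ).setNum 2 i x = toState K { μ with Y := Function.update μ.Y q x } := by
  simp only [State.setNum, toState, State.mk.injEq, true_and]
  funext a
  by_cases h : a = 2
  · subst h
    rw [Function.update_self]
    exact update_comp_node hq _ _
  · rw [Function.update_of_ne h]; split <;> first | rfl | contradiction

theorem index_lt {n T a t : ℕ} (ha : a < n) (ht : t ≤ T) : a * (T + 1) + t < n * (T + 1) := by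
  have := Nat.mul_le_mul_right (T + 1) (Nat.succ_le_of_lt ha)
  rw [Nat.succ_mul] at this
  omega

/-- Only the cells below `n * (T + 1)` belong to the vertex `v`, whence the bound on `i`. -/
theorem setNum_Z {v i : ℕ} {q : ℕ × ℕ} (x : ℚ) (hi : i < K.n * (K.T + 1)) (hq : node K.T i = q) :
    (toState K μ).setNum 3 (v * (K.n * (K.T + 1)) + i) x =
      toState K { μ with Z := Function.update μ.Z v (Function.update (μ.Z v) q x) } := by
  simp only [State.setNum, toState, State.mk.injEq, true_and]
  funext a
  by_cases h : a = 3
  · subst h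
    rw [Function.update_self]
    funext k
    change _ = Function.update μ.Z v (Function.update (μ.Z v) q x) (k / (K.n * (K.T + 1)))
      (node K.T (k % (K.n * (K.T + 1))))
    have hpos : 0 < K.n * (K.T + 1) := by omega
    rw [Function.update_apply]
    by_cases hk : k = v * (K.n * (K.T + 1)) + i
    · subst hk
      rw [if_pos rfl, mul_comm v, Nat.mul_add_div hpos, Nat.div_eq_of_lt hi, Nat.mul_add_mod,
        Nat.mod_eq_of_lt hi, hq]
      simp
    · rw [if_neg hk]
      by_cases hv : k / (K.n * (K.T + 1)) = v
      · rw [hv, Function.update_self, Function.update_of_ne]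
        rintro h'
        have := node_injective _ (h'.trans hq.symm)
        rw [← this, ← hv, mul_comm, Nat.div_add_mod] at hk
        exact hk rfl
      · rw [Function.update_of_ne hv]
  · rw [Function.update_of_ne h]; split <;> first | rfl | contradiction

end TemporalBetweenness

namespace TemporalBetweenness

open RAM

variable {n : ℕ}

/-! ### Loops through the edges of the state graph -/

/-- The starting point of the current time arc. -/
def arcSrc : NatExpr := .load 0 (.reg 12)

/-- The endpoint of the current time arc. -/
def arcDst : NatExpr := .load 1 (.reg 12)

/-- The time step of the current time arc. -/
def arcTime : NatExpr := .load 2 (.reg 12)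

/-- The cell of the tail of the current edge. -/
def tailCell : NatExpr := .add (.load 3 arcSrc) (.reg 13)

/-- The cell of the head of the current edge. -/
def headCell : NatExpr := .add (.load 3 arcDst) arcTime

/-- Disjunction. -/
def condOr (a b : Cond) : Cond := .not (.and (.not a) (.not b))

/-- The condition `d ≤ e`. -/
def condLe (d e : NatExpr) : Cond := .not (.lt e d)

/-- A condition that is checked only if the flag is set. -/
def condIf (flag : Bool) (b : Cond) : Cond := if flag then b else .eq (.const 0) (.const 0)

/-- The test whether the current time arc and time step form an edge, see `EdgeOK`. -/
def edgeCond (c : Variant) : Cond :=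
  condOr (.and (.eq (.reg 13) (.const 0)) (.and (.eq arcSrc (.reg 10))
      (condIf c.multi (.eq arcTime (.add (.reg 11) (.const 1))))))
    (.and (.lt (.const 0) (.reg 13)) (.and (condLe (.add (.reg 13) (.const c.gap)) arcTime)
      (condLe arcTime (.add (.reg 13) (.reg 6)))))

/-- The loop through all edges. -/
def forEdges (c : Variant) (p : Prog) : Prog :=
  .forLoop 12 2 (.forLoop 13 4 (.ite (edgeCond c) p .skip))

/-- The rank of the tail of the current edge. -/
def rankTail : NatExpr := .load 7 tailCell

/-- The rank of the head of the current edge. -/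
def rankHead : NatExpr := .load 7 headCell

/-- Implements `relax`. -/
def relaxProg (c : Variant) : Prog :=
  .ite (.and (.not (.eq rankTail (.const 0))) (condOr (.eq rankHead (.const 0))
      (if c.foremost then .lt rankHead (.add rankTail (.const 1))
        else .lt (.add rankTail (.const 1)) rankHead)))
    (.store 7 headCell (.add rankTail (.const 1))) .skip

/-- Implements `key`. There is no multiplication, so the multiples of `R + 1` are read from a table.
-/
def keyExpr (c : Variant) : NatExpr :=
  if c.foremost then arcTime
  else if c.multi then .add (.load 5 (.sub arcTime (.add (.reg 11) (.const 1)))) rankHead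
  else rankHead

/-- The test whether the current edge is active, see `Active`. -/
def activeCond (c : Variant) : Cond :=
  .and (.not (.eq rankTail (.const 0)))
    (if c.foremost then .and (.lt rankTail rankHead)
      (condIf c.prefixOpt (condOr (.eq (.reg 13) (.const 0)) (.eq (.load 6 arcSrc) (.reg 13))))
      else .eq (.add rankTail (.const 1)) rankHead)

/-- The loop through all active edges, in the order of the ranks of their heads. -/
def forSorted (c : Variant) (p : Prog) : Prog :=
  .forLoop 14 7 (forEdges c
    (.ite (.and (activeCond c) (.eq rankHead (.add (.reg 14) (.const 1)))) p .skip))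

theorem holds_condOr {st : State} {a b : Cond} :
    (condOr a b).Holds st ↔ a.Holds st ∨ b.Holds st := by
  simp only [condOr, Cond.Holds]; tauto

theorem holds_condLe {st : State} {d e : NatExpr} :
    (condLe d e).Holds st ↔ d.eval st ≤ e.eval st := by
  simp only [condLe, Cond.Holds, not_lt]

theorem holds_condIf {st : State} {flag : Bool} {b : Cond} :
    (condIf flag b).Holds st ↔ (flag = true → b.Holds st) := by
  cases flag <;> simp [condIf, Cond.Holds]

/-- The constant part of the memory is as the main part of the algorithm needs it. -/
structure Ready (c : Variant) (T Δ : ℕ) (L : List (TimeArc n)) (K : Consts) : Prop where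
  n_eq : K.n = n
  T_eq : K.T = T
  M_eq : K.M = L.length
  T1_eq : K.T1 = T + 1
  lim_eq : K.lim = c.lim T Δ
  R_eq : K.R = c.rounds n T
  T0_eq : K.T0 = c.starts T
  src_eq : ∀ j f, L[j]? = some f → K.src j = f.src
  dst_eq : ∀ j f, L[j]? = some f → K.dst j = f.dst
  tim_eq : ∀ j f, L[j]? = some f → K.tim j = f.time
  row_eq : ∀ v < n, K.row v = v * (T + 1)
  slab_eq : ∀ v < n, K.slab v = v * (n * (T + 1))
  wgt_eq : ∀ d ≤ T, K.wgt d = d * (c.rounds n T + 1)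
  time_le : ∀ f ∈ L, f.time ≤ T
  one_le_M : 1 ≤ L.length
  one_le_T : 1 ≤ T
  one_le_n : 1 ≤ n

/-- The loop counters point to the edge `e`. -/
structure AtEdge (T : ℕ) (L : List (TimeArc n)) (μ : Mem) (e : Edge n) : Prop where
  arc : L[μ.j]? = some e.1
  time_eq : μ.t = e.2
  time_le : e.2 ≤ T

section

variable {c : Variant} {T Δ : ℕ} {L : List (TimeArc n)} {K : Consts} {μ : Mem} {e : Edge n}

theorem Ready.eval_arcSrc (h : Ready c T Δ L K) (he : AtEdge T L μ e) :
    arcSrc.eval (toState K μ) = e.1.src := h.src_eq _ _ he.arc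

theorem Ready.eval_arcDst (h : Ready c T Δ L K) (he : AtEdge T L μ e) :
    arcDst.eval (toState K μ) = e.1.dst := h.dst_eq _ _ he.arc

theorem Ready.eval_arcTime (h : Ready c T Δ L K) (he : AtEdge T L μ e) :
    arcTime.eval (toState K μ) = e.1.time := h.tim_eq _ _ he.arc

theorem Ready.eval_tailCell (h : Ready c T Δ L K) (he : AtEdge T L μ e) :
    tailCell.eval (toState K μ) = e.1.src * (T + 1) + e.2 := by
  have : tailCell.eval (toState K μ) = K.row (arcSrc.eval (toState K μ)) + μ.t := rfl
  rw [this, h.eval_arcSrc he, h.row_eq _ e.1.src.2, he.time_eq]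

theorem Ready.eval_headCell (h : Ready c T Δ L K) (he : AtEdge T L μ e) :
    headCell.eval (toState K μ) = e.1.dst * (T + 1) + e.1.time := by
  have : headCell.eval (toState K μ) =
    K.row (arcDst.eval (toState K μ)) + arcTime.eval (toState K μ) := rfl
  rw [this, h.eval_arcDst he, h.eval_arcTime he, h.row_eq _ e.1.dst.2]

theorem Ready.time_le' (h : Ready c T Δ L K) (he : AtEdge T L μ e) : e.1.time ≤ T :=
  h.time_le _ (List.mem_of_getElem? he.arc)

theorem Ready.node_tail (h : Ready c T Δ L K) (he : AtEdge T L μ e) :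
    node K.T (tailCell.eval (toState K μ)) = tail e := by
  rw [h.eval_tailCell he, h.T_eq, node_add he.time_le]; rfl

theorem Ready.node_head (h : Ready c T Δ L K) (he : AtEdge T L μ e) :
    node K.T (headCell.eval (toState K μ)) = head e := by
  rw [h.eval_headCell he, h.T_eq, node_add (h.time_le' he)]; rfl

theorem Ready.tailCell_lt (h : Ready c T Δ L K) (he : AtEdge T L μ e) :
    tailCell.eval (toState K μ) < K.n * (K.T + 1) := by
  rw [h.eval_tailCell he, h.T_eq, h.n_eq]
  exact index_lt e.1.src.2 he.time_le

theorem Ready.headCell_lt (h : Ready c T Δ L K) (he : AtEdge T L μ e) :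
    headCell.eval (toState K μ) < K.n * (K.T + 1) := by
  rw [h.eval_headCell he, h.T_eq, h.n_eq]
  exact index_lt e.1.dst.2 (h.time_le' he)

theorem Ready.eval_rankTail (h : Ready c T Δ L K) (he : AtEdge T L μ e) :
    rankTail.eval (toState K μ) = μ.phi (tail e) := by
  rw [← h.node_tail he]; rfl

theorem Ready.eval_rankHead (h : Ready c T Δ L K) (he : AtEdge T L μ e) :
    rankHead.eval (toState K μ) = μ.phi (head e) := by
  rw [← h.node_head he]; rfl

theorem Ready.holds_edgeCond (h : Ready c T Δ L K) (he : AtEdge T L μ e) :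
    (edgeCond c).Holds (toState K μ) ↔ EdgeOK c (c.lim T Δ) μ.s μ.t₀ e := by
  have h13 : (NatExpr.reg 13).eval (toState K μ) = e.2 := he.time_eq
  have h6 : (NatExpr.reg 6).eval (toState K μ) = c.lim T Δ := h.lim_eq
  have h10 : (NatExpr.reg 10).eval (toState K μ) = μ.s := rfl
  have h11 : (NatExpr.reg 11).eval (toState K μ) = μ.t₀ := rfl
  simp only [edgeCond, holds_condOr, holds_condLe, holds_condIf, Cond.Holds, h.eval_arcSrc he,
    h.eval_arcTime he, NatExpr.eval.eq_1, NatExpr.eval.eq_4, h13, h6, h10, h11, EdgeOK]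

theorem Ready.eval_keyExpr (h : Ready c T Δ L K) (he : AtEdge T L μ e) :
    (keyExpr c).eval (toState K μ) = key c (c.rounds n T) μ.t₀ μ.phi e.1 := by
  unfold keyExpr key
  split_ifs
  · exact h.eval_arcTime he
  · have : NatExpr.eval (toState K μ) (.add (.load 5 (.sub arcTime (.add (.reg 11) (.const 1))))
      rankHead) = K.wgt (arcTime.eval (toState K μ) - (μ.t₀ + 1)) + rankHead.eval (toState K μ) :=
      rfl
    rw [this, h.eval_arcTime he, h.eval_rankHead he, h.wgt_eq _ (by have := h.time_le' he; omega)]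
    rfl
  · exact h.eval_rankHead he

theorem Ready.holds_activeCond (h : Ready c T Δ L K) (he : AtEdge T L μ e) :
    (activeCond c).Holds (toState K μ) ↔ Active c μ.phi μ.best e := by
  have h13 : (NatExpr.reg 13).eval (toState K μ) = e.2 := he.time_eq
  have h6 : (NatExpr.load 6 arcSrc).eval (toState K μ) = μ.best e.1.src := by
    rw [← h.eval_arcSrc he]; rfl
  unfold activeCond Active
  split_ifs <;>
  simp only [holds_condOr, holds_condIf, Cond.Holds, h.eval_rankTail he, h.eval_rankHead he,
    NatExpr.eval.eq_1, NatExpr.eval.eq_4, h13, h6, ne_eq]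

theorem cost_edgeCond (c : Variant) : (edgeCond c).cost ≤ 50 := by
  unfold edgeCond condIf
  split_ifs <;> simp [condOr, condLe, Cond.cost, NatExpr.cost, arcSrc, arcTime]

theorem cost_activeCond (c : Variant) : (activeCond c).cost ≤ 80 := by
  unfold activeCond condIf
  split_ifs <;> simp [condOr, Cond.cost, NatExpr.cost, arcSrc, arcTime, arcDst, rankTail, rankHead,
    tailCell, headCell]

theorem cost_keyExpr (c : Variant) : (keyExpr c).cost ≤ 30 := by
  unfold keyExpr
  split_ifs <;> simp [NatExpr.cost, arcTime, arcDst, rankHead, headCell]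

/-- The total cost of the loop through all pairs of a time arc and a time step, if only the edges
cause a cost `w` beyond that of the test. -/
theorem sum_map_edges (c : Variant) (T lim : ℕ) (L : List (TimeArc n)) (s t₀ : ℕ)
    (w : Edge n → ℕ) : (L.map fun f => ((List.range (T + 1)).map fun t =>
      60 + if EdgeOK c lim s t₀ (f, t) then w (f, t) else 0).sum).sum =
      L.length * ((T + 1) * 60) + ((edges c T lim L s t₀).map w).sum := by
  have h1 : ∀ (f : TimeArc n) (l : List ℕ), (l.map fun t =>
      60 + if EdgeOK c lim s t₀ (f, t) then w (f, t) else 0).sum = l.length * 60 +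
      (((l.map fun t => (f, t)).filter fun e => decide (EdgeOK c lim s t₀ e)).map w).sum := by
    intro f l
    induction l with
    | nil => simp
    | cons t l ih =>
      rw [List.map_cons, List.sum_cons, ih]
      by_cases h : EdgeOK c lim s t₀ (f, t) <;> simp [h] <;> ring
  induction L with
  | nil => simp [edges]
  | cons f L ih =>
    rw [List.map_cons, List.sum_cons, ih, h1]
    simp only [edges, List.length_range, List.length_cons, List.flatMap_cons, List.map_append,
      List.sum_append]
    ring

theorem length_edges_le (c : Variant) (T lim : ℕ) (L : List (TimeArc n)) (s t₀ : ℕ) :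
    (edges c T lim L s t₀).length ≤ L.length * (T + 1) := by
  unfold edges
  induction L with
  | nil => simp
  | cons f L ih =>
    rw [List.flatMap_cons, List.length_append, List.length_cons, Nat.succ_mul, add_comm]
    refine add_le_add ih ((List.length_filter_le _ _).trans ?_)
    simp

/-- The rule for the loop through all edges.  The data of type `α` that the loop modifies is part
of the memory by way of `put`. -/
theorem Ready.run_forEdges_sum (h : Ready c T Δ L K) {α : Type*} (put : α → Mem)
    (step : α → Edge n → α) {s t₀ : ℕ} (w : Edge n → ℕ) {p : Prog}
    (hput : ∀ a, (put a).j = 0 ∧ (put a).t = 0 ∧ (put a).s = s ∧ (put a).t₀ = t₀)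
    (hp : ∀ a e j, e ∈ edges c T (c.lim T Δ) L s t₀ →
      AtEdge T L { put a with j := j, t := e.2 } e →
      Run p (toState K { put a with j := j, t := e.2 }) (w e)
        (toState K { put (step a e) with j := j, t := e.2 })) (a : α) :
    Run (forEdges c p) (toState K (put a))
      (400 * (L.length * ((T + 1) * 60) + ((edges c T (c.lim T Δ) L s t₀).map w).sum))
      (toState K (put ((edges c T (c.lim T Δ) L s t₀).foldl step a))) := by
  set stepT : TimeArc n → α → ℕ → α := fun f a t =>
    if EdgeOK c (c.lim T Δ) s t₀ (f, t) then step a (f, t) else a with hstepT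
  set stepF : α → TimeArc n → α := fun a f => (List.range (T + 1)).foldl (stepT f) a with hstepF
  set wT : TimeArc n → ℕ → ℕ := fun f t =>
    60 + if EdgeOK c (c.lim T Δ) s t₀ (f, t) then w (f, t) else 0 with hwT
  set wF : TimeArc n → ℕ := fun f => ((List.range (T + 1)).map (wT f)).sum with hwF
  have hinner : ∀ a j f, L[j]? = some f → Run (.forLoop 13 4 (.ite (edgeCond c) p .skip))
      (toState K { put a with j := j }) (20 * wF f)
      (toState K { put (stepF a f) with j := j }) := by
    intro a j f hf
    refine Run.forLoop_sum (by decide) (by omega) (fun i => ((List.range i).map (wT f)).sum)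
      (fun i => toState K { put ((List.range i).foldl (stepT f) a) with j := j })
      (fun i => ⟨(hput _).2.1, h.T1_eq⟩) ?_
    intro i hi
    refine ⟨wT f i, ?_, ?_, ?_⟩
    · rw [hwT]; dsimp only; omega
    · simp [List.range_succ]
    simp only [setReg_t, List.range_succ, List.foldl_append, List.foldl_cons, List.foldl_nil]
    generalize (List.range i).foldl (stepT f) a = b
    have hat : AtEdge T L { put b with j := j, t := i } (f, i) := ⟨hf, rfl, by simpa using hi⟩
    have hcond : (edgeCond c).Holds (toState K { put b with j := j, t := i }) ↔
        EdgeOK c (c.lim T Δ) s t₀ (f, i) := by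
      rw [← (hput b).2.2.1, ← (hput b).2.2.2]
      exact h.holds_edgeCond hat
    by_cases hok : EdgeOK c (c.lim T Δ) s t₀ (f, i)
    · rw [hstepT, hwT]
      simp only [if_pos hok]
      have hmem : (f, i) ∈ edges c T (c.lim T Δ) L s t₀ := ?_
      · have hcost := cost_edgeCond c
        refine (Run.ite_pos (hcond.2 hok) (hp b (f, i) j hmem hat)).mono ?_
        omega
      simp only [edges, List.mem_flatMap, List.mem_filter, List.mem_map, List.mem_range,
        decide_eq_true_eq]
      exact ⟨f, List.mem_of_getElem? hf, ⟨i, hi, rfl⟩, hok⟩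
    · rw [hstepT, hwT]
      simp only [if_neg hok]
      have hcost := cost_edgeCond c
      refine (Run.ite_neg (fun h' => hok (hcond.1 h')) (Run.skip _)).mono ?_
      omega
  have hfold : (edges c T (c.lim T Δ) L s t₀).foldl step a = L.foldl stepF a := by
    simp only [edges, List.foldl_flatMap, List.foldl_filter, List.foldl_map, hstepF, hstepT,
      decide_eq_true_eq]
  rw [hfold, ← sum_map_edges]
  have := Run.forLoop_sum (x := 12) (y := 2) (N := L.length)
    (p := .forLoop 13 4 (.ite (edgeCond c) p .skip)) (by decide) h.one_le_M
    (fun i => 20 * ((L.take i).map wF).sum)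
    (fun i => toState K (put ((L.take i).foldl stepF a))) (fun i => ⟨(hput _).1, h.M_eq⟩) ?_
  · simp only [List.take_length, List.take_zero, List.foldl_nil] at this
    refine this.mono ?_
    change 20 * (20 * (L.map wF).sum) ≤ 400 * (L.map wF).sum
    omega
  · intro i hi
    simp only [setReg_j]
    rw [List.take_add_one, List.getElem?_eq_getElem hi, Option.toList_some, List.foldl_append,
      List.foldl_cons, List.foldl_nil]
    refine ⟨20 * wF L[i], ?_, ?_, hinner _ _ _ (List.getElem?_eq_getElem hi)⟩
    · have : 60 ≤ wF L[i] := by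
        rw [hwF, hwT]
        simp only [List.range_succ, List.map_append, List.sum_append, List.map_cons, List.map_nil,
          List.sum_cons, List.sum_nil]
        omega
      omega
    · simp only [List.map_append, List.sum_append, List.map_cons, List.map_nil, List.sum_cons,
        List.sum_nil]
      omega

/-- The rule for the loop through all edges, if the costs per edge are bounded. -/
theorem Ready.run_forEdges (h : Ready c T Δ L K) {α : Type*} (put : α → Mem)
    (step : α → Edge n → α) {s t₀ d : ℕ} {p : Prog}
    (hput : ∀ a, (put a).j = 0 ∧ (put a).t = 0 ∧ (put a).s = s ∧ (put a).t₀ = t₀)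
    (hp : ∀ a e j, e ∈ edges c T (c.lim T Δ) L s t₀ →
      AtEdge T L { put a with j := j, t := e.2 } e →
      Run p (toState K { put a with j := j, t := e.2 }) d
        (toState K { put (step a e) with j := j, t := e.2 })) (a : α) :
    Run (forEdges c p) (toState K (put a)) (400 * (L.length * ((T + 1) * (d + 60))))
      (toState K (put ((edges c T (c.lim T Δ) L s t₀).foldl step a))) := by
  refine (h.run_forEdges_sum put step (fun _ => d) hput hp a).mono ?_
  rw [List.map_const', List.sum_replicate, smul_eq_mul]
  have := Nat.mul_le_mul_right d (length_edges_le c T (c.lim T Δ) L s t₀)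
  linarith

/-- Each edge has only one rank, so that the cost `d` arises only once for each edge, although all
edges are inspected in each of the `R` rounds. -/
theorem sum_ranks_le (E : List (Edge n)) (P : Edge n → Prop) [DecidablePred P] (φ : ℕ × ℕ → ℕ)
    (R d : ℕ) : ((List.range R).map fun r => (E.map fun e =>
      140 + if P e ∧ φ (head e) = r + 1 then d else 0).sum).sum ≤
      R * (E.length * 140) + E.length * d := by
  have h1 : ∀ e : Edge n, ((List.range R).map fun r =>
      140 + if P e ∧ φ (head e) = r + 1 then d else 0).sum ≤ R * 140 + d := by
    intro e
    have : ((List.range R).map fun r => 140 + if P e ∧ φ (head e) = r + 1 then d else 0).sum ≤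
        R * 140 + if φ (head e) ≤ R then d else 0 := by
      induction R with
      | zero => simp
      | succ R ih =>
        simp only [List.range_succ, List.map_append, List.sum_append, List.map_cons, List.map_nil,
          List.sum_cons, List.sum_nil]
        split_ifs at ih ⊢ <;> omega
    refine this.trans ?_
    split_ifs <;> omega
  have h2 : ((List.range R).map fun r => (E.map fun e =>
      140 + if P e ∧ φ (head e) = r + 1 then d else 0).sum).sum =
      (E.map fun e => ((List.range R).map fun r =>
        140 + if P e ∧ φ (head e) = r + 1 then d else 0).sum).sum := by
    induction E with
    | nil => simp
    | cons e E ih =>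
      simp only [List.map_cons, List.sum_cons, List.sum_map_add]
      simp only [List.sum_map_add] at ih
      rw [ih]
  rw [h2]
  refine (List.sum_le_sum (g := fun _ => R * 140 + d) fun e _ => h1 e).trans ?_
  rw [List.map_const', List.sum_replicate, smul_eq_mul]
  linarith

/-- The rule for the loop through all active edges. -/
theorem Ready.run_forSorted (h : Ready c T Δ L K) {α : Type*} (put : α → Mem)
    (step : α → Edge n → α) {s t₀ d : ℕ} {φ : ℕ × ℕ → ℕ} {best : ℕ → ℕ} {p : Prog}
    (hput : ∀ a, (put a).j = 0 ∧ (put a).t = 0 ∧ (put a).s = s ∧ (put a).t₀ = t₀ ∧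
      (put a).r = 0 ∧ (put a).phi = φ ∧ (put a).best = best)
    (hp : ∀ a e j r, e ∈ edges c T (c.lim T Δ) L s t₀ →
      AtEdge T L { put a with j := j, t := e.2, r := r } e →
      Run p (toState K { put a with j := j, t := e.2, r := r }) d
        (toState K { put (step a e) with j := j, t := e.2, r := r })) (a : α) :
    Run (forSorted c p) (toState K (put a))
      (8000 * (K.R * (L.length * (T + 1) * 200) + L.length * (T + 1) * d))
      (toState K (put ((sortedEdges c K.R φ best
        (edges c T (c.lim T Δ) L s t₀)).foldl step a))) := by
  set E := edges c T (c.lim T Δ) L s t₀ with hE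
  set stepR : ℕ → α → Edge n → α := fun r a e =>
    if Active c φ best e ∧ φ (head e) = r + 1 then step a e else a with hstepR
  set w : ℕ → Edge n → ℕ := fun r e =>
    140 + if Active c φ best e ∧ φ (head e) = r + 1 then d else 0 with hw
  have hfold : (sortedEdges c K.R φ best E).foldl step a =
      (List.range K.R).foldl (fun a r => E.foldl (stepR r) a) a := by
    simp only [sortedEdges, List.foldl_flatMap, List.foldl_filter, hstepR, decide_eq_true_eq]
  rw [hfold]
  have hR : 1 ≤ K.R := by rw [h.R_eq]; unfold Variant.rounds; split_ifs <;> omega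
  have hpos : 1 ≤ L.length * ((T + 1) * 60) := Nat.mul_pos h.one_le_M (by positivity)
  set B := L.length * ((T + 1) * 60) with hB
  refine (Run.forLoop_sum (x := 14) (y := 7) (N := K.R) (by decide) hR
    (fun i => 400 * (i * B + ((List.range i).map fun r => (E.map (w r)).sum).sum))
    (fun i => toState K (put ((List.range i).foldl (fun a r => E.foldl (stepR r) a) a)))
    (fun i => ⟨(hput _).2.2.2.2.1, rfl⟩) ?_).mono ?_
  · intro i hi
    refine ⟨400 * (B + (E.map (w i)).sum), by omega, ?_, ?_⟩
    · simp only [List.range_succ, List.map_append, List.sum_append, List.map_cons, List.map_nil,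
        List.sum_cons, List.sum_nil]
      linarith
    simp only [setReg_r, List.range_succ, List.foldl_append, List.foldl_cons, List.foldl_nil]
    generalize (List.range i).foldl (fun a r => E.foldl (stepR r) a) a = b
    refine (h.run_forEdges_sum (fun a => { put a with r := i }) (stepR i) (w i) (s := s)
      (t₀ := t₀) (fun a => ⟨(hput a).1, (hput a).2.1, (hput a).2.2.1, (hput a).2.2.2.1⟩) ?_ b)
    intro a e j he hat
    obtain ⟨-, -, -, -, -, hφ, hbest⟩ := hput a
    have hact := h.holds_activeCond hat
    have hrank := h.eval_rankHead hat
    have hcond : (Cond.and (activeCond c) (.eq rankHead (.add (.reg 14) (.const 1)))).Holds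
        (toState K { put a with r := i, j := j, t := e.2 }) ↔
        Active c φ best e ∧ φ (head e) = i + 1 := by
      rw [← hφ, ← hbest, ← hact, ← hrank]
      rfl
    have hcost : (Cond.and (activeCond c)
        (.eq rankHead (.add (.reg 14) (.const 1)))).cost ≤ 120 := by
      have := cost_activeCond c
      simp only [Cond.cost, NatExpr.cost, rankHead, headCell, arcDst, arcTime]
      omega
    by_cases hP : Active c φ best e ∧ φ (head e) = i + 1
    · have hstep : stepR i a e = step a e := if_pos hP
      have hwi : w i e = 140 + d := by rw [hw]; simp only [if_pos hP]
      rw [hstep, hwi]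
      refine (Run.ite_pos (hcond.2 hP) (hp a e j i he ⟨hat.arc, rfl, hat.time_le⟩)).mono ?_
      omega
    · have hstep : stepR i a e = a := if_neg hP
      have hwi : w i e = 140 := by rw [hw]; simp only [if_neg hP, add_zero]
      rw [hstep, hwi]
      refine (Run.ite_neg (fun h' => hP (hcond.1 h')) (Run.skip _)).mono ?_
      omega
  · have h1 := sum_ranks_le E (Active c φ best) φ K.R d
    have h2 := length_edges_le c T (c.lim T Δ) L s t₀
    have h3 := Nat.mul_le_mul_left K.R (Nat.mul_le_mul_right 140 h2)
    have h4 := Nat.mul_le_mul_right d h2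
    rw [← hE] at h3 h4
    simp only [hw, hB] at *
    nlinarith

end

end TemporalBetweenness

namespace TemporalBetweenness

open RAM

variable {n : ℕ}

/-! ### The bodies of the loops -/

/-- The cell of the two-dimensional array of walk counts that belongs to the current vertex. -/
def slabCell (i : NatExpr) : NatExpr := .add (.load 4 (.reg 15)) i

/-- Resets all ranks and walk counts of the states that occur in the state graph. -/
def clearProg (c : Variant) : Prog :=
  forEdges c (.seq (.seq (.store 7 tailCell (.const 0)) (.store 7 headCell (.const 0)))
    (.seq (.seq (.storeNum 2 tailCell .zero) (.storeNum 2 headCell .zero))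
      (.forLoop 15 0 (.seq (.storeNum 3 (slabCell tailCell) .zero)
        (.storeNum 3 (slabCell headCell) .zero)))))

/-- Computes the ranks of all states. -/
def rankProg (c : Variant) : Prog :=
  .seq (clearProg c) (.seq (.seq (.store 7 (.load 3 (.reg 10)) (.const 1))
    (.storeNum 2 (.load 3 (.reg 10)) .one)) (.forLoop 14 7 (forEdges c (relaxProg c))))

/-- Takes the walks that end with the current edge into account in the computation of the least
cost of a walk to each vertex. -/
def bestProg (c : Variant) : Prog :=
  .ite (.and (.not (.eq rankTail (.const 0)))
      (.and (condIf (!c.closed) (.not (.eq arcDst (.reg 10))))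
      (condOr (.eq (.load 6 arcDst) (.const 0)) (.lt (keyExpr c) (.load 6 arcDst)))))
    (.store 6 arcDst (keyExpr c)) .skip

/-- The test whether walks that end with the current edge can be optimal, see `IsFinal`. -/
def finalCond (c : Variant) : Cond := .eq (.load 6 arcDst) (keyExpr c)

/-- Implements `extend`. -/
def extendProg : Prog :=
  .storeNum 2 headCell (.add (.load 2 headCell) (.load 2 tailCell))

/-- Counts the optimal walks that end with the current edge. -/
def countProg (c : Variant) : Prog :=
  .seq (.ite (finalCond c) (.storeNum 1 arcDst (.add (.load 1 arcDst) (.load 2 tailCell))) .skip)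
    extendProg

/-- Adds the contribution of the optimal walks that end with the current edge to the betweenness
of the current vertex, and counts the walks through this vertex. -/
def shareProg (c : Variant) : Prog :=
  .seq (.ite (.and (finalCond c) (.and (.not (.eq (.reg 15) arcDst))
      (.not (.eq (.reg 15) (.reg 10)))))
      (.storeNum 0 (.reg 15) (.add (.load 0 (.reg 15))
        (.div (.load 3 (slabCell tailCell)) (.load 1 arcDst)))) .skip)
    (.ite (.eq (.reg 15) arcDst)
      (.storeNum 3 (slabCell headCell) (.add (.load 3 (slabCell headCell)) (.load 2 tailCell)))
      (.storeNum 3 (slabCell headCell)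
        (.add (.load 3 (slabCell headCell)) (.load 3 (slabCell tailCell)))))

/-- Implements `dependencyStep`. -/
def dependencyProg (c : Variant) : Prog := .seq (.forLoop 15 0 (shareProg c)) extendProg

/-- Ranks and walk counts. -/
structure Scratch where
  phi : ℕ × ℕ → ℕ
  Y : ℕ × ℕ → ℚ
  Z : ℕ → ℕ × ℕ → ℚ

/-- Overwrites the ranks and the walk counts. -/
def Mem.put (μ : Mem) (a : Scratch) : Mem := { μ with phi := a.phi, Y := a.Y, Z := a.Z }

/-- The counters of all inner loops are zero. -/
structure Mem.Idle (μ : Mem) : Prop where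
  j : μ.j = 0
  t : μ.t = 0
  r : μ.r = 0
  v : μ.v = 0

/-- Resets the entries for the two ends of an edge. -/
def clearStep (a : Scratch) (e : Edge n) : Scratch where
  phi := Function.update (Function.update a.phi (tail e) 0) (head e) 0
  Y := Function.update (Function.update a.Y (tail e) 0) (head e) 0
  Z v := if v < n then Function.update (Function.update (a.Z v) (tail e) 0) (head e) 0 else a.Z v

/-- Takes the walks that end with the edge `e` into account in the least costs; `0` stands for
infinity. -/
def bestStep (c : Variant) (R s t₀ : ℕ) (φ : ℕ × ℕ → ℕ) (best : ℕ → ℕ) (e : Edge n) : ℕ → ℕ :=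
  if φ (tail e) ≠ 0 ∧ (c.closed = false → (e.1.dst : ℕ) ≠ s) ∧
    (best e.1.dst = 0 ∨ key c R t₀ φ e.1 < best e.1.dst)
  then Function.update best e.1.dst (key c R t₀ φ e.1) else best

/-- The walks that end with the transition `f` and have the rank of its head are optimal. -/
def IsFinal (c : Variant) (R t₀ : ℕ) (φ : ℕ × ℕ → ℕ) (best : ℕ → ℕ) (f : TimeArc n) : Prop :=
  best f.dst = key c R t₀ φ f

instance (c : Variant) (R t₀ : ℕ) (φ : ℕ × ℕ → ℕ) (best : ℕ → ℕ) (f : TimeArc n) :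
    Decidable (IsFinal c R t₀ φ best f) := by
  unfold IsFinal; infer_instance

/-- Adds the number of walks to the tail of `e` to the number of walks to its head. -/
def extend (Y : ℕ × ℕ → ℚ) (e : Edge n) : ℕ × ℕ → ℚ :=
  Function.update Y (head e) (Y (head e) + Y (tail e))

/-- The effect of an edge on the numbers of walks to the states and of optimal walks to the
vertices; the walks that end with a transition satisfying `F` are the optimal ones. -/
def countStep (F : TimeArc n → Prop) [DecidablePred F] (a : (ℕ × ℕ → ℚ) × (ℕ → ℚ))
    (e : Edge n) : (ℕ × ℕ → ℚ) × (ℕ → ℚ) :=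
  (extend a.1 e, if F e.1 then Function.update a.2 e.1.dst (a.2 e.1.dst + a.1 (tail e)) else a.2)

/-- The numbers of walks to each state, in total and through each vertex, and the betweenness. -/
structure Shares where
  Y : ℕ × ℕ → ℚ
  Z : ℕ → ℕ × ℕ → ℚ
  out : ℕ → ℚ

/-- The number of walks through `v`, where the end of a walk counts, after the walks to the tail of
`e` have been extended by `e`. -/
def extendThrough (a : Shares) (e : Edge n) (v : ℕ) : ℕ × ℕ → ℚ :=
  Function.update (a.Z v) (head e)
    (a.Z v (head e) + if v = e.1.dst then a.Y (tail e) else a.Z v (tail e))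

/-- The betweenness of `v` after the contribution of the optimal walks that end with `e`. -/
def share (F : TimeArc n → Prop) [DecidablePred F] (s : ℕ) (sig : ℕ → ℚ) (a : Shares)
    (e : Edge n) (v : ℕ) : ℚ :=
  a.out v + if F e.1 ∧ v ≠ e.1.dst ∧ v ≠ s then a.Z v (tail e) / sig e.1.dst else 0

/-- The effect of an edge on walk counts and betweenness. -/
def dependencyStep (F : TimeArc n → Prop) [DecidablePred F] (s : ℕ) (sig : ℕ → ℚ) (a : Shares)
    (e : Edge n) : Shares where
  Y := extend a.Y e
  Z v := if v < n then extendThrough a e v else a.Z v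
  out v := if v < n then share F s sig a e v else a.out v

/-- A loop through the indices below `n` replaces the values one by one. -/
theorem update_parallel {β : Type*} (f g : ℕ → β) (i : ℕ) :
    Function.update (fun v => if v < i then f v else g v) i (f i) =
      fun v => if v < i + 1 then f v else g v := by
  funext v
  by_cases h : v = i
  · subst h; simp
  · rw [Function.update_of_ne h]
    have : v < i ↔ v < i + 1 := by omega
    simp only [this]

section

variable {c : Variant} {T Δ : ℕ} {L : List (TimeArc n)} {K : Consts} {μ : Mem} {e : Edge n}

theorem cost_tailCell : tailCell.cost = 5 := rfl

theorem cost_headCell : headCell.cost = 6 := rfl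

theorem Ready.eval_Y_tail (h : Ready c T Δ L K) (he : AtEdge T L μ e) :
    (RatExpr.load 2 tailCell).eval (toState K μ) = μ.Y (tail e) := by
  rw [← h.node_tail he]; rfl

theorem Ready.eval_Y_head (h : Ready c T Δ L K) (he : AtEdge T L μ e) :
    (RatExpr.load 2 headCell).eval (toState K μ) = μ.Y (head e) := by
  rw [← h.node_head he]; rfl

theorem Ready.eval_slabCell (h : Ready c T Δ L K) (hv : μ.v < n) (i : NatExpr) :
    (slabCell i).eval (toState K μ) = μ.v * (K.n * (K.T + 1)) + i.eval (toState K μ) := by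
  have : (slabCell i).eval (toState K μ) = K.slab μ.v + i.eval (toState K μ) := rfl
  rw [this, h.slab_eq _ hv, h.n_eq, h.T_eq]

theorem Ready.eval_Z (h : Ready c T Δ L K) (hv : μ.v < n) {i : NatExpr} {q : ℕ × ℕ}
    (hi : i.eval (toState K μ) < K.n * (K.T + 1)) (hq : node K.T (i.eval (toState K μ)) = q) :
    (RatExpr.load 3 (slabCell i)).eval (toState K μ) = μ.Z μ.v q := by
  have : (RatExpr.load 3 (slabCell i)).eval (toState K μ) =
    μ.Z ((slabCell i).eval (toState K μ) / (K.n * (K.T + 1)))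
      (node K.T ((slabCell i).eval (toState K μ) % (K.n * (K.T + 1)))) := rfl
  have hpos : 0 < K.n * (K.T + 1) := by omega
  rw [this, h.eval_slabCell hv, mul_comm μ.v, Nat.mul_add_div hpos, Nat.div_eq_of_lt hi,
    Nat.mul_add_mod, Nat.mod_eq_of_lt hi, hq, add_zero]

theorem Ready.run_storeZ (h : Ready c T Δ L K) (hv : μ.v < n) {i : NatExpr} {q : ℕ × ℕ}
    (hi : i.eval (toState K μ) < K.n * (K.T + 1)) (hq : node K.T (i.eval (toState K μ)) = q)
    (x : RatExpr) : Run (.storeNum 3 (slabCell i) x) (toState K μ) (i.cost + x.cost + 4)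
      (toState K { μ with Z := Function.update μ.Z μ.v (Function.update (μ.Z μ.v) q
        (x.eval (toState K μ))) }) := by
  have := Run.storeNum 3 (slabCell i) x (toState K μ)
  rw [h.eval_slabCell hv, setNum_Z K μ _ hi hq] at this
  refine this.mono ?_
  simp only [slabCell, NatExpr.cost]
  omega

theorem run_storeY {i : NatExpr} {q : ℕ × ℕ} (hq : node K.T (i.eval (toState K μ)) = q)
    (x : RatExpr) : Run (.storeNum 2 i x) (toState K μ) (i.cost + x.cost + 1)
      (toState K { μ with Y := Function.update μ.Y q (x.eval (toState K μ)) }) := by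
  have := Run.storeNum 2 i x (toState K μ)
  rwa [setNum_Y K μ _ hq] at this

theorem run_storePhi {i : NatExpr} {q : ℕ × ℕ} (hq : node K.T (i.eval (toState K μ)) = q)
    (x : NatExpr) : Run (.store 7 i x) (toState K μ) (i.cost + x.cost + 1)
      (toState K { μ with phi := Function.update μ.phi q (x.eval (toState K μ)) }) := by
  have := Run.store 7 i x (toState K μ)
  rwa [setArr_phi K μ _ hq] at this

theorem AtEdge.congr {μ' : Mem} (he : AtEdge T L μ e) (hj : μ'.j = μ.j) (ht : μ'.t = μ.t) :
    AtEdge T L μ' e := ⟨hj ▸ he.arc, ht.trans he.time_eq, he.time_le⟩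

theorem Ready.run_clearZ (h : Ready c T Δ L K) (hμ : μ.v = 0) (he : AtEdge T L μ e) :
    Run (.forLoop 15 0 (.seq (.storeNum 3 (slabCell tailCell) .zero)
        (.storeNum 3 (slabCell headCell) .zero))) (toState K μ) (20 * (n * 40))
      (toState K { μ with Z := (clearStep ⟨μ.phi, μ.Y, μ.Z⟩ e).Z }) := by
  set f : ℕ → ℕ × ℕ → ℚ :=
    fun v => Function.update (Function.update (μ.Z v) (tail e) 0) (head e) 0 with hf
  refine Run.forLoop (by decide) h.one_le_n (by norm_num)
    (fun i => toState K { μ with Z := fun v => if v < i then f v else μ.Z v })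
    (fun i => ⟨hμ, h.n_eq⟩) ?_
  intro i hi
  simp only [setReg_v]
  have h1 : AtEdge T L { μ with v := i, Z := fun v => if v < i then f v else μ.Z v } e :=
    he.congr rfl rfl
  have h2 := h.run_storeZ hi (h.tailCell_lt h1) (h.node_tail h1) .zero
  have h2 := h2.seq (h.run_storeZ hi (h.headCell_lt (by exact he.congr rfl rfl))
    (h.node_head (by exact he.congr rfl rfl)) .zero)
  simp only [Function.update_self, Function.update_idem, RatExpr.eval, lt_irrefl, if_false] at h2
  rw [← update_parallel]
  refine h2.mono ?_
  simp [cost_tailCell, cost_headCell, RatExpr.cost]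

theorem Ready.run_clear (h : Ready c T Δ L K) (hμ : μ.Idle) (a : Scratch) :
    Run (clearProg c) (toState K (μ.put a))
      (400 * (L.length * ((T + 1) * ((40 + 20 * (n * 40)) + 60))))
      (toState K (μ.put ((edges c T (c.lim T Δ) L μ.s μ.t₀).foldl clearStep a))) := by
  refine h.run_forEdges μ.put clearStep (fun a => ⟨hμ.j, hμ.t, rfl, rfl⟩) ?_ a
  intro a e j _ hat
  refine (((run_storePhi (h.node_tail hat) (.const 0)).seq
    (run_storePhi (h.node_head (by exact hat.congr rfl rfl)) (.const 0))).seq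
    (((run_storeY (h.node_tail (by exact hat.congr rfl rfl)) .zero).seq
    (run_storeY (h.node_head (by exact hat.congr rfl rfl)) .zero)).seq
      (h.run_clearZ ?_ (by exact hat.congr rfl rfl)))).mono ?_
  · exact hμ.v
  · simp only [cost_tailCell, cost_headCell, RatExpr.cost, NatExpr.cost]
    omega

theorem Ready.run_relax (h : Ready c T Δ L K) (he : AtEdge T L μ e) :
    Run (relaxProg c) (toState K μ) 70 (toState K { μ with phi := relax c μ.phi e }) := by
  have hw := h.eval_rankHead he
  have hu := h.eval_rankTail he
  have hcond : (Cond.and (.not (.eq rankTail (.const 0))) (condOr (.eq rankHead (.const 0))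
      (if c.foremost then .lt rankHead (.add rankTail (.const 1))
        else .lt (.add rankTail (.const 1)) rankHead))).Holds (toState K μ) ↔
      Improves c μ.phi e := by
    unfold Improves
    split_ifs <;> simp only [holds_condOr, Cond.Holds, NatExpr.eval.eq_4, NatExpr.eval.eq_1, hw, hu,
      ne_eq]
  unfold relaxProg
  have hstore := run_storePhi (h.node_head he) (.add rankTail (.const 1))
  simp only [NatExpr.eval.eq_4, NatExpr.eval.eq_1, hu] at hstore
  have := Run.guarded hcond (fun _ => hstore) (by omega)
  unfold relax
  have hcost : ∀ b : Bool, (Cond.and (.not (.eq rankTail (.const 0)))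
      (condOr (.eq rankHead (.const 0)) (if b then .lt rankHead (.add rankTail (.const 1))
        else .lt (.add rankTail (.const 1)) rankHead))).cost ≤ 45 := by
    intro b
    cases b <;> decide
  have hc := hcost c.foremost
  simp only [cost_headCell, NatExpr.cost, rankTail, cost_tailCell] at this
  by_cases hP : Improves c μ.phi e
  · rw [if_pos hP] at this ⊢
    exact this.mono (by simp only [rankTail] at hc; omega)
  · rw [if_neg hP] at this ⊢
    exact this.mono (by simp only [rankTail] at hc; omega)

end

end TemporalBetweenness

namespace TemporalBetweenness

open RAM

variable {n : ℕ}

/-! ### The three passes -/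

/-- Updates the least costs of walks to all vertices for one class of departure times. -/
def bestPass (c : Variant) : Prog := .seq (rankProg c) (forEdges c (bestProg c))

/-- Adds the numbers of optimal walks of one class of departure times. -/
def countPass (c : Variant) : Prog := .seq (rankProg c) (forSorted c (countProg c))

/-- Adds the contributions of one class of departure times to the betweenness. -/
def dependencyPass (c : Variant) : Prog := .seq (rankProg c) (forSorted c (dependencyProg c))

/-- The ranks are the result of the algorithm of Bellman and Ford, and the walk counts are set to
their initial values. -/
structure Prepared (c : Variant) (R s : ℕ) (E : List (Edge n)) (a : Scratch) : Prop where
  phi : ∃ φ₀ : ℕ × ℕ → ℕ, a.phi = (List.range R).foldl (fun φ _ => E.foldl (relax c) φ) φ₀ ∧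
    φ₀ (s, 0) = 1 ∧ ∀ e ∈ E, ∀ q, q = tail e ∨ q = head e → q ≠ (s, 0) → φ₀ q = 0
  Y_source : a.Y (s, 0) = 1
  Y_eq_zero : ∀ e ∈ E, ∀ q, q = tail e ∨ q = head e → q ≠ (s, 0) → a.Y q = 0
  Z_eq_zero : ∀ e ∈ E, ∀ q, q = tail e ∨ q = head e → ∀ v < n, a.Z v q = 0

/-- All entries for the state `q` are zero. -/
def Scratch.Clear (n : ℕ) (a : Scratch) (q : ℕ × ℕ) : Prop :=
  a.phi q = 0 ∧ a.Y q = 0 ∧ ∀ v < n, a.Z v q = 0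

theorem clear_clearStep {a : Scratch} {e : Edge n} {q : ℕ × ℕ}
    (h : a.Clear n q ∨ q = tail e ∨ q = head e) : (clearStep a e).Clear n q := by
  have key : ∀ {β : Type} [Zero β] (f : ℕ × ℕ → β), f q = 0 ∨ q = tail e ∨ q = head e →
      Function.update (Function.update f (tail e) 0) (head e) 0 q = 0 := by
    intro β _ f hf
    simp only [Function.update_apply]
    split_ifs <;> tauto
  refine ⟨key _ (h.imp_left fun h => h.1), key _ (h.imp_left fun h => h.2.1), fun v hv => ?_⟩
  simp only [clearStep, if_pos hv]
  exact key _ (h.imp_left fun h => h.2.2 v hv)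

theorem clear_foldl (E : List (Edge n)) (a : Scratch) {q : ℕ × ℕ}
    (h : a.Clear n q ∨ ∃ e ∈ E, q = tail e ∨ q = head e) :
    (E.foldl clearStep a).Clear n q := by
  induction E generalizing a with
  | nil => simpa using h
  | cons e E ih =>
    refine ih _ ?_
    rcases h with h | ⟨e', he', h⟩
    · exact .inl (clear_clearStep (.inl h))
    · rcases List.mem_cons.1 he' with rfl | he'
      · exact .inl (clear_clearStep (.inr h))
      · exact .inr ⟨e', he', h⟩

section

variable {c : Variant} {T Δ : ℕ} {L : List (TimeArc n)} {K : Consts} {μ : Mem} {e : Edge n}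

theorem Ready.one_le_R (h : Ready c T Δ L K) : 1 ≤ K.R := by
  rw [h.R_eq]; unfold Variant.rounds; split_ifs <;> omega

theorem Ready.n_le_R (h : Ready c T Δ L K) : n ≤ K.R := by
  rw [h.R_eq]; unfold Variant.rounds; split_ifs
  · nlinarith
  · omega

/-- Clearing only the states of the state graph keeps the cost at `O(n * M * (T + 1))`; as `n ≤ R`,
this is within the cost of the `R` rounds of relaxations. -/
theorem Ready.run_rank (h : Ready c T Δ L K) (hμ : μ.Idle) (hs : μ.s < n) :
    ∃ a : Scratch, Prepared c K.R μ.s (edges c T (c.lim T Δ) L μ.s μ.t₀) a ∧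
      Run (rankProg c) (toState K μ) (2000000 * (K.R * (L.length * (T + 1))))
        (toState K (μ.put a)) := by
  set E := edges c T (c.lim T Δ) L μ.s μ.t₀ with hE
  set b := E.foldl clearStep ⟨μ.phi, μ.Y, μ.Z⟩ with hb
  have hclear : ∀ e ∈ E, ∀ q, q = tail e ∨ q = head e → b.Clear n q :=
    fun e he q hq => clear_foldl E _ (.inr ⟨e, he, hq⟩)
  set φ₀ := Function.update b.phi (μ.s, 0) 1 with hφ₀
  set Y₀ := Function.update b.Y (μ.s, 0) 1 with hY₀
  refine ⟨⟨(List.range K.R).foldl (fun φ _ => E.foldl (relax c) φ) φ₀, Y₀, b.Z⟩,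
    ⟨⟨φ₀, rfl, Function.update_self .., ?_⟩, Function.update_self .., ?_, ?_⟩, ?_⟩
  · intro e he q hq hne
    rw [hφ₀, Function.update_of_ne hne]
    exact (hclear e he q hq).1
  · intro e he q hq hne
    refine (Function.update_of_ne hne ..).trans ?_
    exact (hclear e he q hq).2.1
  · intro e he q hq
    exact (hclear e he q hq).2.2
  have hcell : ∀ μ' : Mem, μ'.s = μ.s →
      node K.T ((NatExpr.load 3 (.reg 10)).eval (toState K μ')) = (μ.s, 0) := by
    intro μ' hs'
    have : (NatExpr.load 3 (.reg 10)).eval (toState K μ') = K.row μ'.s := rfl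
    rw [this, hs', h.row_eq _ hs, h.T_eq]
    exact node_add (t := 0) (Nat.zero_le _)
  have hbf : Run (.forLoop 14 7 (forEdges c (relaxProg c))) (toState K (μ.put ⟨φ₀, Y₀, b.Z⟩))
      (20 * (K.R * (400 * (L.length * ((T + 1) * (70 + 60))))))
      (toState K
        (μ.put ⟨(List.range K.R).foldl (fun φ _ => E.foldl (relax c) φ) φ₀, Y₀, b.Z⟩)) := by
    refine Run.forLoop (by decide) h.one_le_R ?_ (fun i => toState K
      (μ.put ⟨(List.range i).foldl (fun φ _ => E.foldl (relax c) φ) φ₀, Y₀, b.Z⟩))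
      (fun i => ⟨hμ.r, rfl⟩) ?_
    · have := h.one_le_M
      exact Nat.mul_pos (by norm_num) (Nat.mul_pos this (by positivity))
    intro i hi
    simp only [setReg_r, List.range_succ, List.foldl_append, List.foldl_cons, List.foldl_nil]
    generalize (List.range i).foldl (fun φ _ => E.foldl (relax c) φ) φ₀ = φ
    exact h.run_forEdges (fun φ => { μ.put ⟨φ, Y₀, b.Z⟩ with r := i }) (relax c)
      (fun _ => ⟨hμ.j, hμ.t, rfl, rfl⟩) (fun φ e j _ hat => h.run_relax hat) φ
  refine ((h.run_clear hμ ⟨μ.phi, μ.Y, μ.Z⟩).seq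
    (((run_storePhi (by exact hcell _ rfl) (.const 1)).seq
    (run_storeY (by exact hcell _ rfl) .one)).seq hbf)).mono ?_
  simp only [NatExpr.cost, RatExpr.cost]
  have h1 := h.n_le_R
  have h2 : 1 ≤ L.length * (T + 1) := Nat.mul_pos h.one_le_M (by positivity)
  have h3 : n * (L.length * (T + 1)) ≤ K.R * (L.length * (T + 1)) := Nat.mul_le_mul_right _ h1
  have h4 : 1 * (L.length * (T + 1)) ≤ K.R * (L.length * (T + 1)) :=
    Nat.mul_le_mul_right _ h.one_le_R
  nlinarith

theorem Ready.run_best (h : Ready c T Δ L K) (he : AtEdge T L μ e) :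
    Run (bestProg c) (toState K μ) 200 (toState K
      { μ with best := bestStep c (c.rounds n T) μ.s μ.t₀ μ.phi μ.best e }) := by
  have hb : (NatExpr.load 6 arcDst).eval (toState K μ) = μ.best e.1.dst := by
    rw [← h.eval_arcDst he]; rfl
  have h10 : (NatExpr.reg 10).eval (toState K μ) = μ.s := rfl
  have hcond : (Cond.and (.not (.eq rankTail (.const 0)))
      (.and (condIf (!c.closed) (.not (.eq arcDst (.reg 10))))
      (condOr (.eq (.load 6 arcDst) (.const 0)) (.lt (keyExpr c) (.load 6 arcDst))))).Holds
      (toState K μ) ↔ (μ.phi (tail e) ≠ 0 ∧ (c.closed = false → (e.1.dst : ℕ) ≠ μ.s) ∧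
      (μ.best e.1.dst = 0 ∨ key c (c.rounds n T) μ.t₀ μ.phi e.1 < μ.best e.1.dst)) := by
    simp only [holds_condOr, holds_condIf, Cond.Holds, h.eval_rankTail he, h.eval_keyExpr he,
      h.eval_arcDst he, hb, h10, NatExpr.eval.eq_1, Bool.not_eq_true', ne_eq]
  have hstore := Run.store 6 arcDst (keyExpr c) (toState K μ)
  rw [h.eval_arcDst he, h.eval_keyExpr he, setArr_best] at hstore
  have := Run.guarded hcond (fun _ => hstore) (by omega)
  have hcost : (Cond.and (.not (.eq rankTail (.const 0)))
      (.and (condIf (!c.closed) (.not (.eq arcDst (.reg 10))))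
      (condOr (.eq (.load 6 arcDst) (.const 0))
        (.lt (keyExpr c) (.load 6 arcDst))))).cost ≤ 100 := by
    have := cost_keyExpr c
    unfold condIf
    split_ifs <;> simp [Cond.cost, condOr, NatExpr.cost, arcDst, rankTail, cost_tailCell] <;> omega
  have hkey := cost_keyExpr c
  have hdst : arcDst.cost = 2 := rfl
  unfold bestProg bestStep
  split_ifs at this ⊢ <;> refine this.mono ?_ <;> omega

theorem Ready.run_bestPass (h : Ready c T Δ L K) (hμ : μ.Idle) (hs : μ.s < n) :
    ∃ a : Scratch, Prepared c K.R μ.s (edges c T (c.lim T Δ) L μ.s μ.t₀) a ∧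
      Run (bestPass c) (toState K μ) (3000000 * (K.R * (L.length * (T + 1))))
        (toState K ({ μ with best := ((edges c T (c.lim T Δ) L μ.s μ.t₀).foldl
          (bestStep c (c.rounds n T) μ.s μ.t₀ a.phi) μ.best) }.put a)) := by
  obtain ⟨a, ha, hrun⟩ := h.run_rank hμ hs
  refine ⟨a, ha, (hrun.seq (h.run_forEdges (fun best => { μ with best := best }.put a)
    (bestStep c (c.rounds n T) μ.s μ.t₀ a.phi) (s := μ.s) (t₀ := μ.t₀) (d := 200)
    (fun _ => ⟨hμ.j, hμ.t, rfl, rfl⟩) (fun _ _ _ _ hat => h.run_best hat) μ.best)).mono ?_⟩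
  have h4 : 1 * (L.length * (T + 1)) ≤ K.R * (L.length * (T + 1)) :=
    Nat.mul_le_mul_right _ h.one_le_R
  have h5 : 1 ≤ L.length * (T + 1) := Nat.mul_pos h.one_le_M (by positivity)
  linarith

theorem Ready.run_extend (h : Ready c T Δ L K) (he : AtEdge T L μ e) :
    Run extendProg (toState K μ) 30 (toState K { μ with Y := extend μ.Y e }) := by
  have := run_storeY (h.node_head he) (.add (.load 2 headCell) (.load 2 tailCell))
  rw [RatExpr.eval, h.eval_Y_head he, h.eval_Y_tail he] at this
  exact this.mono (by decide)

theorem Ready.holds_finalCond (h : Ready c T Δ L K) (he : AtEdge T L μ e) :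
    (finalCond c).Holds (toState K μ) ↔
      IsFinal c (c.rounds n T) μ.t₀ μ.phi μ.best e.1 := by
  have hb : (NatExpr.load 6 arcDst).eval (toState K μ) = μ.best e.1.dst := by
    rw [← h.eval_arcDst he]; rfl
  simp only [finalCond, Cond.Holds, hb, h.eval_keyExpr he, IsFinal]

theorem Ready.run_count (h : Ready c T Δ L K) (he : AtEdge T L μ e) :
    Run (countProg c) (toState K μ) 150 (toState K { μ with
      Y := (countStep (IsFinal c (c.rounds n T) μ.t₀ μ.phi μ.best) (μ.Y, μ.sig) e).1
      sig := (countStep (IsFinal c (c.rounds n T) μ.t₀ μ.phi μ.best) (μ.Y, μ.sig) e).2 }) := by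
  have hstore := Run.storeNum 1 arcDst (.add (.load 1 arcDst) (.load 2 tailCell)) (toState K μ)
  have hb : (RatExpr.load 1 arcDst).eval (toState K μ) = μ.sig e.1.dst := by
    rw [← h.eval_arcDst he]; rfl
  rw [RatExpr.eval, h.eval_Y_tail he, hb, h.eval_arcDst he, setNum_sig] at hstore
  have h1 := Run.guarded (h.holds_finalCond he) (fun _ => hstore) (by omega)
  have hkey := cost_keyExpr c
  unfold countProg countStep
  by_cases hF : IsFinal c (c.rounds n T) μ.t₀ μ.phi μ.best e.1
  · simp only [if_pos hF] at h1 ⊢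
    refine (h1.seq (h.run_extend (by exact he.congr rfl rfl))).mono ?_
    simp only [finalCond, Cond.cost, NatExpr.cost, RatExpr.cost, arcDst, cost_tailCell]
    omega
  · simp only [if_neg hF] at h1 ⊢
    refine (h1.seq (h.run_extend (by exact he.congr rfl rfl))).mono ?_
    simp only [finalCond, Cond.cost, NatExpr.cost, RatExpr.cost, arcDst, cost_tailCell]
    omega

theorem Ready.run_countPass (h : Ready c T Δ L K) (hμ : μ.Idle) (hs : μ.s < n) :
    ∃ a b : Scratch, Prepared c K.R μ.s (edges c T (c.lim T Δ) L μ.s μ.t₀) a ∧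
      Run (countPass c) (toState K μ) (10000000 * (K.R * (L.length * (T + 1))))
        (toState K ({ μ with sig := (((sortedEdges c K.R a.phi μ.best
          (edges c T (c.lim T Δ) L μ.s μ.t₀)).foldl
            (countStep (IsFinal c (c.rounds n T) μ.t₀ a.phi μ.best))
              (a.Y, μ.sig)).2) }.put b)) := by
  obtain ⟨a, ha, hrun⟩ := h.run_rank hμ hs
  refine ⟨a, ⟨a.phi, _, a.Z⟩, ha, (hrun.seq (h.run_forSorted
    (fun x => { μ with sig := x.2 }.put ⟨a.phi, x.1, a.Z⟩)
    (countStep (IsFinal c (c.rounds n T) μ.t₀ a.phi μ.best)) (s := μ.s) (t₀ := μ.t₀) (d := 150)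
    (φ := a.phi) (best := μ.best)
    (fun _ => ⟨hμ.j, hμ.t, rfl, rfl, hμ.r, rfl, rfl⟩)
    (fun x e j r _ hat => h.run_count hat) (a.Y, μ.sig))).mono ?_⟩
  have h4 : 1 * (L.length * (T + 1)) ≤ K.R * (L.length * (T + 1)) :=
    Nat.mul_le_mul_right _ h.one_le_R
  have h5 : 1 ≤ L.length * (T + 1) := Nat.mul_pos h.one_le_M (by positivity)
  linarith

theorem Ready.run_share (h : Ready c T Δ L K) (hv : μ.v < n) (he : AtEdge T L μ e) (a : Shares)
    (ha : a.Y = μ.Y ∧ a.Z μ.v = μ.Z μ.v ∧ a.out μ.v = μ.out μ.v) :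
    Run (shareProg c) (toState K μ) 250 (toState K { μ with
      Z := Function.update μ.Z μ.v (extendThrough a e μ.v)
      out := (Function.update μ.out μ.v
        (share (IsFinal c (c.rounds n T) μ.t₀ μ.phi μ.best) μ.s μ.sig a e μ.v)) }) := by
  have hZt := fun μ' (he' : AtEdge T L μ' e) (hv' : μ'.v < n) =>
    h.eval_Z hv' (h.tailCell_lt he') (h.node_tail he')
  have hZh := fun μ' (he' : AtEdge T L μ' e) (hv' : μ'.v < n) =>
    h.eval_Z hv' (h.headCell_lt he') (h.node_head he')
  have hkey := cost_keyExpr c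
  -- the contribution to the betweenness
  have h1 : Run (.ite (.and (finalCond c) (.and (.not (.eq (.reg 15) arcDst))
      (.not (.eq (.reg 15) (.reg 10))))) (.storeNum 0 (.reg 15) (.add (.load 0 (.reg 15))
        (.div (.load 3 (slabCell tailCell)) (.load 1 arcDst)))) .skip) (toState K μ) 120
      (toState K { μ with out := (Function.update μ.out μ.v
        (share (IsFinal c (c.rounds n T) μ.t₀ μ.phi μ.best) μ.s μ.sig a e μ.v)) }) := by
    have h10 : (NatExpr.reg 10).eval (toState K μ) = μ.s := rfl
    have h15 : (NatExpr.reg 15).eval (toState K μ) = μ.v := rfl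
    have hcond : (Cond.and (finalCond c) (.and (.not (.eq (.reg 15) arcDst))
      (.not (.eq (.reg 15) (.reg 10))))).Holds (toState K μ) ↔
        (IsFinal c (c.rounds n T) μ.t₀ μ.phi μ.best e.1 ∧ μ.v ≠ e.1.dst ∧ μ.v ≠ μ.s) := by
      simp only [Cond.Holds, h.holds_finalCond he, h.eval_arcDst he, h10, h15, ne_eq]
    have hstore := Run.storeNum 0 (.reg 15) (.add (.load 0 (.reg 15))
        (.div (.load 3 (slabCell tailCell)) (.load 1 arcDst))) (toState K μ)
    have hb : (RatExpr.load 1 arcDst).eval (toState K μ) = μ.sig e.1.dst := by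
      rw [← h.eval_arcDst he]; rfl
    have ho : (RatExpr.load 0 (.reg 15)).eval (toState K μ) = μ.out μ.v := rfl
    rw [RatExpr.eval, RatExpr.eval.eq_7, hb, ho, hZt μ he hv, h15, setNum_out] at hstore
    have := Run.guarded hcond (fun _ => hstore) (by omega)
    unfold share
    split_ifs at this ⊢
    · rw [ha.2.1, ha.2.2]
      refine this.mono ?_
      simp only [finalCond, Cond.cost, NatExpr.cost, RatExpr.cost, arcDst, slabCell, cost_tailCell]
      omega
    · rw [add_zero, ha.2.2, Function.update_eq_self]
      refine this.mono ?_
      simp only [finalCond, Cond.cost, NatExpr.cost, RatExpr.cost, arcDst, slabCell, cost_tailCell]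
      omega
  refine (h1.seq (d := 120) ?_).mono (by norm_num)
  generalize Function.update μ.out μ.v
    (share (IsFinal c (c.rounds n T) μ.t₀ μ.phi μ.best) μ.s μ.sig a e μ.v) = o
  have he' : AtEdge T L { μ with out := o } e := he.congr rfl rfl
  have hcond : (Cond.eq (.reg 15) arcDst).Holds (toState K { μ with out := o }) ↔
      μ.v = e.1.dst := by
    simp only [Cond.Holds, h.eval_arcDst he']
    rfl
  unfold extendThrough
  rw [ha.1, ha.2.1]
  by_cases hd : μ.v = e.1.dst
  · rw [if_pos hd]
    have := h.run_storeZ (μ := { μ with out := o }) hv (h.headCell_lt he') (h.node_head he')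
      (.add (.load 3 (slabCell headCell)) (.load 2 tailCell))
    rw [RatExpr.eval, hZh _ he' hv, h.eval_Y_tail he'] at this
    refine (Run.ite_pos (hcond.2 hd) this).mono ?_
    simp [Cond.cost, NatExpr.cost, RatExpr.cost, arcDst, slabCell, cost_tailCell, cost_headCell]
  · rw [if_neg hd]
    have := h.run_storeZ (μ := { μ with out := o }) hv (h.headCell_lt he') (h.node_head he')
      (.add (.load 3 (slabCell headCell)) (.load 3 (slabCell tailCell)))
    rw [RatExpr.eval, hZh _ he' hv, hZt _ he' hv] at this
    refine (Run.ite_neg (fun h' => hd (hcond.1 h')) this).mono ?_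
    simp [Cond.cost, NatExpr.cost, RatExpr.cost, arcDst, slabCell, cost_tailCell, cost_headCell]

theorem Ready.run_dependency (h : Ready c T Δ L K) (hμ : μ.v = 0) (he : AtEdge T L μ e)
    (a : Shares) (ha : a = dependencyStep (n := n) (IsFinal c (c.rounds n T) μ.t₀ μ.phi μ.best) μ.s
      μ.sig ⟨μ.Y, μ.Z, μ.out⟩ e) :
    Run (dependencyProg c) (toState K μ) (20 * (n * 250) + 30)
      (toState K { μ with Y := a.Y, Z := a.Z, out := a.out }) := by
  subst ha
  set b : Shares := ⟨μ.Y, μ.Z, μ.out⟩ with hb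
  set F := IsFinal c (c.rounds n T) μ.t₀ μ.phi μ.best with hF
  have h1 : Run (.forLoop 15 0 (shareProg c)) (toState K μ) (20 * (n * 250)) (toState K { μ with
      Z := (dependencyStep F μ.s μ.sig b e).Z, out := (dependencyStep F μ.s μ.sig b e).out }) := by
    have := Run.forLoop (p := shareProg c) (x := 15) (y := 0) (c := 250) (by decide) h.one_le_n
      (by norm_num) (fun i => toState K { μ with
        Z := fun v => if v < i then extendThrough b e v else b.Z v
        out := fun v => if v < i then share F μ.s μ.sig b e v else b.out v })
      (fun i => ⟨hμ, h.n_eq⟩) ?_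
    · simp only [Nat.not_lt_zero, if_false] at this
      exact this
    intro i hi
    simp only [setReg_v]
    rw [← update_parallel, ← update_parallel]
    refine h.run_share (μ := { μ with
      Z := fun v => if v < i then extendThrough b e v else b.Z v
      out := fun v => if v < i then share F μ.s μ.sig b e v else b.out v, v := i }) hi
      (by exact he.congr rfl rfl) b ⟨rfl, ?_, ?_⟩
    · simp
    · simp
  exact h1.seq (h.run_extend (by exact he.congr rfl rfl))

theorem Ready.run_dependencyPass (h : Ready c T Δ L K) (hμ : μ.Idle) (hs : μ.s < n) :
    ∃ a b : Scratch, Prepared c K.R μ.s (edges c T (c.lim T Δ) L μ.s μ.t₀) a ∧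
      Run (dependencyPass c) (toState K μ)
        (50000000 * (K.R * (L.length * (T + 1))))
        (toState K ({ μ with out := (((sortedEdges c K.R a.phi μ.best
          (edges c T (c.lim T Δ) L μ.s μ.t₀)).foldl
            (dependencyStep (IsFinal c (c.rounds n T) μ.t₀ a.phi μ.best) μ.s μ.sig)
              ⟨a.Y, a.Z, μ.out⟩).out) }.put b)) := by
  obtain ⟨a, ha, hrun⟩ := h.run_rank hμ hs
  refine ⟨a, ⟨a.phi, _, _⟩, ha, (hrun.seq (h.run_forSorted
    (fun x => { μ with out := x.out }.put ⟨a.phi, x.Y, x.Z⟩)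
    (dependencyStep (IsFinal c (c.rounds n T) μ.t₀ a.phi μ.best) μ.s μ.sig) (s := μ.s) (t₀ := μ.t₀)
    (d := 20 * (n * 250) + 30) (φ := a.phi) (best := μ.best)
    (fun _ => ⟨hμ.j, hμ.t, rfl, rfl, hμ.r, rfl, rfl⟩)
    (fun x e j r _ hat => h.run_dependency (by exact hμ.v) hat _ rfl) ⟨a.Y, a.Z, μ.out⟩)).mono ?_⟩
  have h1 := h.n_le_R
  have h3 : n * (L.length * (T + 1)) ≤ K.R * (L.length * (T + 1)) := Nat.mul_le_mul_right _ h1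
  have h4 : 1 * (L.length * (T + 1)) ≤ K.R * (L.length * (T + 1)) :=
    Nat.mul_le_mul_right _ h.one_le_R
  have h5 : 1 ≤ L.length * (T + 1) := Nat.mul_pos h.one_le_M (by positivity)
  linarith

end

end TemporalBetweenness

namespace TemporalBetweenness

variable {n : ℕ}

/-! ### Walks in the state graph -/

/-- The state that a sequence of transitions, listed in reverse order, leads to from `s`. -/
def endState (s : Fin n) : List (TimeArc n) → ℕ × ℕ
  | [] => (s, 0)
  | f :: _ => (f.dst, f.time)

/-- `W` is a walk from the state `(s, 0)` in the state graph with the edges `E`, with its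
transitions listed in reverse order. -/
def Trail (E : List (Edge n)) (s : Fin n) : List (TimeArc n) → Prop
  | [] => True
  | f :: W => (f, (endState s W).2) ∈ E ∧ (f.src : ℕ) = (endState s W).1 ∧ Trail E s W

/-- The state occurs in the state graph. -/
def IsNode (E : List (Edge n)) (s : Fin n) (q : ℕ × ℕ) : Prop :=
  q = (↑s, 0) ∨ ∃ e ∈ E, q = tail e ∨ q = head e

theorem Trail.isNode {E : List (Edge n)} {s : Fin n} {W : List (TimeArc n)} (h : Trail E s W) :
    IsNode E s (endState s W) := by
  cases W with
  | nil => exact .inl rfl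
  | cons f W => exact .inr ⟨_, h.1, .inr rfl⟩

theorem Trail.mono {E E' : List (Edge n)} {s : Fin n} (hE : E ⊆ E') {W : List (TimeArc n)}
    (h : Trail E s W) : Trail E' s W := by
  induction W with
  | nil => trivial
  | cons f W ih => exact ⟨hE h.1, h.2.1, ih h.2.2⟩

/-- The rank of a state lies on the correct side of the rank that a walk of length `l` yields. -/
def Reached (c : Variant) (φ : ℕ × ℕ → ℕ) (l : ℕ) (q : ℕ × ℕ) : Prop :=
  φ q ≠ 0 ∧ if c.foremost then l + 1 ≤ φ q else φ q ≤ l + 1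

/-- The ranks are correct for all walks of length at most `R`. -/
structure Ranked (c : Variant) (R : ℕ) (E : List (Edge n)) (s : Fin n) (φ : ℕ × ℕ → ℕ) : Prop where
  sound : ∀ q, IsNode E s q → φ q ≠ 0 →
    ∃ W, Trail E s W ∧ endState s W = q ∧ φ q = W.length + 1
  complete : ∀ W, Trail E s W → W.length ≤ R → Reached c φ W.length (endState s W)

theorem Reached.relax {c : Variant} {φ : ℕ × ℕ → ℕ} {l : ℕ} {q : ℕ × ℕ} (h : Reached c φ l q)
    (e : Edge n) : Reached c (relax c φ e) l q := by
  unfold TemporalBetweenness.relax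
  split_ifs with hφ
  · obtain ⟨h1, h2⟩ := hφ
    obtain ⟨h3, h4⟩ := h
    by_cases hq : q = head e
    · subst hq
      refine ⟨by simp, ?_⟩
      rw [Function.update_self]
      split_ifs at h2 h4 ⊢ <;> omega
    · unfold Reached
      rw [Function.update_of_ne hq]
      exact ⟨h3, h4⟩
  · exact h

theorem Reached.relax_head {c : Variant} {φ : ℕ × ℕ → ℕ} {l : ℕ} {e : Edge n}
    (h : Reached c φ l (tail e)) :
      Reached c (TemporalBetweenness.relax c φ e) (l + 1) (head e) := by
  obtain ⟨h3, h4⟩ := h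
  unfold TemporalBetweenness.relax
  split_ifs with hφ
  · refine ⟨by simp, ?_⟩
    rw [Function.update_self]
    split_ifs at h4 ⊢ <;> omega
  · unfold Reached
    simp only [Improves, ne_eq, h3, not_false_eq_true, true_and, not_or] at hφ
    obtain ⟨h1, h2⟩ := hφ
    refine ⟨h1, ?_⟩
    split_ifs at h2 h4 ⊢ <;> omega

theorem Reached.foldl {c : Variant} {φ : ℕ × ℕ → ℕ} {l : ℕ} {q : ℕ × ℕ} (h : Reached c φ l q)
    (E : List (Edge n)) : Reached c (E.foldl (TemporalBetweenness.relax c) φ) l q := by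
  induction E generalizing φ with
  | nil => exact h
  | cons e E ih => exact ih (h.relax e)

theorem Reached.foldl_head {c : Variant} {φ : ℕ × ℕ → ℕ} {l : ℕ} {E : List (Edge n)} {e : Edge n}
    (h : Reached c φ l (tail e)) (he : e ∈ E) :
    Reached c (E.foldl (TemporalBetweenness.relax c) φ) (l + 1) (head e) := by
  induction E generalizing φ with
  | nil => simp at he
  | cons e' E ih =>
    rcases List.mem_cons.1 he with rfl | he
    · exact h.relax_head.foldl E
    · exact ih (h.relax e') he

/-- After `i` rounds of relaxations, the ranks are correct for all walks of length at most `i`. -/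
theorem Prepared.ranked {c : Variant} {R : ℕ} {E : List (Edge n)} {s : Fin n} {a : Scratch}
    (h : Prepared c R s E a) : Ranked c R E s a.phi := by
  obtain ⟨φ₀, hφ, h1, h0⟩ := h.phi
  rw [hφ]
  constructor
  · -- every relaxation step preserves soundness
    set P : (ℕ × ℕ → ℕ) → Prop := fun φ => ∀ q, IsNode E s q → φ q ≠ 0 →
      ∃ W, Trail E s W ∧ endState s W = q ∧ φ q = W.length + 1 with hP
    have hrelax : ∀ φ, P φ → ∀ e ∈ E, P (relax c φ e) := by
      intro φ hφ e he q hq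
      unfold relax
      split_ifs with hcond
      · by_cases hqe : q = head e
        · subst hqe
          intro _
          obtain ⟨W, hW, hend, hlen⟩ := hφ (tail e) (.inr ⟨e, he, .inl rfl⟩) hcond.1
          refine ⟨e.1 :: W, ⟨?_, ?_, hW⟩, rfl, ?_⟩
          · rw [hend]; exact he
          · rw [hend]; rfl
          · rw [Function.update_self, hlen, List.length_cons]
        · rw [Function.update_of_ne hqe]
          exact hφ q hq
      · exact hφ q hq
    have hfold : ∀ (E' : List (Edge n)) φ, E' ⊆ E → P φ → P (E'.foldl (relax c) φ) := by
      intro E'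
      induction E' with
      | nil => exact fun φ _ h => h
      | cons e E' ih =>
        intro φ hE h
        exact ih _ (fun x hx => hE (List.mem_cons_of_mem _ hx)) (hrelax φ h e (hE (by simp)))
    have : P φ₀ := by
      rintro q (rfl | ⟨e, he, hq⟩) hne
      · exact ⟨[], trivial, rfl, h1⟩
      · by_cases hs : q = (↑s, 0)
        · subst hs; exact ⟨[], trivial, rfl, h1⟩
        · exact absurd (h0 e he q hq hs) hne
    have hrounds : ∀ R, P ((List.range R).foldl (fun φ _ => E.foldl (relax c) φ) φ₀) := by
      intro R
      induction R with
      | zero => exact this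
      | succ R ih =>
        rw [List.range_succ, List.foldl_append, List.foldl_cons, List.foldl_nil]
        exact hfold E _ (fun _ h => h) ih
    exact hrounds R
  · clear hφ
    intro W hW hlen
    have key : ∀ R, W.length ≤ R → Reached c
        ((List.range R).foldl (fun φ _ => E.foldl (relax c) φ) φ₀) W.length (endState s W) := by
      clear hlen
      induction W with
      | nil =>
        intro R _
        clear h
        induction R with
        | zero =>
          refine ⟨by simp [endState, h1], ?_⟩
          simp [endState, h1]
        | succ R ih =>
          rw [List.range_succ, List.foldl_append, List.foldl_cons, List.foldl_nil]
          exact (ih (Nat.zero_le _)).foldl E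
      | cons f W ih =>
        intro R hR
        obtain ⟨R, rfl⟩ : ∃ R', R = R' + 1 := ⟨R - 1, by simp at hR; omega⟩
        rw [List.range_succ, List.foldl_append, List.foldl_cons, List.foldl_nil]
        have hih := ih hW.2.2 R (by simpa using hR)
        refine Reached.foldl_head (e := (f, (endState s W).2)) ?_ hW.1
        rwa [show tail (f, (endState s W).2) = endState s W from Prod.ext hW.2.1 rfl]
    exact key R hlen

/-! ### Counting walks -/

section

variable {α : Type*} [AddCommMonoid α]

/-- Extends the walks to the tail of an edge by this edge; `g` is the effect of the edge. -/
def push (g : Edge n → α → α) (X : ℕ × ℕ → α) (e : Edge n) : ℕ × ℕ → α :=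
  Function.update X (head e) (X (head e) + g e (X (tail e)))

/-- The edges are listed in a topological order. -/
def Sorted (O : List (Edge n)) : Prop :=
  O.Pairwise (fun e e' => head e' ≠ tail e) ∧ ∀ e ∈ O, head e ≠ tail e

theorem Sorted.foldl_push_tail {O : List (Edge n)} {e : Edge n} (h : Sorted (O ++ [e]))
    (g : Edge n → α → α) (X : ℕ × ℕ → α) {e' : Edge n} (he' : e' ∈ O ++ [e]) :
    (O ++ [e]).foldl (push g) X (tail e') = O.foldl (push g) X (tail e') := by
  rw [List.foldl_append, List.foldl_cons, List.foldl_nil]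
  refine Function.update_of_ne ?_ _ _
  rcases List.mem_append.1 he' with h' | h'
  · exact ((List.pairwise_append.1 h.1).2.2 e' h' e (by simp)).symm
  · obtain rfl : e' = e := by simpa using h'
    exact (h.2 e' (by simp)).symm

theorem Sorted.of_append {O : List (Edge n)} {e : Edge n} (h : Sorted (O ++ [e])) : Sorted O :=
  ⟨(List.pairwise_append.1 h.1).1, fun e' he' => h.2 e' (by simp [he'])⟩

/-- If the edges are processed in a topological order, then the values of the tails are final when
an edge is processed, so that the result solves the linear equations of the state graph. -/
theorem Sorted.foldl_push {O : List (Edge n)} (h : Sorted O) (g : Edge n → α → α) (X : ℕ × ℕ → α)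
    (q : ℕ × ℕ) : O.foldl (push g) X q = X q +
      ((O.filter fun e => head e = q).map fun e => g e (O.foldl (push g) X (tail e))).sum := by
  induction O using List.reverseRecOn with
  | nil => simp
  | append_singleton O e ih =>
    have h1 : ((O.filter fun e => head e = q).map fun e' =>
        g e' ((O ++ [e]).foldl (push g) X (tail e'))) = (O.filter fun e => head e = q).map
          fun e' => g e' (O.foldl (push g) X (tail e')) := by
      refine List.map_congr_left fun e' he' => ?_
      rw [h.foldl_push_tail g X (List.mem_append_left _ (List.mem_filter.1 he').1)]
    rw [List.filter_append, List.map_append, List.sum_append, h1, ← add_assoc, ← ih h.of_append]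
    by_cases hq : head e = q
    · simp only [hq, decide_true, List.filter_cons_of_pos, List.filter_nil, List.map_cons,
        List.map_nil, List.sum_cons, List.sum_nil, add_zero]
      rw [h.foldl_push_tail g X (by simp), List.foldl_append, List.foldl_cons, List.foldl_nil]
      simp only [push, hq, Function.update_self]
    · simp only [hq, decide_false, Bool.false_eq_true, not_false_eq_true, List.filter_cons_of_neg,
        List.filter_nil, List.map_nil, List.sum_nil, add_zero]
      rw [List.foldl_append, List.foldl_cons, List.foldl_nil]
      exact Function.update_of_ne (Ne.symm hq) _ _

end

/-- All walks in the state graph that end in a given state. -/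
def walksTo (O : List (Edge n)) (s : Fin n) : ℕ × ℕ → Multiset (List (TimeArc n)) :=
  O.foldl (push fun e m => m.map (e.1 :: ·)) fun q => if q = (↑s, 0) then {[]} else 0

/-- All walks in the state graph the last edge of which satisfies `P`. -/
def walksBy (O : List (Edge n)) (s : Fin n) (P : Edge n → Prop) [DecidablePred P] :
    Multiset (List (TimeArc n)) :=
  ((O.filter fun e => P e).map fun e => (walksTo O s (tail e)).map (e.1 :: ·)).sum

section

variable {O : List (Edge n)} {s : Fin n} [DecidableEq (TimeArc n)]

theorem count_walksBy_nil (P : Edge n → Prop) [DecidablePred P] :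
    (walksBy O s P).count [] = 0 := by
  have := map_list_sum (Multiset.countAddMonoidHom ([] : List (TimeArc n)))
    ((O.filter fun e => P e).map fun e => (walksTo O s (tail e)).map (e.1 :: ·))
  rw [Multiset.coe_countAddMonoidHom] at this
  rw [walksBy, this, List.sum_eq_zero]
  simp only [List.map_map, List.mem_map, Function.comp_apply]
  rintro x ⟨e, -, rfl⟩
  rw [Multiset.count_eq_zero]
  simp

open Classical in
/-- Every walk `f :: W` arises only from the edge `(f, t)`, where `t` is the time of arrival of `W`,
and from the walk `W` to the tail of this edge. -/
theorem count_walksBy_cons (hO : O.Nodup) (P : Edge n → Prop) [DecidablePred P] (f : TimeArc n)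
    {W : List (TimeArc n)} (hW : ∀ q, (walksTo O s q).count W =
      if Trail O s W ∧ endState s W = q then 1 else 0) :
    (walksBy O s P).count (f :: W) =
      if Trail O s (f :: W) ∧ P (f, (endState s W).2) then 1 else 0 := by
  have := map_list_sum (Multiset.countAddMonoidHom (f :: W))
    ((O.filter fun e => P e).map fun e => (walksTo O s (tail e)).map (e.1 :: ·))
  rw [Multiset.coe_countAddMonoidHom] at this
  rw [walksBy, this, List.map_map]
  set e₀ : Edge n := (f, (endState s W).2) with he₀
  have h1 : ∀ e ∈ O.filter fun e => P e, (Multiset.count (f :: W) ∘ fun e =>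
      (walksTo O s (tail e)).map (e.1 :: ·)) e =
      if e = e₀ ∧ (f.src : ℕ) = (endState s W).1 ∧ Trail O s W then 1 else 0 := by
    intro e _
    rw [Function.comp_apply]
    by_cases hf : e.1 = f
    · subst hf
      rw [Multiset.count_map_eq_count' _ _ (List.cons_injective), hW]
      congr 1
      simp only [eq_iff_iff, he₀, tail, Prod.ext_iff, true_and]
      constructor
      · rintro ⟨h1, h2, h3⟩; exact ⟨h3.symm, h2.symm, h1⟩
      · rintro ⟨h1, h2, h3⟩; exact ⟨h3, h2.symm, h1.symm⟩
    · rw [if_neg (fun h => hf (by rw [h.1]))]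
      rw [Multiset.count_eq_zero, Multiset.mem_map]
      rintro ⟨W', -, h⟩
      exact hf (List.cons_eq_cons.1 h).1
  rw [List.map_congr_left h1]
  by_cases hC : (f.src : ℕ) = (endState s W).1 ∧ Trail O s W
  · simp only [hC, and_self, and_true]
    have h2 : ((O.filter fun e => P e).map fun e => if e = e₀ then 1 else 0).sum =
        (O.filter fun e => P e).count e₀ := by
      rw [List.count_eq_countP, List.countP_eq_length_filter]
      induction O.filter fun e => P e with
      | nil => simp
      | cons e l ih =>
        rw [List.map_cons, List.sum_cons, ih]
        by_cases he : e = e₀ <;> simp [he, add_comm]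
    rw [h2, (hO.filter _).count]
    congr 1
    simp only [List.mem_filter, decide_eq_true_eq, Trail, hC, and_true, he₀]
  · rw [if_neg (fun h => hC ⟨h.1.2.1, h.1.2.2⟩), List.sum_eq_zero]
    simp only [List.mem_map]
    rintro x ⟨e, -, rfl⟩
    rw [if_neg (fun h => hC h.2)]

open Classical in
/-- The pushing procedure yields each walk exactly once. -/
theorem count_walksTo (hO : O.Nodup) (hs : Sorted O) (W : List (TimeArc n)) (q : ℕ × ℕ) :
    (walksTo O s q).count W = if Trail O s W ∧ endState s W = q then 1 else 0 := by
  have hrec : ∀ q, walksTo O s q =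
      (if q = (↑s, 0) then {[]} else 0) + walksBy O s (fun e => head e = q) := by
    intro q
    rw [walksTo, hs.foldl_push]
    rfl
  induction W generalizing q with
  | nil =>
    rw [hrec, Multiset.count_add, count_walksBy_nil, add_zero]
    by_cases hq : q = (↑s, 0)
    · simp [hq, Trail, endState]
    · simp [hq, Trail, endState, Ne.symm hq]
  | cons f W ih =>
    rw [hrec, Multiset.count_add, count_walksBy_cons hO _ f ih]
    have : Multiset.count (f :: W) (if q = (↑s, 0) then {[]} else 0) = 0 := by
      split_ifs <;> simp
    rw [this, zero_add]
    rfl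

end

end TemporalBetweenness

namespace TemporalBetweenness

variable {n : ℕ}

/-! ### Numbers of walks as results of the passes -/

/-- A walk to `z` whose last transition satisfies `F`, listed in reverse order. -/
def OptTrail (O : List (Edge n)) (s : Fin n) (F : TimeArc n → Prop) (z : Fin n)
    (W : List (TimeArc n)) : Prop :=
  Trail O s W ∧ ∃ f ∈ W.head?, F f ∧ f.dst = z

/-- The walk arrives at the vertex `v` at some time. -/
def Visits (v : ℕ) (W : List (TimeArc n)) : Prop := ∃ f ∈ W, (f.dst : ℕ) = v

section

variable {α β : Type*} [AddCommMonoid α] [AddCommMonoid β]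

/-- An accumulator that reads the value of the tail of each processed edge reads the final value. -/
theorem Sorted.foldl_acc {O : List (Edge n)} (h : Sorted O) (g : Edge n → α → α)
    (k : Edge n → α → β) (X : ℕ × ℕ → α) (b : β) :
    O.foldl (fun (x : (ℕ × ℕ → α) × β) e => (push g x.1 e, x.2 + k e (x.1 (tail e)))) (X, b) =
      (O.foldl (push g) X, b + (O.map fun e => k e (O.foldl (push g) X (tail e))).sum) := by
  induction O using List.reverseRecOn with
  | nil => simp
  | append_singleton O e ih =>
    rw [List.foldl_append, ih h.of_append, List.foldl_cons, List.foldl_nil]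
    have h1 : ((O ++ [e]).map fun e' => k e' ((O ++ [e]).foldl (push g) X (tail e'))) =
        (O ++ [e]).map fun e' => k e' (O.foldl (push g) X (tail e')) :=
      List.map_congr_left fun e' he' => by rw [h.foldl_push_tail g X he']
    rw [h1, List.foldl_append, List.foldl_cons, List.foldl_nil]
    simp [add_assoc]

/-- Additive maps carry over from the collections of walks to their sizes. Only the values in `N`
matter, as the memory may hold arbitrary values elsewhere. -/
theorem foldl_push_hom {O : List (Edge n)} (H : α →+ β) {g : Edge n → α → α} {g' : Edge n → β → β}
    (hg : ∀ e a, H (g e a) = g' e (H a)) {N : Set (ℕ × ℕ)}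
    (hN : ∀ e ∈ O, tail e ∈ N ∧ head e ∈ N) {X : ℕ × ℕ → α} {X' : ℕ × ℕ → β}
    (hX : ∀ q ∈ N, X' q = H (X q)) :
    ∀ q ∈ N, O.foldl (push g') X' q = H (O.foldl (push g) X q) := by
  induction O generalizing X X' with
  | nil => exact hX
  | cons e O ih =>
    refine ih (fun e' he' => hN e' (List.mem_cons_of_mem _ he')) fun q hq => ?_
    obtain ⟨h1, h2⟩ := hN e (by simp)
    unfold push
    by_cases hqe : q = head e
    · subst hqe
      rw [Function.update_self, Function.update_self, map_add, hg, hX _ h1, hX _ h2]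
    · rw [Function.update_of_ne hqe, Function.update_of_ne hqe, hX q hq]

end

section

variable {O : List (Edge n)} {s : Fin n}

open Classical in
theorem count_walksBy (hO : O.Nodup) (hs : Sorted O) (F : TimeArc n → Prop) (z : Fin n)
    (W : List (TimeArc n)) :
    (walksBy O s fun e => F e.1 ∧ e.1.dst = z).count W = if OptTrail O s F z W then 1 else 0 := by
  cases W with
  | nil => rw [count_walksBy_nil, if_neg]; rintro ⟨-, f, hf, -⟩; simp at hf
  | cons f W =>
    rw [count_walksBy_cons hO _ f (count_walksTo hO hs W)]
    simp [OptTrail]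

open Classical in
theorem setOf_optTrail (hO : O.Nodup) (hs : Sorted O) (F : TimeArc n → Prop) (z : Fin n)
    (Q : List (TimeArc n) → Prop) : {W | OptTrail O s F z W ∧ Q W} =
      ↑((walksBy O s fun e => F e.1 ∧ e.1.dst = z).filter Q).toFinset := by
  ext W
  have := count_walksBy (s := s) hO hs F z W
  rw [Set.mem_ofPred_eq, Finset.mem_coe, Multiset.mem_toFinset, Multiset.mem_filter,
    ← Multiset.count_pos, this]
  split_ifs with h <;> simp [h]

theorem finite_optTrail (hO : O.Nodup) (hs : Sorted O) (F : TimeArc n → Prop) (z : Fin n) :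
    {W | OptTrail O s F z W}.Finite := by
  have := setOf_optTrail (s := s) hO hs F z fun _ => True
  simp only [and_true] at this
  rw [this]
  exact Finset.finite_toSet _

open Classical in
theorem ncard_optTrail (hO : O.Nodup) (hs : Sorted O) (F : TimeArc n → Prop) (z : Fin n)
    (Q : List (TimeArc n) → Prop) : {W | OptTrail O s F z W ∧ Q W}.ncard =
      ((walksBy O s fun e => F e.1 ∧ e.1.dst = z).filter Q).card := by
  rw [setOf_optTrail hO hs, Set.ncard_coe_finset, Multiset.toFinset_card_of_nodup]
  refine Multiset.Nodup.filter _ (Multiset.nodup_iff_count_le_one.2 fun W => ?_)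
  rw [count_walksBy hO hs]
  split_ifs <;> simp

/-- The number of walks, and the number of walks through `v`. -/
noncomputable def cardHom (v : ℕ) : Multiset (List (TimeArc n)) →+ ℚ × ℚ := by
  classical
  exact {
    toFun m := (m.card, (m.filter (Visits v)).card)
    map_zero' := by simp
    map_add' a b := by simp }

open Classical in
theorem cardHom_apply (v : ℕ) (m : Multiset (List (TimeArc n))) :
    cardHom v m = ((m.card : ℚ), ((m.filter (Visits v)).card : ℚ)) := by
  unfold cardHom
  rfl

/-- The effect of an edge on the number of walks, and on the number of walks through `v`. -/
def through (v : ℕ) (e : Edge n) (y : ℚ × ℚ) : ℚ × ℚ := (y.1, if v = e.1.dst then y.1 else y.2)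

theorem cardHom_map_cons (v : ℕ) (e : Edge n) (m : Multiset (List (TimeArc n))) :
    cardHom v (m.map (e.1 :: ·)) = through v e (cardHom v m) := by
  classical
  simp only [cardHom_apply, through, Multiset.card_map, Prod.mk.injEq, true_and,
    Multiset.filter_map]
  by_cases hv : v = e.1.dst
  · rw [if_pos hv, Multiset.filter_eq_self.2]
    intro W _
    exact ⟨e.1, by simp, hv.symm⟩
  · rw [if_neg hv]
    congr 2
    refine Multiset.filter_congr fun W _ => ?_
    simp [Visits, Ne.symm hv]

/-- The walk counts have their initial values. -/
structure Initial (N : Set (ℕ × ℕ)) (s : Fin n) (Y : ℕ × ℕ → ℚ) : Prop where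
  source : Y (s, 0) = 1
  eq_zero : ∀ q ∈ N, q ≠ (↑s, 0) → Y q = 0

/-- The computed numbers are the sizes of the collections of walks. -/
theorem foldl_through (v : ℕ) {N : Set (ℕ × ℕ)} (hN : ∀ e ∈ O, tail e ∈ N ∧ head e ∈ N)
    {Y Z : ℕ × ℕ → ℚ} (hY : Initial N s Y) (hZ : ∀ q ∈ N, Z q = 0) :
    ∀ q ∈ N, O.foldl (push (through v)) (fun q => (Y q, Z q)) q = cardHom v (walksTo O s q) := by
  refine foldl_push_hom (cardHom v) (cardHom_map_cons v) hN fun q hq => ?_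
  classical
  rw [cardHom_apply, hZ q hq]
  by_cases hs : q = (↑s, 0)
  · subst hs
    rw [hY.source, if_pos rfl, Multiset.filter_singleton, if_neg]
    · simp
    · rintro ⟨f, hf, -⟩
      simp at hf
  · rw [hY.eq_zero q hq hs, if_neg hs]
    simp

theorem foldl_push_fst (v : ℕ) (Y Z : ℕ × ℕ → ℚ) (q : ℕ × ℕ) :
    (O.foldl (push (through v)) (fun q => (Y q, Z q)) q).1 = O.foldl extend Y q := by
  refine (foldl_push_hom (O := O) (g := through v) (g' := fun _ y => y) (AddMonoidHom.fst ℚ ℚ)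
    (fun _ _ => rfl) (N := Set.univ) (by simp) (X := fun q => (Y q, Z q)) (X' := Y)
    (fun _ _ => rfl) q trivial).symm.trans ?_
  rfl

open Classical in
/-- The number of optimal walks to `z`. -/
theorem foldl_countStep (hO : O.Nodup) (hs : Sorted O) (F : TimeArc n → Prop) {N : Set (ℕ × ℕ)}
    (hN : ∀ e ∈ O, tail e ∈ N ∧ head e ∈ N) {Y : ℕ × ℕ → ℚ} (hY : Initial N s Y) (sig : ℕ → ℚ)
    (z : Fin n) : (O.foldl (countStep F) (Y, sig)).2 z =
      sig z + ({W | OptTrail O s F z W}.ncard : ℚ) := by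
  set k : Edge n → ℚ → ℕ → ℚ := fun e y => if F e.1 then Pi.single (e.1.dst : ℕ) y else 0 with hk
  have h1 : countStep (n := n) F = fun x e =>
      (push (fun _ y => y) x.1 e, x.2 + k e (x.1 (tail e))) := by
    funext x e
    refine Prod.ext rfl ?_
    funext z
    simp only [countStep, hk]
    split_ifs with hF
    · by_cases hz : z = e.1.dst
      · subst hz; simp
      · simp [hz]
    · simp
  rw [h1, hs.foldl_acc]
  have h2 : ∀ e ∈ O, O.foldl (push fun _ y => y) Y (tail e) = (walksTo O s (tail e)).card := by
    intro e he
    have := foldl_through 0 hN hY (Z := fun _ => 0) (fun _ _ => rfl) (tail e) (hN e he).1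
    have h3 := foldl_push_fst (O := O) 0 Y (fun _ => 0) (tail e)
    rw [this, cardHom_apply] at h3
    exact h3.symm
  have h3 := ncard_optTrail (s := s) hO hs F z fun _ => True
  rw [(@Multiset.filter_eq_self _ (fun _ => True) (fun _ => propDecidable _) _).2
    fun _ _ => trivial] at h3
  simp only [and_true] at h3
  rw [h3, walksBy]
  refine congrArg (sig z + ·) ?_
  clear h1 h3
  have h4 : ∀ l : List (Edge n), l ⊆ O → (l.map fun e =>
      k e (O.foldl (push fun _ y => y) Y (tail e))).sum (z : ℕ) =
      ((((l.filter fun e => decide (F e.1 ∧ e.1.dst = z)).map fun e =>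
        (walksTo O s (tail e)).map (e.1 :: ·)).sum).card : ℚ) := by
    intro l hl
    induction l with
    | nil => simp
    | cons e l ih =>
      rw [List.map_cons, List.sum_cons, Pi.add_apply,
        ih fun x hx => hl (List.mem_cons_of_mem _ hx), h2 e (hl (by simp))]
      by_cases hF : F e.1
      · by_cases hz : e.1.dst = z
        · simp [hk, hF, hz]
        · have : (z : ℕ) ≠ e.1.dst := fun h => hz (Fin.ext h.symm)
          simp [hk, hF, hz, this]
      · simp [hk, hF]
  exact h4 O (fun _ h => h)

open Classical in
/-- The contributions of all optimal walks to the betweenness of `v`. -/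
theorem foldl_dependencyStep (hO : O.Nodup) (hs : Sorted O) (F : TimeArc n → Prop)
    {N : Set (ℕ × ℕ)} (hN : ∀ e ∈ O, tail e ∈ N ∧ head e ∈ N) {a : Shares}
    (hY : Initial N s a.Y) (sig : ℕ → ℚ) (v : Fin n) (hZ : ∀ q ∈ N, a.Z v q = 0) :
    (O.foldl (dependencyStep F s sig) a).out v = a.out v +
      ∑ z : Fin n, if s ≠ v ∧ z ≠ v then
        ({W | OptTrail O s F z W ∧ Visits v W}.ncard : ℚ) / sig z else 0 := by
  set k : Edge n → ℚ × ℚ → ℚ := fun e y =>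
    if F e.1 ∧ (v : ℕ) ≠ e.1.dst ∧ (v : ℕ) ≠ s then y.2 / sig e.1.dst else 0 with hk
  set p : Shares → (ℕ × ℕ → ℚ × ℚ) × ℚ := fun a => (fun q => (a.Y q, a.Z v q), a.out v) with hp
  have h1 : ∀ a e, p (dependencyStep F s sig a e) =
      (push (through v) (p a).1 e, (p a).2 + k e ((p a).1 (tail e))) := by
    intro a e
    refine Prod.ext ?_ ?_
    · funext q
      simp only [hp, dependencyStep, if_pos v.2, extend, extendThrough, push, through]
      by_cases hq : q = head e
      · subst hq
        simp
      · simp [Function.update_of_ne hq]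
    · simp only [hp, dependencyStep, if_pos v.2, share, hk]
  have h2 := List.foldl_hom (f := p) (g₁ := dependencyStep F s sig) (l := O) (init := a)
    (g₂ := fun x e => (push (through v) x.1 e, x.2 + k e (x.1 (tail e)))) (fun a e => (h1 a e).symm)
  rw [hs.foldl_acc] at h2
  have h3 : (O.foldl (dependencyStep F s sig) a).out v =
      (p (O.foldl (dependencyStep F s sig) a)).2 :=
    rfl
  rw [h3, ← h2]
  refine congrArg (a.out v + ·) ?_
  have h4 : ∀ e ∈ O, O.foldl (push (through v)) (p a).1 (tail e) =
      cardHom v (walksTo O s (tail e)) :=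
    fun e he => foldl_through v hN hY hZ (tail e) (hN e he).1
  have h5 : ∀ z : Fin n, (if s ≠ v ∧ z ≠ v then
      ({W | OptTrail O s F z W ∧ Visits v W}.ncard : ℚ) / sig z else 0) =
      (O.map fun e => if e.1.dst = z then k e (cardHom v (walksTo O s (tail e))) else 0).sum := by
    intro z
    by_cases hz : s ≠ v ∧ z ≠ v
    · rw [if_pos hz, ncard_optTrail hO hs, walksBy]
      have h6 : ∀ l : List (Edge n), (((((l.filter fun e => decide (F e.1 ∧ e.1.dst = z)).map
          fun e => (walksTo O s (tail e)).map (e.1 :: ·)).sum).filter (Visits v)).card : ℚ) /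
          sig z = (l.map fun e =>
            if e.1.dst = z then k e (cardHom v (walksTo O s (tail e))) else 0).sum := by
        intro l
        induction l with
        | nil => simp
        | cons e l ih =>
          rw [List.map_cons, List.sum_cons, ← ih]
          by_cases hF : F e.1 ∧ e.1.dst = z
          · have h7 : (((walksTo O s (tail e)).map (e.1 :: ·)).filter (Visits v)).card =
                (cardHom v (walksTo O s (tail e))).2 := by
              have := congrArg Prod.snd (cardHom_map_cons v e (walksTo O s (tail e)))
              rw [cardHom_apply] at this
              dsimp only at this
              rw [this, through, if_neg]
              rw [hF.2]
              exact fun h => hz.2 (Fin.ext h).symm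
            have h8 : F e.1 ∧ (v : ℕ) ≠ e.1.dst ∧ (v : ℕ) ≠ s :=
              ⟨hF.1, fun h => hz.2 (by rw [← hF.2]; exact (Fin.ext h).symm),
                fun h => hz.1 (Fin.ext h).symm⟩
            have h9 : ∀ y, k e y = y.2 / sig z := fun y => by
              simp only [hk]
              rw [if_pos h8, hF.2]
            rw [List.filter_cons_of_pos (by simpa using hF), List.map_cons, List.sum_cons,
              Multiset.filter_add, Multiset.card_add, Nat.cast_add, add_div, h7, if_pos hF.2, h9]
          · rw [List.filter_cons_of_neg (by simpa using hF)]
            have : (if e.1.dst = z then k e (cardHom v (walksTo O s (tail e))) else 0) = 0 := by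
              simp only [hk]
              split_ifs with h1 h2
              · exact absurd ⟨h2.1, h1⟩ hF
              · rfl
              · rfl
            rw [this, zero_add]
      exact h6 O
    · rw [if_neg hz, List.sum_eq_zero]
      simp only [List.mem_map]
      rintro x ⟨e, -, rfl⟩
      simp only [hk]
      split_ifs with h1 h2
      · refine absurd ⟨fun h => h2.2.2 (by rw [h]), fun h => h2.2.1 ?_⟩ hz
        rw [h1, h]
      · rfl
      · rfl
  rw [Finset.sum_congr rfl fun z _ => h5 z]
  rw [List.map_congr_left (g := fun e => k e (cardHom v (walksTo O s (tail e))))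
    fun e he => by rw [h4 e he]]
  have h9 : ∀ (l : List (Edge n)) (κ : Edge n → ℚ), (l.map κ).sum =
      ∑ z : Fin n, (l.map fun e => if e.1.dst = z then κ e else 0).sum := by
    intro l κ
    induction l with
    | nil => simp
    | cons e l ih => simp [ih, Finset.sum_add_distrib]
  exact h9 O _

end

end TemporalBetweenness

namespace TemporalBetweenness

variable {n : ℕ}

/-! ### Optimal walks in the state graph -/

theorem mem_sortedEdges {c : Variant} {R : ℕ} {φ : ℕ × ℕ → ℕ} {best : ℕ → ℕ} {E : List (Edge n)}
    {e : Edge n} : e ∈ sortedEdges c R φ best E ↔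
      e ∈ E ∧ Active c φ best e ∧ φ (head e) ≠ 0 ∧ φ (head e) ≤ R := by
  simp only [sortedEdges, List.mem_flatMap, List.mem_range, List.mem_filter, decide_eq_true_eq]
  constructor
  · rintro ⟨r, hr, h1, h2, h3⟩
    exact ⟨h1, h2, by omega, by omega⟩
  · rintro ⟨h1, h2, h3, h4⟩
    exact ⟨φ (head e) - 1, by omega, h1, h2, by omega⟩

theorem Active.lt {c : Variant} {φ : ℕ × ℕ → ℕ} {best : ℕ → ℕ} {e : Edge n}
    (h : Active c φ best e) : φ (tail e) < φ (head e) := by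
  obtain ⟨-, h⟩ := h
  split_ifs at h
  · exact h.1
  · omega

theorem sorted_sortedEdges (c : Variant) (R : ℕ) (φ : ℕ × ℕ → ℕ) (best : ℕ → ℕ)
    (E : List (Edge n)) : Sorted (sortedEdges c R φ best E) := by
  constructor
  · have h : (sortedEdges c R φ best E).Pairwise fun e e' => φ (head e) ≤ φ (head e') := by
      refine List.pairwise_flatMap.2 ⟨fun r _ => ?_, ?_⟩
      · refine List.pairwise_of_forall_mem_list fun e he e' he' => ?_
        simp only [List.mem_filter, decide_eq_true_eq] at he he'
        rw [he.2.2, he'.2.2]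
      · refine List.pairwise_lt_range.imp fun {r r'} hr e he e' he' => ?_
        simp only [List.mem_filter, decide_eq_true_eq] at he he'
        rw [he.2.2, he'.2.2]
        omega
    refine h.imp_of_mem fun {e e'} he he' hle heq => ?_
    have := (mem_sortedEdges.1 he).2.1.lt
    rw [← heq] at this
    omega
  · intro e he heq
    have := (mem_sortedEdges.1 he).2.1.lt
    rw [heq] at this
    omega

theorem nodup_sortedEdges {c : Variant} {R : ℕ} {φ : ℕ × ℕ → ℕ} {best : ℕ → ℕ}
    {E : List (Edge n)} (hE : E.Nodup) : (sortedEdges c R φ best E).Nodup := by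
  refine List.nodup_flatMap.2 ⟨fun r _ => hE.filter _, ?_⟩
  refine List.nodup_range.imp fun {r r'} hr e he he' => ?_
  simp only [List.mem_filter, decide_eq_true_eq] at he he'
  omega

theorem nodup_edges {c : Variant} {T lim : ℕ} {L : List (TimeArc n)} (hL : L.Nodup) (s t₀ : ℕ) :
    (edges c T lim L s t₀).Nodup := by
  refine List.nodup_flatMap.2 ⟨fun f _ => ?_, ?_⟩
  · exact (List.nodup_range.map (Prod.mk_right_injective f)).filter _
  · refine hL.imp fun {f f'} hf e he he' => ?_
    simp only [List.mem_filter, List.mem_map] at he he'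
    obtain ⟨⟨t, -, rfl⟩, -⟩ := he
    obtain ⟨⟨t', -, h⟩, -⟩ := he'
    exact hf (congrArg Prod.fst h).symm

theorem mem_edges {c : Variant} {T lim : ℕ} {L : List (TimeArc n)} {s t₀ : ℕ} {e : Edge n} :
    e ∈ edges c T lim L s t₀ ↔ e.1 ∈ L ∧ e.2 ≤ T ∧ EdgeOK c lim s t₀ e := by
  simp only [edges, List.mem_flatMap, List.mem_filter, List.mem_map, List.mem_range,
    decide_eq_true_eq]
  constructor
  · rintro ⟨f, hf, ⟨t, ht, rfl⟩, h⟩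
    exact ⟨hf, by omega, h⟩
  · rintro ⟨h1, h2, h3⟩
    exact ⟨e.1, h1, ⟨e.2, by omega, rfl⟩, h3⟩

/-- The cost of a walk with departure time `t₀ + 1`; it encodes the lexicographic order on durations
and lengths if both count. -/
def walkCost (c : Variant) (R t₀ : ℕ) (W : List (TimeArc n)) : ℕ :=
  if c.foremost then (W.head?.map TimeArc.time).getD 0
  else if c.multi then ((W.head?.map TimeArc.time).getD 0 - (t₀ + 1)) * (R + 1) + (W.length + 1)
  else W.length + 1

/-- For every walk there is a walk to the same state that is not longer and not too long. -/
def HasShort (R : ℕ) (E : List (Edge n)) (s : Fin n) : Prop :=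
  ∀ W, Trail E s W → ∃ W', Trail E s W' ∧ endState s W' = endState s W ∧
    W'.length ≤ W.length ∧ W'.length + 1 ≤ R

/-- All time steps are positive, so that no edge leads back to the starting state. -/
def PosTime (E : List (Edge n)) : Prop := ∀ e ∈ E, 1 ≤ e.1.time

section

variable {c : Variant} {R t₀ : ℕ} {E : List (Edge n)} {s : Fin n} {φ : ℕ × ℕ → ℕ} {best : ℕ → ℕ}

theorem Ranked.ne_zero (h : Ranked c R E s φ) (hS : HasShort R E s) {W : List (TimeArc n)}
    (hW : Trail E s W) : φ (endState s W) ≠ 0 := by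
  obtain ⟨W', h1, h2, -, h4⟩ := hS W hW
  rw [← h2]
  exact (h.complete W' h1 (by omega)).1

theorem Ranked.le (h : Ranked c R E s φ) (hS : HasShort R E s) (hc : c.foremost = false)
    {W : List (TimeArc n)} (hW : Trail E s W) :
    φ (endState s W) ≤ W.length + 1 ∧ φ (endState s W) ≤ R := by
  obtain ⟨W', h1, h2, h3, h4⟩ := hS W hW
  have := (h.complete W' h1 (by omega)).2
  simp only [hc, Bool.false_eq_true, if_false] at this
  rw [← h2]
  omega

theorem trail_cons {e : Edge n} (he : e ∈ E) {W : List (TimeArc n)} (hW : Trail E s W)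
    (hend : endState s W = tail e) : Trail E s (e.1 :: W) := by
  refine ⟨?_, ?_, hW⟩
  · rw [hend]; exact he
  · rw [hend]; rfl

/-- The ranks determine the least cost of a walk to each state. -/
theorem Ranked.exists_walkCost (h : Ranked c R E s φ) (hS : HasShort R E s) (hE : PosTime E)
    {e : Edge n} (he : e ∈ E) (ht : φ (tail e) ≠ 0) :
    ∃ W, Trail E s W ∧ (∃ f ∈ W.head?, f.dst = e.1.dst) ∧ walkCost c R t₀ W = key c R t₀ φ e.1 := by
  obtain ⟨W, hW, hend, -⟩ := h.sound _ (.inr ⟨e, he, .inl rfl⟩) ht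
  have h1 := h.ne_zero hS (trail_cons he hW hend)
  obtain ⟨V, hV, hVend, hlen⟩ := h.sound _ (.inr ⟨e, he, .inr rfl⟩) h1
  cases V with
  | nil =>
    have := hE e he
    have h2 := congrArg Prod.snd hVend
    simp only [endState, head] at h2
    omega
  | cons f V =>
    simp only [endState, head, Prod.mk.injEq] at hVend
    refine ⟨f :: V, hV, ⟨f, rfl, Fin.ext hVend.1⟩, ?_⟩
    unfold walkCost key
    simp only [List.head?_cons, Option.map_some, Option.getD_some, hVend.2]
    simp only [head] at hlen
    rw [hlen]

theorem Ranked.key_le (h : Ranked c R E s φ) (hS : HasShort R E s) {f : TimeArc n}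
    {W : List (TimeArc n)} (hW : Trail E s (f :: W)) :
    key c R t₀ φ f ≤ walkCost c R t₀ (f :: W) := by
  unfold walkCost key
  split_ifs with h1 h2
  · simp
  · have := (h.le hS (by simpa using h1) hW).1
    simpa [endState] using this
  · exact (h.le hS (by simpa using h1) hW).1

theorem key_pos (hE : PosTime E) (h : Ranked c R E s φ) (hS : HasShort R E s) {e : Edge n}
    (he : e ∈ E) (ht : φ (tail e) ≠ 0) : key c R t₀ φ e.1 ≠ 0 := by
  obtain ⟨W, hW, ⟨f, hf, -⟩, h1⟩ := h.exists_walkCost (t₀ := t₀) hS hE he ht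
  rw [← h1]
  unfold walkCost
  split_ifs
  · cases W with
    | nil => simp at hf
    | cons g W =>
      have : 1 ≤ g.time := hE _ hW.1
      simp only [List.head?_cons, Option.map_some, Option.getD_some]
      omega
  · omega
  · omega

/-- The edges that take part in the computation of the least costs. -/
def Counts (c : Variant) (s : ℕ) (φ : ℕ × ℕ → ℕ) (e : Edge n) : Prop :=
  φ (tail e) ≠ 0 ∧ (c.closed = false → (e.1.dst : ℕ) ≠ s)

theorem foldl_bestStep_le {s : ℕ} (E : List (Edge n)) (best : ℕ → ℕ)
    (hpos : ∀ e ∈ E, Counts c s φ e → key c R t₀ φ e.1 ≠ 0) (z : ℕ) (m : ℕ)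
    (hz : (best z ≠ 0 ∧ best z ≤ m) ∨
      ∃ e ∈ E, Counts c s φ e ∧ e.1.dst = z ∧ key c R t₀ φ e.1 ≤ m) :
    E.foldl (bestStep c R s t₀ φ) best z ≠ 0 ∧ E.foldl (bestStep c R s t₀ φ) best z ≤ m := by
  induction E generalizing best with
  | nil => simpa using hz
  | cons e E ih =>
    refine ih _ (fun e' he' => hpos e' (List.mem_cons_of_mem _ he')) ?_
    have hpe := hpos e (by simp)
    by_cases h : ∃ e ∈ E, Counts c s φ e ∧ e.1.dst = z ∧ key c R t₀ φ e.1 ≤ m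
    · exact .inr h
    left
    have hz' : (best z ≠ 0 ∧ best z ≤ m) ∨
        (Counts c s φ e ∧ e.1.dst = z ∧ key c R t₀ φ e.1 ≤ m) := by
      rcases hz with hz | ⟨e', he', hz⟩
      · exact .inl hz
      · rcases List.mem_cons.1 he' with rfl | he'
        · exact .inr hz
        · exact absurd ⟨e', he', hz⟩ h
    unfold bestStep
    split_ifs with hcond
    · by_cases hze : z = e.1.dst
      · subst hze
        rw [Function.update_self]
        have := hpe ⟨hcond.1, hcond.2.1⟩
        rcases hz' with hz' | hz' <;> omega
      · rw [Function.update_of_ne hze]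
        rcases hz' with hz' | hz'
        · exact hz'
        · exact absurd hz'.2.1.symm hze
    · rcases hz' with hz' | ⟨hz1, hz2, hz3⟩
      · exact hz'
      · subst hz2
        have h5 : ¬ (best e.1.dst = 0 ∨ key c R t₀ φ e.1 < best e.1.dst) :=
          fun h' => hcond ⟨hz1.1, hz1.2, h'⟩
        omega

theorem foldl_bestStep_eq {s : ℕ} (E : List (Edge n)) (best : ℕ → ℕ) (z : ℕ) :
    E.foldl (bestStep c R s t₀ φ) best z = best z ∨ ∃ e ∈ E, Counts c s φ e ∧ e.1.dst = z ∧
      E.foldl (bestStep c R s t₀ φ) best z = key c R t₀ φ e.1 := by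
  induction E generalizing best with
  | nil => simp
  | cons e E ih =>
    rcases ih (bestStep c R s t₀ φ best e) with h | ⟨e', he', h⟩
    · rw [List.foldl_cons, h]
      unfold bestStep
      split_ifs with hcond
      · by_cases hze : z = e.1.dst
        · subst hze
          exact .inr ⟨e, by simp, ⟨hcond.1, hcond.2.1⟩, rfl, Function.update_self ..⟩
        · exact .inl (Function.update_of_ne hze ..)
      · exact .inl rfl
    · exact .inr ⟨e', List.mem_cons_of_mem _ he', h⟩

end

/-- The number `best z` is the least cost of a walk to `z`, for all classes of departure times below
`k`, where `E t₀` are the edges for the class `t₀`. -/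
structure BestFor (c : Variant) (R k : ℕ) (E : ℕ → List (Edge n)) (s : Fin n)
    (best : ℕ → ℕ) : Prop where
  sound : ∀ z : Fin n, best z ≠ 0 → (c.closed = false → z ≠ s) ∧ ∃ t₀ < k, ∃ W,
    Trail (E t₀) s W ∧ (∃ f ∈ W.head?, f.dst = z) ∧ walkCost c R t₀ W = best z
  complete : ∀ z : Fin n, (c.closed = false → z ≠ s) → ∀ t₀ < k, ∀ W, Trail (E t₀) s W →
    (∃ f ∈ W.head?, f.dst = z) → best z ≠ 0 ∧ best z ≤ walkCost c R t₀ W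

theorem BestFor.zero (c : Variant) (R : ℕ) (E : ℕ → List (Edge n)) (s : Fin n) (best : ℕ → ℕ)
    (hbest : ∀ v < n, best v = 0) : BestFor c R 0 E s best :=
  ⟨fun z hz => absurd (hbest z z.2) hz, fun _ _ _ h => absurd h (by omega)⟩

theorem BestFor.succ {c : Variant} {R k : ℕ} {E : ℕ → List (Edge n)} {s : Fin n} {best : ℕ → ℕ}
    {φ : ℕ × ℕ → ℕ} (h : BestFor c R k E s best) (hφ : Ranked c R (E k) s φ)
    (hS : HasShort R (E k) s) (hE : PosTime (E k)) :
    BestFor c R (k + 1) E s ((E k).foldl (bestStep c R s k φ) best) := by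
  have hpos : ∀ e ∈ E k, Counts c s φ e → key c R k φ e.1 ≠ 0 :=
    fun e he hc => key_pos hE hφ hS he hc.1
  constructor
  · intro z hz
    rcases foldl_bestStep_eq (c := c) (R := R) (t₀ := k) (φ := φ) (s := s) (E k) best z with
      h1 | ⟨e, he, hc, hd, h1⟩
    · rw [h1] at hz ⊢
      obtain ⟨h2, t₀, ht₀, h3⟩ := h.sound z hz
      exact ⟨h2, t₀, by omega, h3⟩
    · obtain ⟨W, hW, hf, hcost⟩ := hφ.exists_walkCost (t₀ := k) hS hE he hc.1
      have hd' : e.1.dst = z := Fin.ext hd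
      refine ⟨fun hcl hzs => hc.2 hcl (by rw [hd, hzs]), k, by omega, W, hW, ?_, ?_⟩
      · rw [← hd']; exact hf
      · rw [h1, hcost]
  · intro z hcl t₀ ht₀ W hW hf
    refine foldl_bestStep_le (E k) best hpos z _ ?_
    rcases Nat.lt_succ_iff_lt_or_eq.1 ht₀ with ht₀ | rfl
    · exact .inl (h.complete z hcl t₀ ht₀ W hW hf)
    · right
      obtain ⟨f, hf, hfz⟩ := hf
      cases W with
      | nil => simp at hf
      | cons g W =>
        obtain rfl : g = f := by simpa using hf
        refine ⟨_, hW.1, ⟨?_, ?_⟩, by rw [← hfz], hφ.key_le hS hW⟩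
        · rw [show tail (g, (endState s W).2) = endState s W from Prod.ext hW.2.1 rfl]
          exact hφ.ne_zero hS hW.2.2
        · intro h1 h2
          exact hcl h1 (by rw [← hfz]; exact Fin.ext h2)

/-- An optimal walk to `z` with departure time in the class `t₀`. -/
def IsOptimal (c : Variant) (R t₀ : ℕ) (E : List (Edge n)) (s : Fin n) (best : ℕ → ℕ) (z : Fin n)
    (W : List (TimeArc n)) : Prop :=
  Trail E s W ∧ (∃ f ∈ W.head?, f.dst = z) ∧ best z = walkCost c R t₀ W ∧
    (c.prefixOpt = true → ∀ f ∈ W, best f.dst = f.time)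

section

variable {c : Variant} {R k t₀ : ℕ} {E : List (Edge n)} {s : Fin n} {φ : ℕ × ℕ → ℕ}
  {best : ℕ → ℕ} {z : Fin n} {W : List (TimeArc n)}

/-- If lengths count, then the walks along active edges are the shortest walks to their end. -/
theorem Ranked.trail_sortedEdges (h : Ranked c R E s φ) (hS : HasShort R E s)
    (hc : c.foremost = false) :
    Trail (sortedEdges c R φ best E) s W ↔ Trail E s W ∧ φ (endState s W) = W.length + 1 := by
  induction W with
  | nil =>
    have h1 := h.le hS hc (W := []) trivial
    have h2 := h.ne_zero hS (W := []) trivial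
    simp only [Trail, true_and, true_iff, List.length_nil] at *
    omega
  | cons f W ih =>
    constructor
    · rintro ⟨h1, h2, h3⟩
      obtain ⟨h4, h5⟩ := ih.1 h3
      have h6 := mem_sortedEdges.1 h1
      refine ⟨⟨h6.1, h2, h4⟩, ?_⟩
      have h7 := h6.2.1.2
      simp only [hc, Bool.false_eq_true, if_false] at h7
      rw [show tail (f, (endState s W).2) = endState s W from Prod.ext h2 rfl, h5] at h7
      exact h7.symm
    · rintro ⟨h1, h2⟩
      have htail : tail (f, (endState s W).2) = endState s W := Prod.ext h1.2.1 rfl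
      have hne := h.ne_zero hS h1.2.2
      obtain ⟨V, hV, hVend, hVlen⟩ := h.sound _ h1.2.2.isNode hne
      have h3 := (h.le hS hc (trail_cons (s := s) h1.1 hV (hVend.trans htail.symm))).1
      have h4 := (h.le hS hc h1.2.2).1
      have h5 := (h.le hS hc h1).2
      simp only [List.length_cons] at h2 h3
      change φ (head (f, (endState s W).2)) = _ at h2
      change φ (head (f, (endState s W).2)) ≤ _ at h3
      change φ (head (f, (endState s W).2)) ≤ _ at h5
      refine ⟨mem_sortedEdges.2 ⟨h1.1, ⟨by rwa [htail], ?_⟩, by omega, h5⟩, h1.2.1,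
        ih.2 ⟨h1.2.2, by omega⟩⟩
      simp only [hc, Bool.false_eq_true, if_false]
      rw [htail]
      omega

/-- If lengths count, then the counted walks are the optimal ones. -/
theorem Ranked.optTrail_iff_of_shortest (h : Ranked c R E s φ) (hS : HasShort R E s)
    (hE : PosTime E) (hc : c.foremost = false) (hp : c.prefixOpt = false) {Es : ℕ → List (Edge n)}
    (hbest : BestFor c R k Es s best) (ht₀ : t₀ < k) (hEs : Es t₀ = E) :
    OptTrail (sortedEdges c R φ best E) s (IsFinal c R t₀ φ best) z W ↔
      IsOptimal c R t₀ E s best z W := by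
  unfold OptTrail IsOptimal
  rw [h.trail_sortedEdges hS hc]
  cases W with
  | nil => simp
  | cons f W =>
    simp only [List.head?_cons, Option.mem_def, Option.some.injEq, exists_eq_left', hp,
      Bool.false_eq_true, false_imp_iff, and_true, and_assoc]
    refine and_congr_right fun hW => ?_
    constructor
    · rintro ⟨h1, h2, h3⟩
      refine ⟨h3, ?_⟩
      rw [← h3, show best f.dst = _ from h2]
      unfold key walkCost
      simp only [hc, Bool.false_eq_true, if_false, List.head?_cons, Option.map_some,
        Option.getD_some]
      change φ (f.dst, f.time) = _ at h1
      rw [h1]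
    · rintro ⟨h3, h4⟩
      subst h3
      have h5 := h.key_le (t₀ := t₀) hS hW
      have htail : tail (f, (endState s W).2) = endState s W := Prod.ext hW.2.1 rfl
      have hne := h.ne_zero hS hW.2.2
      have hb0 : best f.dst ≠ 0 := by
        rw [h4]; unfold walkCost
        simp only [hc, Bool.false_eq_true, if_false]
        split_ifs <;> omega
      obtain ⟨V, hV, hVf, hVcost⟩ := h.exists_walkCost (t₀ := t₀) hS hE hW.1 (by rwa [htail])
      have h6 := (hbest.complete f.dst (hbest.sound _ hb0).1 t₀ ht₀ V (by rwa [hEs]) hVf).2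
      rw [hVcost] at h6
      have h7 : key c R t₀ φ f = walkCost c R t₀ (f :: W) := le_antisymm h5 (h4 ▸ h6)
      refine ⟨?_, h4.trans h7.symm, rfl⟩
      unfold key walkCost at h7
      simp only [hc, Bool.false_eq_true, if_false, List.head?_cons, Option.map_some,
        Option.getD_some] at h7
      change φ (f.dst, f.time) = _
      split_ifs at h7 <;> omega

/-- If all walks to the end of a walk are bounded in length, then their maximum length increases
along this walk. -/
theorem Ranked.trail_sortedEdges_of_bounded (h : Ranked c R E s φ) (hS : HasShort R E s)
    (hc : c.foremost = true) (hW : Trail E s W)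
    (hopt : c.prefixOpt = true → ∀ f ∈ W.tail, best f.dst = f.time)
    (hb : ∀ V, Trail E s V → endState s V = endState s W → V.length + 1 ≤ R) :
    Trail (sortedEdges c R φ best E) s W := by
  induction W with
  | nil => trivial
  | cons f W ih =>
    have htail : tail (f, (endState s W).2) = endState s W := Prod.ext hW.2.1 rfl
    have hne := h.ne_zero hS hW.2.2
    have hne' := h.ne_zero hS hW
    obtain ⟨V, hV, hVend, hVlen⟩ := h.sound _ hW.2.2.isNode hne
    obtain ⟨V', hV', hVend', hVlen'⟩ := h.sound _ hW.isNode hne'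
    have h1 := trail_cons (s := s) hW.1 hV (hVend.trans htail.symm)
    have h2 := (h.complete _ h1 (by have := hb _ h1 rfl; omega)).2
    simp only [hc, if_true, List.length_cons] at h2
    have h3 := hb _ hV' hVend'
    refine ⟨mem_sortedEdges.2 ⟨hW.1, ⟨by rwa [htail], ?_⟩, hne', ?_⟩, hW.2.1, ih hW.2.2 ?_ ?_⟩
    · simp only [hc, if_true]
      refine ⟨?_, fun hp => ?_⟩
      · rw [htail, hVlen]
        exact h2
      · cases W with
        | nil => exact .inl rfl
        | cons g W =>
          right
          have h4 : (f.src : ℕ) = g.dst := hW.2.1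
          rw [h4, hopt hp g (by simp)]
          rfl
    · change φ (endState s (f :: W)) ≤ R
      omega
    · exact fun hp g hg => hopt hp g (List.mem_of_mem_tail hg)
    · intro U hU hUend
      have h5 := hb _ (trail_cons (s := s) hW.1 hU (hUend.trans htail.symm)) rfl
      simp only [List.length_cons] at h5
      omega

/-- If arrival times count, then the counted walks are the optimal ones, provided that the lengths
of the walks to an optimal end are bounded. Otherwise, ranks along cycles of simultaneous
transitions would not be final after `R` rounds. -/
theorem Ranked.optTrail_iff_of_foremost (h : Ranked c R E s φ) (hS : HasShort R E s)
    (hE : PosTime E)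
    (hc : c.foremost = true)
    (hb : ∀ V, IsOptimal c R t₀ E s best z V → ∀ V', Trail E s V' →
      endState s V' = endState s V → V'.length + 1 ≤ R) :
    OptTrail (sortedEdges c R φ best E) s (IsFinal c R t₀ φ best) z W ↔
      IsOptimal c R t₀ E s best z W := by
  constructor
  · rintro ⟨h1, f, hf, h2, rfl⟩
    cases W with
    | nil => simp at hf
    | cons g W =>
      obtain rfl : g = f := by simpa using hf
      have h3 : best g.dst = g.time := by
        rw [show best g.dst = _ from h2]; simp [key, hc]
      refine ⟨h1.mono fun e he => (mem_sortedEdges.1 he).1, ⟨g, rfl, rfl⟩, ?_, fun hp => ?_⟩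
      · rw [h3]; simp [walkCost, hc]
      · clear hf h2 hb
        induction W generalizing g with
        | nil => simpa using h3
        | cons g' W ih =>
          intro f hf
          rcases List.mem_cons.1 hf with rfl | hf
          · exact h3
          refine ih g' h1.2.2 ?_ f hf
          have h4 := (mem_sortedEdges.1 h1.1).2.1
          have h5 := h4.2
          simp only [hc, if_true] at h5
          rcases h5.2 hp with h6 | h6
          · exfalso
            have h7 : 1 ≤ g'.time := hE _ (mem_sortedEdges.1 h1.2.2.1).1
            have h8 : g'.time = 0 := h6
            omega
          · have h7 : (g.src : ℕ) = g'.dst := h1.2.1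
            rw [← h7]
            exact h6
  · intro hopt
    obtain ⟨h1, ⟨f, hf, hfz⟩, h3, h4⟩ := hopt
    refine ⟨h.trail_sortedEdges_of_bounded hS hc h1
      (fun hp g hg => h4 hp g (List.mem_of_mem_tail hg)) (hb W ⟨h1, ⟨f, hf, hfz⟩, h3, h4⟩),
      f, hf, ?_, hfz⟩
    unfold IsFinal
    rw [hfz, h3]
    cases W with
    | nil => simp at hf
    | cons g W =>
      obtain rfl : g = f := by simpa using hf
      simp [walkCost, key, hc]

end

end TemporalBetweenness

namespace TemporalBetweenness

/-! ### Shortening and prolonging sequences -/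

section

variable {α β : Type*} {R : α → α → Prop} {κ : α → β}

theorem exists_split_of_not_nodup {W : List α} (h : ¬ (W.map κ).Nodup) :
    ∃ A x B y D, W = A ++ x :: (B ++ y :: D) ∧ κ x = κ y := by
  induction W with
  | nil => simp at h
  | cons a W ih =>
    by_cases hW : (W.map κ).Nodup
    · have ha : κ a ∈ W.map κ := by
        by_contra hcon
        exact h (List.nodup_cons.2 ⟨hcon, hW⟩)
      obtain ⟨y, hy, hya⟩ := List.mem_map.1 ha
      obtain ⟨B, D, rfl⟩ := List.append_of_mem hy
      exact ⟨[], a, B, y, D, rfl, hya.symm⟩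
    · obtain ⟨A, x, B, y, D, rfl, hxy⟩ := ih hW
      exact ⟨a :: A, x, B, y, D, rfl, hxy⟩

theorem isChain_cut {A B D : List α} {x y : α} (h : (A ++ x :: (B ++ y :: D)).IsChain R)
    (hxy : ∀ d ∈ D, R y d → R x d) : (A ++ x :: D).IsChain R := by
  rw [List.isChain_append] at h ⊢
  obtain ⟨h1, h2, h3⟩ := h
  refine ⟨h1, ?_, by simpa using h3⟩
  rw [← List.cons_append, List.isChain_append] at h2
  have h4 := List.isChain_cons.1 h2.2.1
  exact List.isChain_cons.2 ⟨fun d hd => hxy d (List.mem_of_mem_head? hd) (h4.1 d hd), h4.2⟩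

theorem isChain_pump {A B D : List α} {x y : α} (h : (A ++ x :: (B ++ y :: D)).IsChain R)
    (hxy : ∀ d, R x d → R y d) : (A ++ x :: (B ++ y :: (B ++ y :: D))).IsChain R := by
  rw [List.isChain_append] at h ⊢
  obtain ⟨h1, h2, h3⟩ := h
  refine ⟨h1, ?_, by simpa using h3⟩
  have h4 := List.isChain_cons.1 h2
  have h5 : (y :: (B ++ y :: D)).IsChain R :=
    List.isChain_cons.2 ⟨fun d hd => hxy d (h4.1 d hd), h4.2⟩
  rw [← List.cons_append, List.isChain_append] at h2 ⊢
  exact ⟨h2.1, h5, by simpa using h2.2.2⟩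

/-- If a chain contains two elements with the same label, then the part from the first to the second
can be cut out, until all labels are distinct. -/
theorem exists_cut (W : List α) (hW : W.IsChain R)
    (hκ : ∀ x y d, [x, y, d].Sublist W → κ x = κ y → R y d → R x d) :
    ∃ W' : List α, W'.Sublist W ∧ W'.IsChain R ∧ W'.head? = W.head? ∧
      W'.getLast?.map κ = W.getLast?.map κ ∧ (W'.map κ).Nodup := by
  induction h : W.length using Nat.strong_induction_on generalizing W with
  | _ l ih =>
    by_cases hn : (W.map κ).Nodup
    · exact ⟨W, List.Sublist.refl _, hW, rfl, rfl, hn⟩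
    obtain ⟨A, x, B, y, D, rfl, hxy⟩ := exists_split_of_not_nodup hn
    have hsub : (A ++ x :: D).Sublist (A ++ x :: (B ++ y :: D)) := by
      refine (List.Sublist.refl A).append (List.Sublist.cons_cons x ?_)
      exact (List.sublist_append_right (B ++ [y]) D).trans (by simp)
    obtain ⟨W', h1, h2, h3, h4, h5⟩ := ih (A ++ x :: D).length (by
      rw [← h]; simp) (A ++ x :: D) (isChain_cut hW fun d hd => hκ x y d (by
        refine List.Sublist.trans ?_ (List.sublist_append_right _ _)
        refine List.Sublist.cons_cons x (List.Sublist.trans ?_ (List.sublist_append_right _ _))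
        exact List.Sublist.cons_cons y (List.singleton_sublist.2 hd)) hxy)
      (fun x y d hs => hκ x y d (hs.trans hsub)) rfl
    refine ⟨W', h1.trans hsub, h2, h3.trans ?_, h4.trans ?_, h5⟩
    · cases A <;> rfl
    · rw [List.getLast?_append, List.getLast?_append, List.getLast?_cons, List.getLast?_cons,
        List.getLast?_append, List.getLast?_cons]
      cases hD : D.getLast? with
      | none => simp [hxy]
      | some d => simp

end

end TemporalBetweenness

namespace TemporalBetweenness

open TemporalGraph TransitionSeq

/-! ### Admissible temporal walks -/

/-- The transition `f` can follow the transition `e`. -/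
def Link {n : ℕ} (gap lim : ℕ) (e f : TimeArc n) : Prop :=
  e.dst = f.src ∧ e.time + gap ≤ f.time ∧ f.time ≤ e.time + lim

/-- The temporal walks from `s` to `z` that obey the time restrictions of the variant `c`. -/
structure IsAdmissible (G : TemporalGraph) (c : Variant) (Δ : ℕ) (s z : Fin G.n)
    (W : List (TimeArc G.n)) : Prop where
  mem : ∀ e ∈ W, e ∈ G.arcs
  chain : W.IsChain (Link c.gap (c.lim G.T Δ))
  head : W.head?.map TimeArc.src = some s
  last : W.getLast?.map TimeArc.dst = some z

/-- The cost of a walk; it encodes the lexicographic order on durations and lengths if both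
count. -/
def cost {n : ℕ} (c : Variant) (R : ℕ) (W : List (TimeArc n)) : ℕ :=
  if c.foremost then arrival W
  else if c.multi then duration W * (R + 1) + (W.length + 1)
  else W.length + 1

variable {G : TemporalGraph} {c : Variant} {Δ : ℕ} {s z : Fin G.n} {L : List (TimeArc G.n)}
  {W : List (TimeArc G.n)} {t₀ R : ℕ}

theorem departure_mem {e : TimeArc G.n} (he : e ∈ W.head?) : departure W = e.time := by
  unfold departure; rw [Option.mem_def.1 he]; rfl

theorem arrival_mem {e : TimeArc G.n} (he : e ∈ W.getLast?) : arrival W = e.time := by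
  unfold arrival; rw [Option.mem_def.1 he]; rfl

theorem exists_of_map {α β : Type*} {o : Option α} {f : α → β} {b : β} (h : o.map f = some b) :
    ∃ a ∈ o, f a = b := by
  simpa using h

namespace IsAdmissible

theorem ne_nil (h : IsAdmissible G c Δ s z W) : W ≠ [] := by
  rintro rfl
  simpa using h.head

theorem exists_head (h : IsAdmissible G c Δ s z W) :
    ∃ e ∈ W.head?, e.src = s ∧ departure W = e.time := by
  obtain ⟨e, he, hs⟩ := exists_of_map h.head
  exact ⟨e, he, hs, departure_mem he⟩

theorem exists_last (h : IsAdmissible G c Δ s z W) :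
    ∃ e ∈ W.getLast?, e.dst = z ∧ arrival W = e.time := by
  obtain ⟨e, he, hs⟩ := exists_of_map h.last
  exact ⟨e, he, hs, arrival_mem he⟩

theorem pairwise (h : IsAdmissible G c Δ s z W) :
    W.Pairwise fun e f => e.time + c.gap ≤ f.time := by
  have h1 : W.IsChain fun e f => e.time + c.gap ≤ f.time := h.chain.imp fun _ _ h => h.2.1
  have : IsTrans (TimeArc G.n) fun e f => e.time + c.gap ≤ f.time :=
    ⟨fun a b d h1 h2 => by omega⟩
  exact h1.pairwise

theorem departure_le (h : IsAdmissible G c Δ s z W) {e : TimeArc G.n} (he : e ∈ W) :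
    departure W ≤ e.time := by
  obtain ⟨f, hf, -, hd⟩ := h.exists_head
  rw [hd]
  cases W with
  | nil => simp at he
  | cons g W =>
    obtain rfl : g = f := by simpa using hf
    rcases List.mem_cons.1 he with rfl | he
    · exact le_rfl
    · have := (List.pairwise_cons.1 h.pairwise).1 e he
      omega

theorem le_arrival (h : IsAdmissible G c Δ s z W) {e : TimeArc G.n} (he : e ∈ W) :
    e.time ≤ arrival W := by
  obtain ⟨f, hf, -, hd⟩ := h.exists_last
  rw [hd]
  obtain ⟨V, rfl⟩ := List.getLast?_eq_some_iff.1 hf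
  rcases List.mem_append.1 he with he | he
  · have := (List.pairwise_append.1 h.pairwise).2.2 e he f (by simp)
    omega
  · rw [List.mem_singleton.1 he]

theorem arrival_pos (h : IsAdmissible G c Δ s z W) : 1 ≤ arrival W := by
  obtain ⟨f, hf, -, hd⟩ := h.exists_last
  rw [hd]
  exact G.time_pos f (h.mem f (List.mem_of_mem_getLast? hf))

end IsAdmissible

theorem cost_pos (h : IsAdmissible G c Δ s z W) : cost c R W ≠ 0 := by
  have := h.arrival_pos
  unfold cost
  split_ifs <;> omega

/-- The walks in the state graph are the admissible walks. -/
theorem trail_iff_isAdmissible (hL : ∀ e, e ∈ L ↔ e ∈ G.arcs) (hW : W ≠ []) :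
    Trail (edges c G.T (c.lim G.T Δ) L s t₀) s W.reverse ∧ (∃ f ∈ W.reverse.head?, f.dst = z) ↔
      IsAdmissible G c Δ s z W ∧ (c.multi = true → departure W = t₀ + 1) := by
  obtain ⟨V, rfl⟩ : ∃ V, W = V.reverse := ⟨W.reverse, by simp⟩
  rw [List.reverse_reverse]
  induction V generalizing z with
  | nil => simp at hW
  | cons f V ih =>
    cases V with
    | nil =>
      simp only [Trail, endState, mem_edges, hL, EdgeOK, List.head?_cons, Option.mem_def]
      constructor
      · rintro ⟨⟨⟨h1, -, h2⟩, h3, -⟩, h4⟩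
        obtain ⟨h5, h6, h7⟩ := h2.resolve_right (by simp)
        refine ⟨⟨by simpa using h1, by simp, ?_, ?_⟩, ?_⟩
        · simpa using Fin.ext h6
        · simpa using h4
        · simpa [departure] using h7
      · rintro ⟨⟨h1, -, h2, h3⟩, h4⟩
        have h5 : f.src = s := by simpa using h2
        refine ⟨⟨⟨by simpa using h1, by simp, .inl ⟨trivial, by rw [h5], ?_⟩⟩, by rw [h5],
          trivial⟩, ?_⟩
        · simpa [departure] using h4
        · simpa using h3
    | cons g V =>
      have ih := ih (z := g.dst) (by simp)
      simp only [List.head?_cons, Option.mem_def, Option.some.injEq, exists_eq_left', and_true]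
        at ih
      have hne : (g :: V).reverse ≠ [] := by simp
      have hdep : departure (f :: g :: V).reverse = departure (g :: V).reverse := by
        unfold departure
        rw [List.reverse_cons, List.head?_append_of_ne_nil _ hne]
      have hlast : (f :: g :: V).reverse.getLast? = some f := by simp
      have hlast' : (g :: V).reverse.getLast? = some g := by simp
      have hhead : (f :: g :: V).reverse.head? = (g :: V).reverse.head? := by
        rw [List.reverse_cons, List.head?_append_of_ne_nil _ hne]
      rw [hdep]
      have key : IsAdmissible G c Δ s z (f :: g :: V).reverse ↔
          (f ∈ G.arcs ∧ Link c.gap (c.lim G.T Δ) g f) ∧ f.dst = z ∧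
            IsAdmissible G c Δ s g.dst (g :: V).reverse := by
        constructor
        · rintro ⟨h1, h2, h3, h4⟩
          rw [List.reverse_cons, List.isChain_append] at h2
          refine ⟨⟨h1 f (by simp), h2.2.2 g hlast' f rfl⟩, by simpa [hlast] using h4,
            fun e he => h1 e ?_, h2.1, hhead ▸ h3, by rw [hlast']; rfl⟩
          rw [List.reverse_cons]
          exact List.mem_append_left _ he
        · rintro ⟨⟨h1, h2⟩, h3, h4⟩
          refine ⟨?_, ?_, hhead ▸ h4.head, by rw [hlast, Option.map_some, h3]⟩
          · intro e he
            rw [List.reverse_cons] at he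
            rcases List.mem_append.1 he with he | he
            · exact h4.mem e he
            · rwa [List.mem_singleton.1 he]
          · rw [List.reverse_cons, List.isChain_append]
            refine ⟨h4.chain, by simp, ?_⟩
            intro x hx y hy
            rw [hlast'] at hx
            simp only [Option.mem_def, Option.some.injEq, List.head?_cons] at hx hy
            subst hx hy
            exact h2
      simp only [key, and_assoc]
      rw [← ih, Trail]
      simp only [endState, mem_edges, hL, List.head?_cons, Option.mem_def, Option.some.injEq,
        exists_eq_left']
      constructor
      · rintro ⟨⟨⟨h1, h2, h3⟩, h4, h5⟩, h6⟩
        have hg : 1 ≤ g.time := G.time_pos g ((hL g).1 (mem_edges.1 h5.1).1)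
        rcases h3 with h3 | h3
        · have : g.time = 0 := h3.1
          omega
        · exact ⟨h1, ⟨Fin.ext h4.symm, h3.2.1, h3.2.2⟩, h6, h5⟩
      · rintro ⟨h1, h2, h3, h4⟩
        have hg := (hL g).1 (mem_edges.1 h4.1).1
        exact ⟨⟨⟨h1, G.time_le g hg, .inr ⟨G.time_pos g hg, h2.2⟩⟩, by rw [h2.1], h4⟩, h3⟩

theorem walkCost_reverse
    (hd : c.multi = true → departure W = t₀ + 1) : walkCost c R t₀ W.reverse = cost c R W := by
  unfold walkCost cost duration
  rw [List.head?_reverse, List.length_reverse]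
  split_ifs with h1 h2
  · rfl
  · rw [hd h2]; rfl
  · rfl

theorem departure_bounds (h : IsAdmissible G c Δ s z W) :
    1 ≤ departure W ∧ departure W ≤ G.T := by
  obtain ⟨e, he, -, hd⟩ := h.exists_head
  have := h.mem e (List.mem_of_mem_head? he)
  rw [hd]
  exact ⟨G.time_pos e this, G.time_le e this⟩

/-- Every admissible walk has a departure class. -/
theorem exists_class (h : IsAdmissible G c Δ s z W) :
    ∃ t₀ < c.starts G.T, c.multi = true → departure W = t₀ + 1 := by
  have := departure_bounds h
  unfold Variant.starts
  by_cases hm : c.multi = true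
  · rw [if_pos hm]
    exact ⟨departure W - 1, by omega, fun _ => by omega⟩
  · exact ⟨0, by rw [if_neg hm]; omega, fun h => absurd h hm⟩

theorem posTime_edges (hL : ∀ e, e ∈ L ↔ e ∈ G.arcs) :
    PosTime (edges c G.T (c.lim G.T Δ) L s t₀) :=
  fun _ he => G.time_pos _ ((hL _).1 (mem_edges.1 he).1)

/-- The admissible walks of least cost. -/
def IsLeast (G : TemporalGraph) (c : Variant) (Δ R : ℕ) (s z : Fin G.n)
    (W : List (TimeArc G.n)) : Prop :=
  (c.closed = false → z ≠ s) ∧ IsAdmissible G c Δ s z W ∧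
    ∀ V, IsAdmissible G c Δ s z V → cost c R W ≤ cost c R V

/-- The least costs belong to the walks of least cost. -/
theorem BestFor.eq_cost (hL : ∀ e, e ∈ L ↔ e ∈ G.arcs) {best : ℕ → ℕ}
    (hb : BestFor c R (c.starts G.T) (fun t₀ => edges c G.T (c.lim G.T Δ) L s t₀) s best)
    (h : IsLeast G c Δ R s z W) : best z = cost c R W := by
  obtain ⟨h1, h2, h3⟩ := h
  obtain ⟨t₀, ht₀, hd⟩ := exists_class h2
  have h5 := (trail_iff_isAdmissible (t₀ := t₀) hL h2.ne_nil).2 ⟨h2, hd⟩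
  have h6 := hb.complete z h1 t₀ ht₀ _ h5.1 h5.2
  rw [walkCost_reverse hd] at h6
  refine le_antisymm h6.2 ?_
  obtain ⟨-, t₁, ht₁, V, hV, hf, hcost⟩ := hb.sound z h6.1
  rw [← List.reverse_reverse V] at hV hf hcost
  have hne : V.reverse ≠ [] := by
    intro h
    rw [h] at hf
    simp at hf
  have h7 := (trail_iff_isAdmissible hL hne).1 ⟨hV, hf⟩
  rw [walkCost_reverse h7.2] at hcost
  rw [← hcost]
  exact h3 _ h7.1

/-- The walks that are optimal in the state graph are the admissible walks of least cost. -/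
theorem BestFor.isOptimal_iff (hL : ∀ e, e ∈ L ↔ e ∈ G.arcs) {best : ℕ → ℕ}
    (hb : BestFor c R (c.starts G.T) (fun t₀ => edges c G.T (c.lim G.T Δ) L s t₀) s best) :
    (∃ t₀ < c.starts G.T, IsOptimal c R t₀ (edges c G.T (c.lim G.T Δ) L s t₀) s best z W.reverse) ↔
      IsLeast G c Δ R s z W ∧ (c.prefixOpt = true → ∀ f ∈ W, best f.dst = f.time) := by
  have hne : ∀ {E V}, Trail E s V.reverse ∧ (∃ f ∈ V.reverse.head?, f.dst = z) → V ≠ [] := by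
    rintro E V ⟨-, f, hf, -⟩ rfl
    simp at hf
  constructor
  · rintro ⟨t₀, ht₀, h1, h2, h3, h4⟩
    have h5 := (trail_iff_isAdmissible hL (hne ⟨h1, h2⟩)).1 ⟨h1, h2⟩
    rw [walkCost_reverse h5.2] at h3
    have h6 : best z ≠ 0 := by rw [h3]; exact cost_pos h5.1
    refine ⟨⟨(hb.sound z h6).1, h5.1, fun V hV => ?_⟩, fun hp f hf => h4 hp f (by simpa using hf)⟩
    obtain ⟨t₁, ht₁, hd⟩ := exists_class hV
    have h7 := (trail_iff_isAdmissible (t₀ := t₁) hL hV.ne_nil).2 ⟨hV, hd⟩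
    have h8 := (hb.complete z (hb.sound z h6).1 t₁ ht₁ _ h7.1 h7.2).2
    rwa [walkCost_reverse hd, h3] at h8
  · rintro ⟨h3, h4⟩
    have h2 := h3.2.1
    obtain ⟨t₀, ht₀, hd⟩ := exists_class h2
    have h5 := (trail_iff_isAdmissible (t₀ := t₀) hL h2.ne_nil).2 ⟨h2, hd⟩
    refine ⟨t₀, ht₀, h5.1, h5.2, ?_, fun hp f hf => h4 hp f (by simpa using hf)⟩
    rw [walkCost_reverse hd, hb.eq_cost hL h3]

end TemporalBetweenness

namespace TemporalBetweenness

open TemporalGraph TransitionSeq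

variable {G : TemporalGraph} {c : Variant} {Δ : ℕ} {s z : Fin G.n} {L : List (TimeArc G.n)}
  {W : List (TimeArc G.n)} {t₀ R : ℕ}

/-! ### Short walks and paths -/

/-- The state that the transition leads to. -/
def target {n : ℕ} (e : TimeArc n) : Fin n × ℕ := (e.dst, e.time)

namespace IsAdmissible

theorem time_le_of_sublist (h : IsAdmissible G c Δ s z W) {x y d : TimeArc G.n}
    (hs : [x, y, d].Sublist W) : x.time ≤ y.time := by
  have := h.pairwise.sublist hs
  simp only [List.pairwise_cons, List.mem_cons] at this
  have := this.1 y (by simp)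
  omega

/-- If waiting times are not bounded, then a walk may skip everything between two visits of a
vertex. -/
theorem link_of_dst_eq (h : IsAdmissible G c Δ s z W) (hr : c.restless = false)
    {x y d : TimeArc G.n} (hs : [x, y, d].Sublist W) (hxy : x.dst = y.dst)
    (hl : Link c.gap (c.lim G.T Δ) y d) :
    Link c.gap (c.lim G.T Δ) x d := by
  have h1 := h.time_le_of_sublist hs
  have h2 := G.time_le d (h.mem d (hs.subset (by simp)))
  refine ⟨hxy.trans hl.1, by have := hl.2.1; omega, ?_⟩
  simp only [Variant.lim, hr, Bool.false_eq_true, if_false]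
  omega

theorem length_le_of_nodup_target (h : IsAdmissible G c Δ s z W) (hn : (W.map target).Nodup) :
    W.length ≤ G.n * (G.T + 1) := by
  have h1 : (W.map target).toFinset ⊆ Finset.univ ×ˢ Finset.range (G.T + 1) := by
    intro q hq
    obtain ⟨e, he, rfl⟩ := List.mem_map.1 (List.mem_toFinset.1 hq)
    have := G.time_le e (h.mem e he)
    simp only [Finset.mem_product, Finset.mem_univ, Finset.mem_range, true_and, target]
    omega
  have h2 := Finset.card_le_card h1
  rwa [List.toFinset_card_of_nodup hn, List.length_map, Finset.card_product, Finset.card_univ,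
    Fintype.card_fin, Finset.card_range] at h2

theorem of_sublist (h : IsAdmissible G c Δ s z W) {V : List (TimeArc G.n)} (hs : V.Sublist W)
    {z' : Fin G.n} (hc : V.IsChain (Link c.gap (c.lim G.T Δ)))
    (hh : V.head?.map TimeArc.src = some s) (hl : V.getLast?.map TimeArc.dst = some z') :
    IsAdmissible G c Δ s z' V :=
  ⟨fun e he => h.mem e (hs.subset he), hc, hh, hl⟩

/-- A short admissible walk that arrives at the same state. In general, repetitions of states are
avoided.  If the waiting times are not bounded, then it is enough to avoid repetitions of vertices,
except for the last transition. -/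
theorem exists_short (h : IsAdmissible G c Δ s z W) : ∃ V, V.Sublist W ∧ IsAdmissible G c Δ s z V ∧
    V.head? = W.head? ∧ V.getLast?.map target = W.getLast?.map target ∧
    V.length + 1 ≤ c.rounds G.n G.T := by
  by_cases hc : (c.restless || c.foremost) = true
  · obtain ⟨V, h1, h2, h3, h4, h5⟩ := exists_cut (κ := target) W h.chain (by
      rintro x y d - hxy hl
      simp only [target, Prod.mk.injEq] at hxy
      unfold Link at *
      rwa [hxy.1, hxy.2])
    have h6 : IsAdmissible G c Δ s z V := by
      refine h.of_sublist h1 h2 (by rw [h3, h.head]) ?_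
      have := congrArg (Option.map Prod.fst) h4
      rw [Option.map_map, Option.map_map] at this
      exact this.trans h.last
    refine ⟨V, h1, h6, h3, h4, ?_⟩
    have := h6.length_le_of_nodup_target h5
    unfold Variant.rounds
    rw [if_pos hc]
    omega
  · have hr : c.restless = false := by cases h : c.restless <;> simp_all
    obtain ⟨l, hl, hlz, -⟩ := h.exists_last
    classical
    set κ : TimeArc G.n → Option (Fin G.n) := fun f => if f = l then none else some f.dst with hκ
    have hκl : ∀ f, κ f = none → f = l := fun f hf => by
      by_contra hne
      simp [hκ, hne] at hf
    obtain ⟨V, h1, h2, h3, h4, h5⟩ := exists_cut (κ := κ) W h.chain (by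
      intro x y d hs hxy hlink
      by_cases hx : x = l
      · have : y = l := hκl y (by rw [← hxy]; simp [hκ, hx])
        rwa [hx, ← this]
      · have hy : y ≠ l := fun hy => hx (hκl x (by rw [hxy]; simp [hκ, hy]))
        exact h.link_of_dst_eq hr hs (by simpa [hκ, hx, hy] using hxy) hlink)
    have h6 : V.getLast? = some l := by
      rw [Option.mem_def.1 hl, Option.map_some] at h4
      obtain ⟨f, hf, hfl⟩ := exists_of_map h4
      rw [← hκl f (by rw [hfl]; simp [hκ])]
      exact hf
    refine ⟨V, h1, h.of_sublist h1 h2 (by rw [h3, h.head]) (by rw [h6, Option.map_some, hlz]), h3,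
      by rw [h6, Option.mem_def.1 hl], ?_⟩
    have h7 := List.Nodup.length_le_card h5
    rw [List.length_map, Fintype.card_option, Fintype.card_fin] at h7
    unfold Variant.rounds
    rw [if_neg hc]
    omega

/-- A walk that does not return to its starting point at the end contains a path. -/
theorem exists_path (h : IsAdmissible G c Δ s z W) (hr : c.restless = false) (hz : z ≠ s) :
    ∃ P, P.Sublist W ∧ IsAdmissible G c Δ s z P ∧ IsPath P := by
  obtain ⟨V, h1, h2, h3, h4, h5⟩ := exists_cut (κ := TimeArc.dst) W h.chain
    fun x y d hs hxy hl => h.link_of_dst_eq hr hs hxy hl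
  have hV := h.of_sublist h1 h2 (by rw [h3, h.head]) (h4.trans h.last)
  have key : ∀ P, IsAdmissible G c Δ s z P → (P.map TimeArc.dst).Nodup → s ∉ P.map TimeArc.dst →
      IsPath P := by
    intro P hP hn hs
    cases P with
    | nil => exact absurd rfl hP.ne_nil
    | cons e P =>
      have : e.src = s := by simpa using hP.head
      exact List.nodup_cons.2 ⟨by rwa [this], hn⟩
  by_cases hs : s ∈ V.map TimeArc.dst
  · -- start the walk when it leaves its starting point for the last time
    obtain ⟨g, hg, hgs⟩ := List.mem_map.1 hs
    obtain ⟨A, D, rfl⟩ := List.append_of_mem hg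
    have hD : D ≠ [] := by
      rintro rfl
      have := hV.last
      simp only [List.getLast?_append, List.getLast?_singleton, Option.map_some,
        Option.some.injEq, Option.some_or] at this
      exact hz (this.symm.trans hgs)
    obtain ⟨d, D, rfl⟩ := List.exists_cons_of_ne_nil hD
    have hsub : (d :: D).Sublist (A ++ g :: d :: D) :=
      (List.sublist_cons_self g _).trans (List.sublist_append_right _ _)
    have h6 := (List.isChain_append.1 h2).2.1
    rw [List.isChain_cons_cons] at h6
    have h7 : IsAdmissible G c Δ s z (d :: D) := by
      refine hV.of_sublist hsub h6.2 (by rw [List.head?_cons, Option.map_some, ← h6.1.1, hgs]) ?_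
      rw [← hV.last, List.getLast?_append, List.getLast?_cons_cons, List.getLast?_cons]
      rfl
    rw [List.map_append, List.nodup_append, List.map_cons, List.nodup_cons] at h5
    exact ⟨d :: D, hsub.trans h1, h7, key _ h7 h5.2.1.2 (by rw [← hgs]; exact h5.2.1.1)⟩
  · exact ⟨V, h1, hV, key V hV h5 hs⟩

theorem arrival_le_of_sublist (h : IsAdmissible G c Δ s z W) {V : List (TimeArc G.n)}
    (hV : IsAdmissible G c Δ s z V) (hs : V.Sublist W) : arrival V ≤ arrival W := by
  obtain ⟨e, he, -, h1⟩ := hV.exists_last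
  rw [h1]
  exact h.le_arrival (hs.subset (List.mem_of_mem_getLast? he))

theorem duration_le_of_sublist (h : IsAdmissible G c Δ s z W) {V : List (TimeArc G.n)}
    (hV : IsAdmissible G c Δ s z V) (hs : V.Sublist W) : duration V ≤ duration W := by
  have h1 := h.arrival_le_of_sublist hV hs
  obtain ⟨e, he, -, h2⟩ := hV.exists_head
  have h3 := h.departure_le (hs.subset (List.mem_of_mem_head? he))
  unfold duration
  omega

theorem ne_of_isPath (h : IsAdmissible G c Δ s z W) (hp : IsPath W) : z ≠ s := by
  obtain ⟨l, hl, hlz, -⟩ := h.exists_last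
  cases W with
  | nil => simp at hl
  | cons e W =>
    have h1 : e.src = s := by simpa using h.head
    rintro rfl
    refine (List.nodup_cons.1 hp).1 ?_
    rw [h1, ← hlz]
    exact List.mem_map_of_mem (List.mem_of_mem_getLast? hl)

theorem isWalkFromTo (h : IsAdmissible G c Δ s z W) : G.IsWalkFromTo s z W :=
  ⟨⟨h.mem, h.chain.imp fun _ _ h => ⟨h.1, by have := h.2.1; omega⟩⟩, h.head, h.last⟩

end IsAdmissible

theorem length_le_of_isPath {n : ℕ} {W : List (TimeArc n)} (h : IsPath W) : W.length ≤ n := by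
  cases W with
  | nil => simp
  | cons e W =>
    have := (List.nodup_cons.1 h).2.length_le_card
    rwa [List.length_map, Fintype.card_fin] at this

theorem isChain_and {α : Type*} {P Q : α → α → Prop} {W : List α} :
    W.IsChain (fun a b => P a b ∧ Q a b) ↔ W.IsChain P ∧ W.IsChain Q := by
  refine ⟨fun h => ⟨h.imp fun _ _ h => h.1, h.imp fun _ _ h => h.2⟩, ?_⟩
  rintro ⟨h1, h2⟩
  induction W with
  | nil => simp
  | cons a W ih =>
    rw [List.isChain_cons] at h1 h2 ⊢
    exact ⟨fun b hb => ⟨h1.1 b hb, h2.1 b hb⟩, ih h1.2 h2.2⟩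

theorem isAdmissible_iff : IsAdmissible G c Δ s z W ↔ G.IsWalkFromTo s z W ∧
    W.IsChain (fun e f => e.time + c.gap ≤ f.time) ∧
    (c.restless = true → IsRestless Δ W) := by
  constructor
  · intro h
    refine ⟨h.isWalkFromTo, h.chain.imp fun _ _ h => h.2.1, fun hr => h.chain.imp fun _ _ h => ?_⟩
    simpa [Variant.lim, hr] using h.2.2
  · rintro ⟨⟨⟨h1, h2⟩, h3, h4⟩, h5, h6⟩
    refine ⟨h1, ?_, h3, h4⟩
    have h7 : W.IsChain fun e f => f.time ≤ e.time + c.lim G.T Δ := by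
      by_cases hr : c.restless = true
      · rw [show c.lim G.T Δ = Δ from if_pos hr]
        exact h6 hr
      · refine List.Pairwise.isChain (List.pairwise_of_forall_mem_list fun e _ f hf => ?_)
        have := G.time_le f (h1 f hf)
        simp only [Variant.lim, hr, Bool.false_eq_true, if_false]
        omega
    exact isChain_and.2 ⟨h2.imp fun _ _ h => h.1, isChain_and.2 ⟨h5, h7⟩⟩

/-- The number of rounds suffices to reach all states. -/
theorem hasShort_edges (hL : ∀ e, e ∈ L ↔ e ∈ G.arcs) :
    HasShort (c.rounds G.n G.T) (edges c G.T (c.lim G.T Δ) L s t₀) s := by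
  intro W hW
  cases hW' : W with
  | nil =>
    subst hW'
    refine ⟨[], trivial, rfl, le_rfl, ?_⟩
    unfold Variant.rounds
    split_ifs <;> simp
  | cons f W' =>
    have hne : W ≠ [] := by simp [hW']
    rw [← hW']
    obtain ⟨U, rfl⟩ : ∃ U, W = U.reverse := ⟨W.reverse, by simp⟩
    have hU : U ≠ [] := by simpa using hne
    obtain ⟨h1, h2⟩ := (trail_iff_isAdmissible (z := f.dst) hL hU).1 ⟨hW, by rw [hW']; exact
      ⟨f, rfl, rfl⟩⟩
    obtain ⟨V, h3, h4, h5, h6, h7⟩ := h1.exists_short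
    have h8 := (trail_iff_isAdmissible (t₀ := t₀) hL h4.ne_nil).2 ⟨h4, fun hm => by
      rw [← h2 hm]; unfold departure; rw [h5]⟩
    refine ⟨V.reverse, h8.1, ?_, by simpa using h3.length_le, by simpa using h7⟩
    rw [← List.head?_reverse, ← List.head?_reverse] at h6
    have key : ∀ A B : List (TimeArc G.n), A ≠ [] → B ≠ [] →
        A.head?.map target = B.head?.map target → endState s A = endState s B := by
      rintro (_ | ⟨a, A⟩) (_ | ⟨b, B⟩) hA hB hAB
      · exact absurd rfl hA
      · exact absurd rfl hA
      · exact absurd rfl hB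
      · simp only [List.head?_cons, Option.map_some, target, Option.some.injEq, Prod.mk.injEq]
          at hAB
        simp [endState, hAB.1, hAB.2]
    exact key _ _ (by simpa using h4.ne_nil) (by simpa using hU) h6

end TemporalBetweenness

namespace TemporalBetweenness

open TemporalGraph TransitionSeq

variable {G : TemporalGraph} {c : Variant} {Δ : ℕ} {s z : Fin G.n} {W : List (TimeArc G.n)} {R : ℕ}

/-! ### Classes of walks that the algorithm handles -/

/-- The variant `c` of the algorithm computes the walks in `𝒲`. -/
structure Realizes (G : TemporalGraph) (c : Variant) (Δ : ℕ) (𝒲 : Set (List (TimeArc G.n))) :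
    Prop where
  iff : ∀ (s z : Fin G.n) (best : ℕ → ℕ),
    (∀ z W, IsLeast G c Δ (c.rounds G.n G.T) s z W → best z = cost c (c.rounds G.n G.T) W) →
    (c.closed = false → best s = 0) → ∀ W,
    (IsLeast G c Δ (c.rounds G.n G.T) s z W ∧ (c.prefixOpt = true → ∀ f ∈ W, best f.dst = f.time) ↔
      W ∈ 𝒲 ∧ G.IsWalkFromTo s z W)
  bounded : c.foremost = true → ∀ (s z : Fin G.n) (W V : List (TimeArc G.n)),
    IsLeast G c Δ (c.rounds G.n G.T) s z W → IsAdmissible G c Δ s z V → arrival V = arrival W →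
    V.length + 1 ≤ c.rounds G.n G.T

theorem isWalkFromTo_unique {s' z' : Fin G.n} (h : G.IsWalkFromTo s z W)
    (h' : G.IsWalkFromTo s' z' W) : s' = s ∧ z' = z := by
  have h1 := h.2.1.symm.trans h'.2.1
  have h2 := h.2.2.symm.trans h'.2.2
  simp only [Option.some.injEq] at h1 h2
  exact ⟨h1.symm, h2.symm⟩

theorem mem_minimizers_iff {P : List (TimeArc G.n) → Prop} {d : List (TimeArc G.n) → ℕ} :
    W ∈ G.minimizers P d ∧ G.IsWalkFromTo s z W ↔ G.IsWalkFromTo s z W ∧ P W ∧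
      ∀ V, G.IsWalkFromTo s z V → P V → d W ≤ d V := by
  constructor
  · rintro ⟨⟨s', z', h1, h2, h3⟩, h4⟩
    obtain ⟨rfl, rfl⟩ := isWalkFromTo_unique h1 h4
    exact ⟨h4, h2, h3⟩
  · rintro ⟨h1, h2, h3⟩
    exact ⟨⟨s, z, h1, h2, h3⟩, h1⟩

theorem isAdmissible_iff_isWalkFromTo (hr : c.restless = false) (hg : c.gap = 0) :
    IsAdmissible G c Δ s z W ↔ G.IsWalkFromTo s z W := by
  rw [isAdmissible_iff]
  refine ⟨fun h => h.1, fun h => ⟨h, ?_, by simp [hr]⟩⟩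
  rw [hg]
  exact h.1.2.imp fun _ _ h => h.2

/-! ### Foremost walks -/

/-- The parameters for foremost walks. -/
def foremostVariant : Variant := { foremost := true, closed := true }

/-- If a foremost walk visits a state twice, then repeating the part in between yields a longer
foremost walk. -/
theorem exists_longer (h : IsAdmissible G c Δ s z W) (hn : ¬ (W.map target).Nodup) :
    ∃ V, IsAdmissible G c Δ s z V ∧ arrival V = arrival W ∧ W.length < V.length := by
  obtain ⟨A, x, B, y, D, rfl, hxy⟩ := exists_split_of_not_nodup hn
  simp only [target, Prod.mk.injEq] at hxy
  have hlast : (A ++ x :: (B ++ y :: (B ++ y :: D))).getLast? =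
      (A ++ x :: (B ++ y :: D)).getLast? := by
    simp [List.getLast?_append, List.getLast?_cons]
  refine ⟨_, ⟨fun e he => h.mem e ?_, isChain_pump h.chain fun d hd => ?_, ?_, ?_⟩, ?_, ?_⟩
  · simp only [List.mem_append, List.mem_cons] at he ⊢
    tauto
  · unfold Link at *
    rwa [← hxy.1, ← hxy.2]
  · rw [← h.head]
    cases A <;> rfl
  · rw [hlast, h.last]
  · unfold arrival
    rw [hlast]
  · simp

/-- If there are finitely many foremost walks, then the longest ones visit no state twice, so that
the number of rounds suffices for all of them. -/
theorem realizes_foremostWalks (hfin : G.foremostWalks.Finite) :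
    Realizes G foremostVariant Δ G.foremostWalks := by
  have hadm : ∀ {s z W}, IsAdmissible G foremostVariant Δ s z W ↔ G.IsWalkFromTo s z W :=
    isAdmissible_iff_isWalkFromTo rfl rfl
  have hleast : ∀ {R s z W}, IsLeast G foremostVariant Δ R s z W ↔
      W ∈ G.foremostWalks ∧ G.IsWalkFromTo s z W := by
    intro R s z W
    unfold foremostWalks IsLeast
    simp only [mem_minimizers_iff, hadm]
    simp [foremostVariant, cost]
  constructor
  · intro s z best _ _ W
    rw [hleast]
    simp [foremostVariant]
  · intro _ s z W V hW hV harr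
    -- a longest foremost walk from `s` to `z` does not visit a state twice
    have hmem : ∀ U, IsAdmissible G foremostVariant Δ s z U → arrival U = arrival W →
        U ∈ {U | U ∈ G.foremostWalks ∧ G.IsWalkFromTo s z U} := by
      intro U hU hUarr
      refine (hleast (R := 0)).1 ⟨by simp [foremostVariant], hU, fun X hX => ?_⟩
      have := hW.2.2 X hX
      simp only [cost, foremostVariant, if_true] at this ⊢
      rwa [hUarr]
    have hfin' : {U | U ∈ G.foremostWalks ∧ G.IsWalkFromTo s z U}.Finite :=
      hfin.subset fun U hU => hU.1
    obtain ⟨U, ⟨hU1, hU2⟩, hmax⟩ := hfin'.exists_maximalFor List.length _ ⟨V, hmem V hV harr⟩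
    have hUarr : arrival U = arrival W := by
      have h1 := (hleast (R := 0)).2 ⟨hU1, hU2⟩
      have h2 := h1.2.2 W hW.2.1
      have h3 := hW.2.2 U h1.2.1
      simp only [cost, foremostVariant, if_true] at h2 h3
      omega
    have hlen : ∀ X, IsAdmissible G foremostVariant Δ s z X → arrival X = arrival W →
        X.length ≤ U.length := fun X hX hXarr => by
      rcases le_total X.length U.length with h | h
      · exact h
      · exact hmax (hmem X hX hXarr) h
    have hnodup : (U.map target).Nodup := by
      by_contra hn
      obtain ⟨X, hX, hXarr, hXlen⟩ := exists_longer (hadm.2 hU2) hn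
      have := hlen X hX (hXarr.trans hUarr)
      omega
    have h1 := (hadm.2 hU2).length_le_of_nodup_target hnodup
    have h2 := hlen V hV harr
    simp only [Variant.rounds, foremostVariant, Bool.or_true, if_true]
    omega

/-! ### Shortest restless walks -/

/-- The parameters for shortest restless walks. -/
def restlessVariant : Variant := { restless := true, closed := true }

theorem realizes_shortestRestlessWalks :
    Realizes G restlessVariant Δ (G.shortestRestlessWalks Δ) := by
  have hadm : ∀ {s z W}, IsAdmissible G restlessVariant Δ s z W ↔
      G.IsWalkFromTo s z W ∧ IsRestless Δ W := by
    intro s z W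
    rw [isAdmissible_iff]
    simp only [restlessVariant, add_zero, forall_const]
    exact ⟨fun h => ⟨h.1, h.2.2⟩, fun h => ⟨h.1, h.1.1.2.imp fun _ _ h => h.2, h.2⟩⟩
  refine ⟨fun s z best _ _ W => ?_, fun h => absurd h (by simp [restlessVariant])⟩
  unfold shortestRestlessWalks IsLeast
  simp only [mem_minimizers_iff, hadm]
  simp [restlessVariant, cost, and_assoc]

/-! ### Shortest paths -/

/-- The parameters for shortest paths. Walks back to the starting point do not count, and all other
shortest walks are paths. -/
def shortestVariant : Variant := {}

/-- An admissible walk to another vertex is a path, or there is a shorter one that is a path and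
does not take more time. -/
theorem exists_isPath (hr : c.restless = false) (h : IsAdmissible G c Δ s z W) (hz : z ≠ s) :
    ∃ P, IsAdmissible G c Δ s z P ∧ IsPath P ∧ arrival P ≤ arrival W ∧ duration P ≤ duration W ∧
      P.length ≤ W.length ∧ (P.length = W.length → P = W) := by
  obtain ⟨P, h1, h2, h3⟩ := h.exists_path hr hz
  exact ⟨P, h2, h3, h.arrival_le_of_sublist h2 h1, h.duration_le_of_sublist h2 h1, h1.length_le,
    h1.eq_of_length⟩

theorem realizes_shortestPaths : Realizes G shortestVariant Δ G.shortestPaths := by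
  have hadm : ∀ {s z W}, IsAdmissible G shortestVariant Δ s z W ↔ G.IsWalkFromTo s z W :=
    isAdmissible_iff_isWalkFromTo rfl rfl
  have hcost : ∀ {R} {W : List (TimeArc G.n)}, cost shortestVariant R W = W.length + 1 :=
    fun {R W} => rfl
  refine ⟨fun s z best _ _ W => ?_, fun h => absurd h (by simp [shortestVariant])⟩
  unfold shortestPaths
  rw [mem_minimizers_iff]
  unfold IsLeast
  simp only [hcost, Nat.add_le_add_iff_right]
  constructor
  · rintro ⟨⟨h1, h2, h3⟩, -⟩
    obtain ⟨P, hP, hPp, -, -, hlen, heq⟩ := exists_isPath rfl h2 (h1 rfl)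
    obtain rfl := heq (le_antisymm hlen (h3 P hP))
    exact ⟨hadm.1 h2, hPp, fun V hV _ => h3 V (hadm.2 hV)⟩
  · rintro ⟨h1, h2, h3⟩
    have hz := (hadm.2 h1).ne_of_isPath h2
    refine ⟨⟨fun _ => hz, hadm.2 h1, fun V hV => ?_⟩, by simp [shortestVariant]⟩
    obtain ⟨P, hP, hPp, -, -, hlen, -⟩ := exists_isPath rfl hV hz
    exact (h3 P (hadm.1 hP) hPp).trans hlen

/-! ### Shortest fastest paths -/

/-- The parameters for shortest fastest paths. -/
def fastestVariant : Variant := { multi := true }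

/-- Durations come first and lengths second in the cost, as paths are shorter than the factor `R +
1`. -/
theorem realizes_shortestFastestPaths : Realizes G fastestVariant Δ G.shortestFastestPaths := by
  have hadm : ∀ {s z W}, IsAdmissible G fastestVariant Δ s z W ↔ G.IsWalkFromTo s z W :=
    isAdmissible_iff_isWalkFromTo rfl rfl
  refine ⟨fun s z best _ _ W => ?_, fun h => absurd h (by simp [fastestVariant])⟩
  have hR : fastestVariant.rounds G.n G.T = G.n + 3 := rfl
  generalize fastestVariant.rounds G.n G.T = R at hR
  have hcost : ∀ {W : List (TimeArc G.n)}, cost fastestVariant R W =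
      duration W * (R + 1) + (W.length + 1) := fun {W} => rfl
  -- the length of a path cannot make up for a longer duration
  have hlex : ∀ {P V : List (TimeArc G.n)}, P.length ≤ G.n → duration P < duration V →
      cost fastestVariant R P < cost fastestVariant R V := by
    intro P V h1 h2
    rw [hcost, hcost]
    have := Nat.mul_le_mul_right (R + 1) (Nat.succ_le_of_lt h2)
    rw [Nat.succ_mul] at this
    omega
  have hfast : ∀ {V}, V ∈ G.fastestPaths ∧ G.IsWalkFromTo s z V ↔ G.IsWalkFromTo s z V ∧ IsPath V ∧
      ∀ U, G.IsWalkFromTo s z U → IsPath U → duration V ≤ duration U := by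
    intro V
    unfold fastestPaths
    rw [mem_minimizers_iff]
  unfold shortestFastestPaths
  rw [mem_minimizers_iff]
  unfold IsLeast
  constructor
  · rintro ⟨⟨h1, h2, h3⟩, -⟩
    obtain ⟨P, hP, hPp, -, hdur, hlen, heq⟩ := exists_isPath rfl h2 (h1 rfl)
    have h4 := h3 P hP
    have h5 := Nat.mul_le_mul_right (R + 1) hdur
    rw [hcost, hcost] at h4
    obtain rfl := heq (by omega)
    have h6 : ∀ U, G.IsWalkFromTo s z U → IsPath U → duration P ≤ duration U := by
      intro U hU hUp
      by_contra hlt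
      have := hlex (length_le_of_isPath hUp) (not_le.1 hlt)
      have := h3 U (hadm.2 hU)
      omega
    refine ⟨hadm.1 h2, (hfast.2 ⟨hadm.1 h2, hPp, h6⟩).1, fun V hV hVf => ?_⟩
    have h7 := (hfast.1 ⟨hVf, hV⟩).2.2 P (hadm.1 h2) hPp
    have h8 := h3 V (hadm.2 hV)
    rw [hcost, hcost, le_antisymm (h6 V hV (hfast.1 ⟨hVf, hV⟩).2.1) h7] at h8
    omega
  · rintro ⟨h1, h2, h3⟩
    obtain ⟨-, hWp, hW⟩ := hfast.1 ⟨h2, h1⟩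
    have hz := (hadm.2 h1).ne_of_isPath hWp
    refine ⟨⟨fun _ => hz, hadm.2 h1, fun V hV => ?_⟩, by simp [fastestVariant]⟩
    obtain ⟨P, hP, hPp, -, hdur, hlen, -⟩ := exists_isPath rfl hV hz
    have h4 : cost fastestVariant R P ≤ cost fastestVariant R V := by
      have h5 := Nat.mul_le_mul_right (R + 1) hdur
      rw [hcost, hcost]
      omega
    refine le_trans ?_ h4
    rcases (hW P (hadm.1 hP) hPp).lt_or_eq with h5 | h5
    · exact (hlex (length_le_of_isPath hWp) h5).le
    · have h6 := h3 P (hadm.1 hP) (hfast.2 ⟨hadm.1 hP, hPp, fun U hU hUp => by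
        rw [← h5]; exact hW U hU hUp⟩).1
      rw [hcost, hcost, h5]
      omega

/-! ### Strict prefix-foremost paths -/

/-- The parameters for strict prefix-foremost paths. -/
def prefixVariant : Variant := { gap := 1, foremost := true, prefixOpt := true }

/-- If all vertices of a strict walk are reached at the earliest possible time, then no vertex is
repeated, so that the walk is a path. -/
theorem realizes_strictPrefixForemostPaths :
    Realizes G prefixVariant Δ G.strictPrefixForemostPaths := by
  have hadm : ∀ {s z W}, IsAdmissible G prefixVariant Δ s z W ↔
      G.IsWalkFromTo s z W ∧ IsStrict W := by
    intro s z W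
    rw [isAdmissible_iff]
    simp [prefixVariant, IsStrict]
  have hcost : ∀ {R} {W : List (TimeArc G.n)}, cost prefixVariant R W = arrival W :=
    fun {R W} => rfl
  have hforemost : ∀ {s z W}, W ∈ G.strictForemostPaths ∧ G.IsWalkFromTo s z W ↔
      IsAdmissible G prefixVariant Δ s z W ∧ IsPath W ∧
        ∀ V, IsAdmissible G prefixVariant Δ s z V → arrival W ≤ arrival V := by
    intro s z W
    unfold strictForemostPaths
    rw [mem_minimizers_iff]
    constructor
    · rintro ⟨h1, ⟨h2, h3⟩, h4⟩
      have h5 : IsAdmissible G prefixVariant Δ s z W := hadm.2 ⟨h1, h3⟩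
      refine ⟨h5, h2, fun V hV => ?_⟩
      obtain ⟨P, hP, hPp, harr, -⟩ := exists_isPath rfl hV (h5.ne_of_isPath h2)
      exact (h4 P (hadm.1 hP).1 ⟨hPp, (hadm.1 hP).2⟩).trans harr
    · rintro ⟨h1, h2, h3⟩
      exact ⟨(hadm.1 h1).1, ⟨h2, (hadm.1 h1).2⟩, fun V hV hVp => h3 V (hadm.2 ⟨hV, hVp.2⟩)⟩
  have hprefix : ∀ {s z : Fin G.n} {W Q : List (TimeArc G.n)},
      IsAdmissible G prefixVariant Δ s z W → Q ≠ [] → Q <+: W →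
      ∃ f ∈ W, f ∈ Q.getLast? ∧ IsAdmissible G prefixVariant Δ s f.dst Q := by
    intro s z W Q hW hQ hQW
    obtain ⟨f, hf⟩ := Option.ne_none_iff_exists'.1 (mt List.getLast?_eq_none_iff.1 hQ)
    refine ⟨f, hQW.subset (List.mem_of_mem_getLast? hf), hf, hW.of_sublist hQW.sublist
      (hW.chain.prefix hQW) ?_ (by rw [hf]; rfl)⟩
    rw [← hW.head]
    obtain ⟨D, rfl⟩ := hQW
    rw [List.head?_append_of_ne_nil _ hQ]
  constructor
  · intro s z best hbest hs W
    have hs := hs rfl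
    constructor
    · rintro ⟨⟨h1, h2, h3⟩, h4⟩
      have h4 := h4 rfl
      have hpath : IsPath W := by
        have hdst : (W.map TimeArc.dst).Nodup := by
          refine List.Nodup.of_map (f := fun v : Fin G.n => best v) ?_
          rw [List.map_map]
          have : W.map ((fun v : Fin G.n => best v) ∘ TimeArc.dst) = W.map TimeArc.time :=
            List.map_congr_left h4
          rw [this]
          refine List.pairwise_map.2 (h2.pairwise.imp fun h => ?_)
          simp only [prefixVariant] at h
          omega
        cases hW : W with
        | nil => exact absurd hW h2.ne_nil
        | cons e V =>
          have h5 : e.src = s := by simpa [hW] using h2.head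
          refine List.nodup_cons.2 ⟨?_, by rwa [hW] at hdst⟩
          rw [h5, ← hW]
          intro hmem
          obtain ⟨f, hf, hfs⟩ := List.mem_map.1 hmem
          have h6 := h4 f hf
          rw [hfs, hs] at h6
          have := G.time_pos f (h2.mem f hf)
          omega
      refine ⟨⟨(hforemost.2 ⟨h2, hpath, h3⟩).1, fun Q hQ hQW => ?_⟩, (hadm.1 h2).1⟩
      obtain ⟨f, hfW, hfQ, hQadm⟩ := hprefix h2 hQ hQW
      refine (hforemost.2 ⟨hQadm, ?_, fun V hV => ?_⟩).1
      · obtain ⟨D, rfl⟩ := hQW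
        cases Q with
        | nil => exact absurd rfl hQ
        | cons e Q =>
          refine hpath.sublist (List.Sublist.cons_cons _ ?_)
          exact (List.sublist_append_left _ _).map _
      · -- there is a walk of least cost, whose cost is `best`
        obtain ⟨U, hU, hUmin⟩ : ∃ U, IsAdmissible G prefixVariant Δ s f.dst U ∧
            ∀ X, IsAdmissible G prefixVariant Δ s f.dst X → arrival U ≤ arrival X := by
          classical
          have hex : ∃ a U, IsAdmissible G prefixVariant Δ s f.dst U ∧ arrival U = a :=
            ⟨_, Q, hQadm, rfl⟩
          obtain ⟨U, hU, hUa⟩ := Nat.find_spec hex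
          exact ⟨U, hU, fun X hX => hUa.trans_le (Nat.find_min' hex ⟨X, hX, rfl⟩)⟩
        have hfs : f.dst ≠ s := by
          intro hfs
          have h6 := h4 f hfW
          rw [hfs, hs] at h6
          have := G.time_pos f (h2.mem f hfW)
          omega
        have h7 := hbest f.dst U ⟨fun _ => hfs, hU, hUmin⟩
        rw [h4 f hfW, hcost] at h7
        rw [arrival_mem hfQ, h7]
        exact hUmin V hV
    · rintro ⟨⟨h1, h2⟩, h3⟩
      obtain ⟨h4, h5, h6⟩ := hforemost.1 ⟨h1, h3⟩
      refine ⟨⟨fun _ => h4.ne_of_isPath h5, h4, h6⟩, fun _ f hf => ?_⟩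
      obtain ⟨A, D, hAD⟩ := List.append_of_mem hf
      have hQW : A ++ [f] <+: W := ⟨D, by simp [hAD]⟩
      obtain ⟨f', -, hf', hQ⟩ := hprefix h4 (by simp) hQW
      obtain rfl : f = f' := by simpa using hf'
      obtain ⟨-, h7, h8⟩ := hforemost.1 ⟨h2 _ (by simp) hQW, (hadm.1 hQ).1⟩
      rw [hbest f.dst _ ⟨fun _ => hQ.ne_of_isPath h7, hQ, h8⟩, hcost, arrival_mem hf']
  · intro _ s z W V _ hV _
    have hnodup : (V.map target).Nodup := by
      refine List.pairwise_map.2 (hV.pairwise.imp fun h heq => ?_)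
      simp only [prefixVariant, target, Prod.mk.injEq] at h heq
      omega
    have := hV.length_le_of_nodup_target hnodup
    simp only [Variant.rounds, prefixVariant, Bool.or_true, if_true]
    omega

end TemporalBetweenness

namespace TemporalBetweenness

open TemporalGraph TransitionSeq RAM

/-! ### Optimal walks of all departure classes -/

section

variable {G : TemporalGraph} {c : Variant} {Δ : ℕ} {s z : Fin G.n} {L : List (TimeArc G.n)}
  {W : List (TimeArc G.n)} {t₀ : ℕ} {best : ℕ → ℕ} {𝒲 : Set (List (TimeArc G.n))}

/-- The edges of the state graph for walks from `s` with departure time in class `t₀`. -/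
abbrev edgesOf (G : TemporalGraph) (c : Variant) (Δ : ℕ) (L : List (TimeArc G.n)) (s : Fin G.n)
    (t₀ : ℕ) : List (Edge G.n) := edges c G.T (c.lim G.T Δ) L s t₀

/-- The optimal walks of the departure class `t₀`, listed in reverse order. -/
def Opt (G : TemporalGraph) (c : Variant) (Δ : ℕ) (L : List (TimeArc G.n)) (s : Fin G.n)
    (best : ℕ → ℕ) (z : Fin G.n) (t₀ : ℕ) (W : List (TimeArc G.n)) : Prop :=
  IsOptimal c (c.rounds G.n G.T) t₀ (edgesOf G c Δ L s t₀) s best z W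

/-- The hypotheses on the variant and on the list of arcs under which the counting passes are
correct. -/
structure Setup (G : TemporalGraph) (c : Variant) (Δ : ℕ) (𝒲 : Set (List (TimeArc G.n)))
    (L : List (TimeArc G.n)) : Prop where
  nodup : L.Nodup
  mem_iff : ∀ e, e ∈ L ↔ e ∈ G.arcs
  realizes : Realizes G c Δ 𝒲
  prefixOpt : c.foremost = false → c.prefixOpt = false

/-- The counted walks are the optimal ones, for all variants. -/
theorem Setup.optTrail_iff (h : Setup G c Δ 𝒲 L)
    (hb : BestFor c (c.rounds G.n G.T) (c.starts G.T) (edgesOf G c Δ L s) s best)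
    {φ : ℕ × ℕ → ℕ} (hφ : Ranked c (c.rounds G.n G.T) (edgesOf G c Δ L s t₀) s φ)
    (ht₀ : t₀ < c.starts G.T) :
    OptTrail (sortedEdges c (c.rounds G.n G.T) φ best (edgesOf G c Δ L s t₀)) s
      (IsFinal c (c.rounds G.n G.T) t₀ φ best) z W ↔ Opt G c Δ L s best z t₀ W := by
  have hS := hasShort_edges (c := c) (Δ := Δ) (s := s) (t₀ := t₀) h.mem_iff
  have hE := posTime_edges (c := c) (Δ := Δ) (s := s) (t₀ := t₀) h.mem_iff
  by_cases hc : c.foremost = true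
  · refine hφ.optTrail_iff_of_foremost hS hE hc fun V hV V' hV' hend => ?_
    have hVne : V ≠ [] := by
      rintro rfl
      obtain ⟨-, ⟨f, hf, -⟩, -⟩ := hV
      simp at hf
    have h1 := ((hb.isOptimal_iff h.mem_iff (W := V.reverse)).1
      ⟨t₀, ht₀, by rwa [List.reverse_reverse]⟩).1
    obtain ⟨f, V, rfl⟩ := List.exists_cons_of_ne_nil hVne
    have hf : 1 ≤ f.time := hE _ hV.1.1
    cases V' with
    | nil =>
      simp only [endState, Prod.mk.injEq] at hend
      omega
    | cons g V' =>
      simp only [endState, Prod.mk.injEq] at hend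
      have hz : f.dst = z := by simpa using hV.2.1
      have h2 := (trail_iff_isAdmissible (z := z) (W := (g :: V').reverse) h.mem_iff (by simp)).1
        ⟨by rwa [List.reverse_reverse], by
          rw [List.reverse_reverse]; exact ⟨g, rfl, (Fin.ext hend.1).trans hz⟩⟩
      have h3 := h.realizes.bounded hc s z _ (g :: V').reverse h1 h2.1 (by
        rw [arrival_mem (e := g) (by simp), arrival_mem (e := f) (by simp), hend.2])
      simpa using h3
  · have hc : c.foremost = false := by simpa using hc
    exact hφ.optTrail_iff_of_shortest hS hE hc (h.prefixOpt hc) hb ht₀ rfl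

theorem Setup.finite_opt (h : Setup G c Δ 𝒲 L)
    (hb : BestFor c (c.rounds G.n G.T) (c.starts G.T) (edgesOf G c Δ L s) s best)
    {φ : ℕ × ℕ → ℕ} (hφ : Ranked c (c.rounds G.n G.T) (edgesOf G c Δ L s t₀) s φ)
    (ht₀ : t₀ < c.starts G.T) : {W | Opt G c Δ L s best z t₀ W}.Finite := by
  refine (finite_optTrail (s := s) (nodup_sortedEdges (nodup_edges h.nodup s t₀))
    (sorted_sortedEdges c (c.rounds G.n G.T) φ best (edgesOf G c Δ L s t₀))
      (IsFinal c (c.rounds G.n G.T) t₀ φ best) z).subset fun W hW => ?_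
  exact (h.optTrail_iff hb hφ ht₀).2 hW

/-- The states that occur in the state graph with the edges `E`. -/
def nodes {n : ℕ} (E : List (Edge n)) : Set (ℕ × ℕ) := {q | ∃ e ∈ E, q = tail e ∨ q = head e}

theorem Prepared.initial {n : ℕ} {R : ℕ} {s : Fin n} {E : List (Edge n)} {a : Scratch}
    (h : Prepared c R s E a) : Initial (nodes E) s a.Y := by
  refine ⟨h.Y_source, ?_⟩
  rintro q ⟨e, he, hq⟩ hne
  exact h.Y_eq_zero e he q hq hne

/-- The effect of the counting pass for the departure class `t₀`. -/
theorem Setup.foldl_countStep (h : Setup G c Δ 𝒲 L)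
    (hb : BestFor c (c.rounds G.n G.T) (c.starts G.T) (edgesOf G c Δ L s) s best)
    {a : Scratch} (ha : Prepared c (c.rounds G.n G.T) s (edgesOf G c Δ L s t₀) a)
    (ht₀ : t₀ < c.starts G.T) (sig : ℕ → ℚ) (z : Fin G.n) :
    ((sortedEdges c (c.rounds G.n G.T) a.phi best (edgesOf G c Δ L s t₀)).foldl
      (countStep (IsFinal c (c.rounds G.n G.T) t₀ a.phi best)) (a.Y, sig)).2 z =
    sig z + ({W | Opt G c Δ L s best z t₀ W}.ncard : ℚ) := by
  have h1 := TemporalBetweenness.foldl_countStep (s := s)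
    (nodup_sortedEdges (nodup_edges h.nodup s t₀))
    (sorted_sortedEdges c (c.rounds G.n G.T) a.phi best (edgesOf G c Δ L s t₀))
    (IsFinal c (c.rounds G.n G.T) t₀ a.phi best) (N := nodes (edgesOf G c Δ L s t₀))
    (fun e he => ⟨⟨e, (mem_sortedEdges.1 he).1, .inl rfl⟩, ⟨e, (mem_sortedEdges.1 he).1, .inr rfl⟩⟩)
    ha.initial sig z
  simp only [h.optTrail_iff hb ha.ranked ht₀] at h1
  convert h1

/-- The effect of the dependency pass for the departure class `t₀`. -/
theorem Setup.foldl_dependencyStep (h : Setup G c Δ 𝒲 L)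
    (hb : BestFor c (c.rounds G.n G.T) (c.starts G.T) (edgesOf G c Δ L s) s best)
    {a : Scratch} (ha : Prepared c (c.rounds G.n G.T) s (edgesOf G c Δ L s t₀) a)
    (ht₀ : t₀ < c.starts G.T) (sig out : ℕ → ℚ) (v : Fin G.n) :
    ((sortedEdges c (c.rounds G.n G.T) a.phi best (edgesOf G c Δ L s t₀)).foldl
      (dependencyStep (IsFinal c (c.rounds G.n G.T) t₀ a.phi best) s sig) ⟨a.Y, a.Z, out⟩).out v =
    out v + ∑ z : Fin G.n, if s ≠ v ∧ z ≠ v then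
      ({W | Opt G c Δ L s best z t₀ W ∧ Visits v W}.ncard : ℚ) / sig z else 0 := by
  have h1 := TemporalBetweenness.foldl_dependencyStep (s := s)
    (nodup_sortedEdges (nodup_edges h.nodup s t₀))
    (sorted_sortedEdges c (c.rounds G.n G.T) a.phi best (edgesOf G c Δ L s t₀))
    (IsFinal c (c.rounds G.n G.T) t₀ a.phi best) (N := nodes (edgesOf G c Δ L s t₀))
    (fun e he => ⟨⟨e, (mem_sortedEdges.1 he).1, .inl rfl⟩, ⟨e, (mem_sortedEdges.1 he).1, .inr rfl⟩⟩)
    (a := ⟨a.Y, a.Z, out⟩) ha.initial sig v (by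
      rintro q ⟨e, he, hq⟩
      exact ha.Z_eq_zero e he q hq v v.2)
  simp only [h.optTrail_iff hb ha.ranked ht₀] at h1
  convert h1

theorem vertices_eq (h : G.IsWalkFromTo s z W) : vertices W = s :: W.map TimeArc.dst := by
  cases W with
  | nil => simpa using h.2.1
  | cons e W =>
    have : e.src = s := by simpa using h.2.1
    rw [vertices, this]

/-- Each walk belongs to one departure class only. -/
theorem Setup.class_unique (h : Setup G c Δ 𝒲 L) {t₁ : ℕ}
    (ht₀ : t₀ < c.starts G.T) (ht₁ : t₁ < c.starts G.T) (h0 : Opt G c Δ L s best z t₀ W)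
    (h1 : Opt G c Δ L s best z t₁ W) : t₀ = t₁ := by
  have hW : W ≠ [] := by
    rintro rfl
    obtain ⟨-, ⟨f, hf, -⟩, -⟩ := h0
    simp at hf
  have key : ∀ {t}, Opt G c Δ L s best z t W → c.multi = true → departure W.reverse = t + 1 := by
    intro t ht
    exact ((trail_iff_isAdmissible (z := z) (W := W.reverse) h.mem_iff (by simpa using hW)).1
      (by rw [List.reverse_reverse]; exact ⟨ht.1, ht.2.1⟩)).2
  unfold Variant.starts at ht₀ ht₁
  by_cases hm : c.multi = true
  · have := key h0 hm
    have := key h1 hm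
    omega
  · rw [if_neg hm] at ht₀ ht₁
    omega

theorem ncard_disjoint {α : Type*} (P : ℕ → α → Prop) (k : ℕ) (hfin : ∀ i < k, {x | P i x}.Finite)
    (hdis : ∀ i < k, ∀ j < k, ∀ x, P i x → P j x → i = j) :
    {x | ∃ i < k, P i x}.Finite ∧
      {x | ∃ i < k, P i x}.ncard = ∑ i ∈ Finset.range k, {x | P i x}.ncard := by
  induction k with
  | zero => simp
  | succ k ih =>
    obtain ⟨h1, h2⟩ := ih (fun i hi => hfin i (by omega))
      fun i hi j hj => hdis i (by omega) j (by omega)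
    have h3 : {x | ∃ i < k + 1, P i x} = {x | ∃ i < k, P i x} ∪ {x | P k x} := by
      ext x
      simp only [Set.mem_union, Set.mem_ofPred_eq, Nat.lt_succ_iff_lt_or_eq]
      constructor
      · rintro ⟨i, hi | rfl, h⟩
        · exact .inl ⟨i, hi, h⟩
        · exact .inr h
      · rintro (⟨i, hi, h⟩ | h)
        · exact ⟨i, .inl hi, h⟩
        · exact ⟨k, .inr rfl, h⟩
    have h4 := hfin k (by omega)
    rw [h3, Finset.sum_range_succ, ← h2]
    refine ⟨h1.union h4, Set.ncard_union_eq (Set.disjoint_left.2 ?_) h1 h4⟩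
    rintro x ⟨i, hi, h⟩ h'
    have := hdis i (by omega) k (by omega) x h h'
    omega

/-- The numbers of optimal walks of the departure classes add up to the number of walks in `𝒲`. -/
theorem Setup.sum_ncard (h : Setup G c Δ 𝒲 L)
    (hb : BestFor c (c.rounds G.n G.T) (c.starts G.T) (edgesOf G c Δ L s) s best)
    (hfin : ∀ t₀ < c.starts G.T, {W | Opt G c Δ L s best z t₀ W}.Finite)
    (Q : List (TimeArc G.n) → Prop) :
    ∑ t₀ ∈ Finset.range (c.starts G.T), {W | Opt G c Δ L s best z t₀ W ∧ Q W}.ncard =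
      {W | W ∈ 𝒲 ∧ G.IsWalkFromTo s z W ∧ Q W.reverse}.ncard := by
  rw [← (ncard_disjoint _ _ (fun i hi => (hfin i hi).subset fun W hW => hW.1)
    fun i hi j hj W hW hW' => h.class_unique hi hj hW.1 hW'.1).2,
    ← Set.ncard_image_of_injective _ List.reverse_injective]
  congr 1
  have key : ∀ W, (∃ t₀ < c.starts G.T, Opt G c Δ L s best z t₀ W.reverse) ↔
      W ∈ 𝒲 ∧ G.IsWalkFromTo s z W := by
    intro W
    rw [← h.realizes.iff s z best (fun z W hW => hb.eq_cost h.mem_iff hW) (fun hc => ?_) W]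
    · exact hb.isOptimal_iff h.mem_iff
    · by_contra hne
      exact (hb.sound s hne).1 hc rfl
  ext W
  constructor
  · rintro ⟨V, ⟨t₀, ht₀, hV, hQ⟩, rfl⟩
    have := (key V.reverse).1 ⟨t₀, ht₀, by rwa [List.reverse_reverse]⟩
    exact ⟨this.1, this.2, by rwa [List.reverse_reverse]⟩
  · rintro ⟨h1, h2, h3⟩
    obtain ⟨t₀, ht₀, h4⟩ := (key W).2 ⟨h1, h2⟩
    exact ⟨W.reverse, ⟨t₀, ht₀, h4, h3⟩, W.reverse_reverse⟩

theorem Setup.sum_ncard_eq_walkCount (h : Setup G c Δ 𝒲 L)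
    (hb : BestFor c (c.rounds G.n G.T) (c.starts G.T) (edgesOf G c Δ L s) s best)
    (hfin : ∀ t₀ < c.starts G.T, {W | Opt G c Δ L s best z t₀ W}.Finite) :
    ∑ t₀ ∈ Finset.range (c.starts G.T), {W | Opt G c Δ L s best z t₀ W}.ncard =
      G.walkCount 𝒲 s z := by
  have := h.sum_ncard (z := z) hb hfin fun _ => True
  simp only [and_true] at this
  exact this

theorem Setup.sum_ncard_eq_walkCountThrough (h : Setup G c Δ 𝒲 L)
    (hb : BestFor c (c.rounds G.n G.T) (c.starts G.T) (edgesOf G c Δ L s) s best)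
    (hfin : ∀ t₀ < c.starts G.T, {W | Opt G c Δ L s best z t₀ W}.Finite) {v : Fin G.n}
    (hv : s ≠ v) :
    ∑ t₀ ∈ Finset.range (c.starts G.T), {W | Opt G c Δ L s best z t₀ W ∧ Visits v W}.ncard =
      G.walkCountThrough 𝒲 s z v := by
  rw [h.sum_ncard hb hfin]
  unfold walkCountThrough
  congr 1
  ext W
  refine and_congr_right fun _ => and_congr_right fun hW => ?_
  rw [vertices_eq hW, List.mem_cons, or_iff_right hv.symm]
  simp [Visits, ← Fin.ext_iff]

end

end TemporalBetweenness

namespace TemporalBetweenness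

open TemporalGraph TransitionSeq RAM

/-! ### The contribution of one starting point -/

/-- Clears the least costs and the numbers of optimal walks. -/
def resetProg : Prog :=
  .forLoop 15 0 (.seq (.store 6 (.reg 15) (.const 0)) (.storeNum 1 (.reg 15) .zero))

/-- Adds the pair dependencies of one starting point to the betweenness. -/
def sourceProg (c : Variant) : Prog :=
  .seq resetProg (.seq (.forLoop 11 8 (bestPass c)) (.seq (.forLoop 11 8 (countPass c))
    (.forLoop 11 8 (dependencyPass c))))

/-- All loop counters but the starting point are zero. -/
structure Mem.AtSource (μ : Mem) (s : ℕ) : Prop where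
  s : μ.s = s
  t₀ : μ.t₀ = 0
  idle : μ.Idle

section

variable {G : TemporalGraph} {c : Variant} {Δ : ℕ} {s : Fin G.n} {L : List (TimeArc G.n)}
  {𝒲 : Set (List (TimeArc G.n))} {K : Consts} {μ : Mem}

theorem Ready.run_reset (h : Ready c G.T Δ L K) (hμ : μ.AtSource s) :
    ∃ μ' : Mem, μ'.AtSource s ∧ μ'.out = μ.out ∧ (∀ v < G.n, μ'.best v = 0 ∧ μ'.sig v = 0) ∧
      Run resetProg (toState K μ) (20 * (G.n * 20)) (toState K μ') := by
  obtain ⟨st', ⟨μ', rfl, h1, h2, h3⟩, hrun⟩ := Run.forLoop_inv (x := 15) (y := 0) (N := G.n)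
    (c := 20) (p := .seq (.store 6 (.reg 15) (.const 0)) (.storeNum 1 (.reg 15) .zero)) (by decide)
    h.one_le_n (by norm_num) (fun i st => ∃ μ' : Mem, st = toState K μ' ∧ μ'.AtSource s ∧
      μ'.out = μ.out ∧ ∀ v < i, μ'.best v = 0 ∧ μ'.sig v = 0)
    (by
      rintro i st ⟨μ', rfl, h1, -⟩
      exact ⟨h1.idle.v, h.n_eq⟩)
    (by
      rintro i st hi ⟨μ', rfl, h1, h2, h3⟩
      refine ⟨_, ⟨{ μ' with
        best := Function.update μ'.best i 0
        sig := Function.update μ'.sig i 0 }, rfl, ⟨h1.s, h1.t₀, h1.idle.j, h1.idle.t, h1.idle.r,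
          h1.idle.v⟩, h2, fun v hv => ?_⟩, ?_⟩
      · by_cases hvi : v = i
        · subst hvi; simp
        · simp only [Function.update_of_ne hvi]
          exact h3 v (by omega)
      · rw [setReg_v, setReg_v]
        have r1 := Run.store 6 (.reg 15) (.const 0) (toState K { μ' with v := i })
        rw [show (NatExpr.reg 15).eval (toState K { μ' with v := i }) = i from rfl,
          setArr_best] at r1
        have r2 := Run.storeNum 1 (.reg 15) .zero (toState K
          { μ' with v := i, best := Function.update μ'.best i 0 })
        rw [show (NatExpr.reg 15).eval (toState K
          { μ' with v := i, best := Function.update μ'.best i 0 }) = i from rfl, setNum_sig] at r2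
        exact (r1.seq r2).mono (by decide))
    (st := toState K μ) ⟨μ, rfl, hμ, rfl, by simp⟩
  exact ⟨μ', h1, h2, h3, hrun⟩

theorem Ready.one_le_T0 (h : Ready c G.T Δ L K) : 1 ≤ c.starts G.T := by
  have := h.one_le_T
  unfold Variant.starts
  split_ifs <;> omega

theorem Ready.one_le_cost (h : Ready c G.T Δ L K) : 1 ≤ K.R * (L.length * (G.T + 1)) :=
  Nat.mul_pos h.one_le_R (Nat.mul_pos h.one_le_M (by positivity))

theorem Ready.run_bestPasses (h : Ready c G.T Δ L K) (hG : Setup G c Δ 𝒲 L) (hμ : μ.AtSource s)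
    (hbest : ∀ v < G.n, μ.best v = 0) :
    ∃ μ' : Mem, μ'.AtSource s ∧ μ'.out = μ.out ∧ μ'.sig = μ.sig ∧
      BestFor c (c.rounds G.n G.T) (c.starts G.T) (edgesOf G c Δ L s) s μ'.best ∧
      Run (.forLoop 11 8 (bestPass c)) (toState K μ)
        (20 * (c.starts G.T * (3000000 * (K.R * (L.length * (G.T + 1)))))) (toState K μ') := by
  have hpos := h.one_le_cost
  obtain ⟨st', ⟨μ', rfl, h1, h2, h3, h4⟩, hrun⟩ := Run.forLoop_inv (x := 11) (y := 8)
    (N := c.starts G.T) (c := 3000000 * (K.R * (L.length * (G.T + 1)))) (p := bestPass c)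
    (by decide) h.one_le_T0 (by omega) (fun i st => ∃ μ' : Mem, st = toState K μ' ∧ μ'.AtSource s ∧
      μ'.out = μ.out ∧ μ'.sig = μ.sig ∧
      BestFor c (c.rounds G.n G.T) i (edgesOf G c Δ L s) s μ'.best)
    (by
      rintro i st ⟨μ', rfl, h1, -⟩
      exact ⟨h1.t₀, h.T0_eq⟩)
    (by
      rintro i st hi ⟨μ', rfl, h1, h2, h3, h4⟩
      obtain ⟨s', t₁, j, t, r, v, best, phi, out, sig, Y, Z⟩ := μ'
      obtain rfl : s' = s := h1.s
      obtain ⟨a, ha, hrun⟩ := h.run_bestPass (μ := ⟨s, i, j, t, r, v, best, phi, out, sig, Y, Z⟩)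
        ⟨h1.idle.j, h1.idle.t, h1.idle.r, h1.idle.v⟩ s.2
      rw [h.R_eq] at ha
      refine ⟨_, ⟨(⟨s, t₁, j, t, r, v, (edgesOf G c Δ L s i).foldl
        (bestStep c (c.rounds G.n G.T) s i a.phi) best, phi, out, sig, Y, Z⟩ : Mem).put a, rfl,
          ⟨h1.s, h1.t₀, h1.idle.j, h1.idle.t, h1.idle.r, h1.idle.v⟩, h2, h3, ?_⟩, ?_⟩
      · exact h4.succ ha.ranked (hasShort_edges hG.mem_iff) (posTime_edges hG.mem_iff)
      · rw [setReg_t₀, setReg_t₀]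
        exact hrun)
    (st := toState K μ) ⟨μ, rfl, hμ, rfl, rfl, BestFor.zero _ _ _ _ _ hbest⟩
  exact ⟨μ', h1, h2, h3, h4, hrun⟩

theorem Ready.run_countPasses (h : Ready c G.T Δ L K) (hG : Setup G c Δ 𝒲 L) (hμ : μ.AtSource s)
    (hb : BestFor c (c.rounds G.n G.T) (c.starts G.T) (edgesOf G c Δ L s) s μ.best)
    (hsig : ∀ v < G.n, μ.sig v = 0) :
    ∃ μ' : Mem, μ'.AtSource s ∧ μ'.out = μ.out ∧ μ'.best = μ.best ∧
      (∀ t₀ < c.starts G.T, ∀ z, {W | Opt G c Δ L s μ.best z t₀ W}.Finite) ∧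
      (∀ z : Fin G.n, μ'.sig z = G.walkCount 𝒲 s z) ∧
      Run (.forLoop 11 8 (countPass c)) (toState K μ)
        (20 * (c.starts G.T * (10000000 * (K.R * (L.length * (G.T + 1)))))) (toState K μ') := by
  have hpos := h.one_le_cost
  obtain ⟨st', ⟨μ', rfl, h1, h2, h3, h4, h5⟩, hrun⟩ := Run.forLoop_inv (x := 11) (y := 8)
    (N := c.starts G.T) (c := 10000000 * (K.R * (L.length * (G.T + 1)))) (p := countPass c)
    (by decide) h.one_le_T0 (by omega) (fun i st => ∃ μ' : Mem, st = toState K μ' ∧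
      μ'.AtSource s ∧ μ'.out = μ.out ∧ μ'.best = μ.best ∧
      (∀ t₀ < i, ∀ z, {W | Opt G c Δ L s μ.best z t₀ W}.Finite) ∧ ∀ z : Fin G.n, μ'.sig z =
        ((∑ t₀ ∈ Finset.range i, {W | Opt G c Δ L s μ.best z t₀ W}.ncard : ℕ) : ℚ))
    (by
      rintro i st ⟨μ', rfl, h1, -⟩
      exact ⟨h1.t₀, h.T0_eq⟩)
    (by
      rintro i st hi ⟨μ', rfl, h1, h2, h3, h4, h5⟩
      obtain ⟨s', t₁, j, t, r, v, best, phi, out, sig, Y, Z⟩ := μ'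
      obtain rfl : s' = s := h1.s
      obtain rfl : best = μ.best := h3
      obtain ⟨a, b, ha, hrun⟩ := h.run_countPass
        (μ := ⟨s, i, j, t, r, v, μ.best, phi, out, sig, Y, Z⟩)
        ⟨h1.idle.j, h1.idle.t, h1.idle.r, h1.idle.v⟩ s.2
      simp only [h.R_eq] at ha hrun ⊢
      refine ⟨_, ⟨(⟨s, t₁, j, t, r, v, μ.best, phi, out, ((sortedEdges c (c.rounds G.n G.T) a.phi
        μ.best (edgesOf G c Δ L s i)).foldl (countStep
          (IsFinal c (c.rounds G.n G.T) i a.phi μ.best)) (a.Y, sig)).2, Y, Z⟩ : Mem).put b, rfl,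
          ⟨h1.s, h1.t₀, h1.idle.j, h1.idle.t, h1.idle.r, h1.idle.v⟩, h2, rfl,
            fun t₀ ht₀ z => ?_, fun z => ?_⟩, ?_⟩
      · rcases Nat.lt_succ_iff_lt_or_eq.1 ht₀ with ht₀ | rfl
        · exact h4 t₀ ht₀ z
        · exact hG.finite_opt hb ha.ranked hi
      · rw [Finset.sum_range_succ, Nat.cast_add, ← h5 z]
        exact hG.foldl_countStep hb ha hi sig z
      · rw [setReg_t₀, setReg_t₀]
        exact hrun)
    (st := toState K μ) ⟨μ, rfl, hμ, rfl, rfl, by simp, fun z => by simp [hsig z z.2]⟩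
  exact ⟨μ', h1, h2, h3, h4, fun z => by rw [h5, hG.sum_ncard_eq_walkCount hb (h4 · · z)], hrun⟩

theorem Ready.run_dependencyPasses (h : Ready c G.T Δ L K) (hG : Setup G c Δ 𝒲 L)
    (hμ : μ.AtSource s)
    (hb : BestFor c (c.rounds G.n G.T) (c.starts G.T) (edgesOf G c Δ L s) s μ.best)
    (hfin : ∀ t₀ < c.starts G.T, ∀ z, {W | Opt G c Δ L s μ.best z t₀ W}.Finite)
    (hsig : ∀ z : Fin G.n, μ.sig z = G.walkCount 𝒲 s z) :
    ∃ μ' : Mem, μ'.AtSource s ∧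
      (∀ v : Fin G.n, μ'.out v = μ.out v +
        ∑ z : Fin G.n, if s ≠ v ∧ z ≠ v then G.pairDependency 𝒲 s z v else 0) ∧
      Run (.forLoop 11 8 (dependencyPass c)) (toState K μ)
        (20 * (c.starts G.T * (50000000 * (K.R * (L.length * (G.T + 1)))))) (toState K μ') := by
  have hpos := h.one_le_cost
  obtain ⟨st', ⟨μ', rfl, h1, h2, h3, h4⟩, hrun⟩ := Run.forLoop_inv (x := 11) (y := 8)
    (N := c.starts G.T) (c := 50000000 * (K.R * (L.length * (G.T + 1)))) (p := dependencyPass c)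
    (by decide) h.one_le_T0 (by omega) (fun i st => ∃ μ' : Mem, st = toState K μ' ∧
      μ'.AtSource s ∧ μ'.sig = μ.sig ∧ μ'.best = μ.best ∧ ∀ v : Fin G.n, μ'.out v = μ.out v +
        ∑ z : Fin G.n, if s ≠ v ∧ z ≠ v then
          ((∑ t₀ ∈ Finset.range i, {W | Opt G c Δ L s μ.best z t₀ W ∧ Visits v W}.ncard : ℕ) : ℚ) /
            μ.sig z else 0)
    (by
      rintro i st ⟨μ', rfl, h1, -⟩
      exact ⟨h1.t₀, h.T0_eq⟩)
    (by
      rintro i st hi ⟨μ', rfl, h1, h2, h3, h4⟩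
      obtain ⟨s', t₁, j, t, r, v, best, phi, out, sig, Y, Z⟩ := μ'
      obtain rfl : s' = s := h1.s
      obtain rfl : sig = μ.sig := h2
      obtain rfl : best = μ.best := h3
      obtain ⟨a, b, ha, hrun⟩ := h.run_dependencyPass
        (μ := ⟨s, i, j, t, r, v, μ.best, phi, out, μ.sig, Y, Z⟩)
        ⟨h1.idle.j, h1.idle.t, h1.idle.r, h1.idle.v⟩ s.2
      simp only [h.R_eq] at ha hrun ⊢
      refine ⟨_, ⟨(⟨s, t₁, j, t, r, v, μ.best, phi, ((sortedEdges c (c.rounds G.n G.T) a.phi μ.best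
        (edgesOf G c Δ L s i)).foldl (dependencyStep (IsFinal c (c.rounds G.n G.T) i a.phi μ.best)
          s μ.sig) ⟨a.Y, a.Z, out⟩).out, μ.sig, Y, Z⟩ : Mem).put b, rfl,
          ⟨h1.s, h1.t₀, h1.idle.j, h1.idle.t, h1.idle.r, h1.idle.v⟩, rfl, rfl, fun v => ?_⟩, ?_⟩
      · refine (hG.foldl_dependencyStep hb ha hi μ.sig out v).trans ?_
        rw [show out v = _ from h4 v, add_assoc, ← Finset.sum_add_distrib]
        refine congrArg (μ.out v + ·) (Finset.sum_congr rfl fun z _ => ?_)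
        split_ifs
        · rw [Finset.sum_range_succ, Nat.cast_add, add_div]
        · rw [add_zero]
      · rw [setReg_t₀, setReg_t₀]
        exact hrun)
    (st := toState K μ) ⟨μ, rfl, hμ, rfl, rfl, fun v => by simp⟩
  refine ⟨μ', h1, fun v => ?_, hrun⟩
  rw [h4]
  refine congrArg (μ.out v + ·) (Finset.sum_congr rfl fun z _ => ?_)
  split_ifs with hv
  · rw [hG.sum_ncard_eq_walkCountThrough hb (hfin · · z) hv.1, hsig]
    unfold pairDependency
    split_ifs with h0
    · rw [h0, Nat.cast_zero, div_zero]
    · rfl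
  · rfl

theorem Ready.run_source (h : Ready c G.T Δ L K) (hG : Setup G c Δ 𝒲 L) (hμ : μ.AtSource s) :
    ∃ μ' : Mem, μ'.AtSource s ∧
      (∀ v : Fin G.n, μ'.out v = μ.out v +
        ∑ z : Fin G.n, if s ≠ v ∧ z ≠ v then G.pairDependency 𝒲 s z v else 0) ∧
      Run (sourceProg c) (toState K μ)
        (2000000000 * (c.starts G.T * (K.R * (L.length * (G.T + 1))))) (toState K μ') := by
  obtain ⟨μ₁, h1, ho1, hz1, r1⟩ := h.run_reset hμ
  obtain ⟨μ₂, h2, ho2, hs2, hb2, r2⟩ := h.run_bestPasses hG h1 fun v hv => (hz1 v hv).1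
  obtain ⟨μ₃, h3, ho3, hb3, hf3, hs3, r3⟩ := h.run_countPasses hG h2 hb2
    fun v hv => by rw [hs2]; exact (hz1 v hv).2
  obtain ⟨μ₄, h4, ho4, r4⟩ := h.run_dependencyPasses hG h3 (by rwa [hb3]) (by rwa [hb3]) hs3
  refine ⟨μ₄, h4, fun v => by rw [ho4, ho3, ho2, ho1], (r1.seq (r2.seq (r3.seq r4))).mono ?_⟩
  have h5 : G.n * 1 ≤ K.R * (L.length * (G.T + 1)) :=
    Nat.mul_le_mul h.n_le_R (Nat.mul_pos h.one_le_M (by positivity))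
  have h6 : 1 * (K.R * (L.length * (G.T + 1))) ≤
    c.starts G.T * (K.R * (L.length * (G.T + 1))) := Nat.mul_le_mul_right _ h.one_le_T0
  have h7 := h.one_le_cost
  rw [mul_left_comm (c.starts G.T) 3000000, mul_left_comm (c.starts G.T) 10000000,
    mul_left_comm (c.starts G.T) 50000000]
  omega

end

end TemporalBetweenness

namespace TemporalBetweenness

open TemporalGraph TransitionSeq RAM

/-! ### The complete algorithm -/

/-- The memory `st` after the first `i` entries of the table `a` of multiples of `d` have been
computed, with the accumulator `q`. -/
def filled (st : State) (a q d i : ℕ) : State where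
  reg := Function.update st.reg q (i * d)
  arr := Function.update st.arr a fun v => if v < i then v * d else st.arr a v
  num := st.num

/-- Computes a table of multiples of the value of `e`; the bound is the content of register `y`. -/
def fillProg (y a q : ℕ) (e : NatExpr) : Prog :=
  .forLoop 15 y (.seq (.store a (.reg 15) (.reg q)) (.assign q (.add (.reg q) e)))

theorem run_fillProg {st : State} {y a q d N : ℕ} {e : NatExpr} (hN : 1 ≤ N) (hy : y ≠ 15)
    (hq : q ≠ 15) (hyq : y ≠ q) (h15 : st.reg 15 = 0) (hst : st.reg y = N) (h0 : st.reg q = 0)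
    (he : ∀ st' : State, (∀ x, x ≠ 15 → x ≠ q → st'.reg x = st.reg x) → e.eval st' = d)
    (hcost : e.cost ≤ 3) :
    Run (fillProg y a q e) st (20 * (N * 10)) (filled st a q d N) := by
  have h := Run.forLoop (x := 15) (y := y) (N := N) (c := 10)
    (p := .seq (.store a (.reg 15) (.reg q)) (.assign q (.add (.reg q) e))) hy hN (by norm_num)
    (filled st a q d) (fun i => ⟨(Function.update_of_ne hq.symm ..).trans h15,
      (Function.update_of_ne hyq ..).trans hst⟩) ?_
  · have h1 : filled st a q d 0 = st := by
      simp only [filled, zero_mul, Nat.not_lt_zero, if_false, Function.update_eq_self]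
      rw [← h0, Function.update_eq_self]
    rwa [h1] at h
  · intro i hi
    have r1 := Run.store a (.reg 15) (.reg q) ((filled st a q d i).setReg 15 i)
    have r2 := Run.assign q (.add (.reg q) e) (((filled st a q d i).setReg 15 i).setArr a
      ((NatExpr.reg 15).eval ((filled st a q d i).setReg 15 i))
      ((NatExpr.reg q).eval ((filled st a q d i).setReg 15 i)))
    have h15' : (NatExpr.reg 15).eval ((filled st a q d i).setReg 15 i) = i :=
      State.setReg_self ..
    have hq' : (NatExpr.reg q).eval ((filled st a q d i).setReg 15 i) = i * d :=
      (State.setReg_of_ne _ _ hq).trans (Function.update_self ..)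
    rw [h15', hq'] at r1 r2
    have hd : e.eval (((filled st a q d i).setReg 15 i).setArr a i (i * d)) = d :=
      he _ fun x hx hxq => (State.setReg_of_ne (filled st a q d i) i hx).trans
        (Function.update_of_ne hxq _ _)
    rw [NatExpr.eval, hd] at r2
    have hq'' : (NatExpr.reg q).eval (((filled st a q d i).setReg 15 i).setArr a i (i * d)) =
      i * d := hq'
    rw [hq''] at r2
    have h3 : (((filled st a q d i).setReg 15 i).setArr a i (i * d)).setReg q (i * d + d) =
        (filled st a q d (i + 1)).setReg 15 i := by
      refine (State.mk.injEq ..).mpr ⟨?_, ?_, rfl⟩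
      · change Function.update (Function.update (Function.update st.reg q (i * d)) 15 i) q
          (i * d + d) = Function.update (Function.update st.reg q ((i + 1) * d)) 15 i
        rw [Function.update_comm hq.symm, Function.update_idem, add_mul, one_mul,
          Function.update_comm hq]
      · change Function.update (Function.update st.arr a _) a (Function.update
          (Function.update st.arr a _ a) i (i * d)) = Function.update st.arr a _
        rw [Function.update_idem, Function.update_self]
        congr 1
        funext v
        by_cases hv : v = i
        · subst hv; simp
        · rw [Function.update_of_ne hv]
          have : v < i + 1 ↔ v < i := by omega
          simp only [this]
    rw [← h3]
    refine (r1.seq r2).mono ?_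
    simp only [NatExpr.cost]
    omega

section

variable (K : Consts) (μ : Mem) (x : ℕ)

theorem setReg_T1 : (toState K μ).setReg 4 x = toState { K with T1 := x } μ :=
  setReg_toState _ _ _ _ rfl rfl fun y => by
    by_cases h : y = 4
    · subst h; rfl
    · rw [if_neg h]; dsimp only [toState]; split <;> first | rfl | contradiction

theorem setReg_lim : (toState K μ).setReg 6 x = toState { K with lim := x } μ :=
  setReg_toState _ _ _ _ rfl rfl fun y => by
    by_cases h : y = 6
    · subst h; rfl
    · rw [if_neg h]; dsimp only [toState]; split <;> first | rfl | contradiction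

theorem setReg_R : (toState K μ).setReg 7 x = toState { K with R := x } μ :=
  setReg_toState _ _ _ _ rfl rfl fun y => by
    by_cases h : y = 7
    · subst h; rfl
    · rw [if_neg h]; dsimp only [toState]; split <;> first | rfl | contradiction

theorem setReg_T0 : (toState K μ).setReg 8 x = toState { K with T0 := x } μ :=
  setReg_toState _ _ _ _ rfl rfl fun y => by
    by_cases h : y = 8
    · subst h; rfl
    · rw [if_neg h]; dsimp only [toState]; split <;> first | rfl | contradiction

theorem setReg_acc : (toState K μ).setReg 9 x = toState { K with acc := x } μ :=
  setReg_toState _ _ _ _ rfl rfl fun y => by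
    by_cases h : y = 9
    · subst h; rfl
    · rw [if_neg h]; dsimp only [toState]; split <;> first | rfl | contradiction

variable (d i : ℕ)

theorem filled_row : filled (toState K μ) 3 5 d i = toState { K with
    Q := i * d, row := fun v => if v < i then v * d else K.row v } μ := by
  simp only [filled, toState, State.mk.injEq, and_true]
  constructor
  · funext y
    by_cases h : y = 5
    · subst h; rfl
    · rw [Function.update_of_ne h]; split <;> first | rfl | contradiction
  · funext y
    by_cases h : y = 3
    · subst h; rfl
    · rw [Function.update_of_ne h]; split <;> first | rfl | contradiction

theorem filled_slab : filled (toState K μ) 4 9 d i = toState { K with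
    acc := i * d, slab := fun v => if v < i then v * d else K.slab v } μ := by
  simp only [filled, toState, State.mk.injEq, and_true]
  constructor
  · funext y
    by_cases h : y = 9
    · subst h; rfl
    · rw [Function.update_of_ne h]; split <;> first | rfl | contradiction
  · funext y
    by_cases h : y = 4
    · subst h; rfl
    · rw [Function.update_of_ne h]; split <;> first | rfl | contradiction

theorem filled_wgt : filled (toState K μ) 5 9 d i = toState { K with
    acc := i * d, wgt := fun v => if v < i then v * d else K.wgt v } μ := by
  simp only [filled, toState, State.mk.injEq, and_true]
  constructor
  · funext y
    by_cases h : y = 9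
    · subst h; rfl
    · rw [Function.update_of_ne h]; split <;> first | rfl | contradiction
  · funext y
    by_cases h : y = 5
    · subst h; rfl
    · rw [Function.update_of_ne h]; split <;> first | rfl | contradiction

end

/-- Computes the constants of the main part of the algorithm. -/
def initProg (c : Variant) : Prog :=
  .seq (.assign 4 (.add (.reg 1) (.const 1)))
  (.seq (fillProg 0 3 5 (.reg 4))
  (.seq (fillProg 0 4 9 (.reg 5))
  (.seq (.assign 9 (.const 0))
  (.seq (.assign 6 (if c.restless then .reg 3 else .reg 1))
  (.seq (.assign 7 (if c.restless || c.foremost then .add (.reg 5) (.const 3)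
    else .add (.reg 0) (.const 3)))
  (.seq (.assign 8 (if c.multi then .reg 1 else .const 1))
  (fillProg 4 5 9 (.add (.reg 7) (.const 1)))))))))

/-- The algorithm. -/
def mainProg (c : Variant) : Prog :=
  .ite (.eq (.reg 2) (.const 0)) .skip (.seq (initProg c) (.forLoop 10 0 (sourceProg c)))

section

variable {G : TemporalGraph} {c : Variant} {Δ : ℕ} {L : List (TimeArc G.n)}
  {𝒲 : Set (List (TimeArc G.n))} {K : Consts} {μ : Mem}

/-- The constants in the input. -/
def inputConsts (G : TemporalGraph) (Δ : ℕ) (L : List (TimeArc G.n)) : Consts where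
  n := G.n
  T := G.T
  M := G.M
  Δ := Δ
  T1 := 0
  Q := 0
  lim := 0
  R := 0
  T0 := 0
  acc := 0
  src j := (L[j]?.map (fun e => (e.src : ℕ))).getD 0
  dst j := (L[j]?.map (fun e => (e.dst : ℕ))).getD 0
  tim j := (L[j]?.map TimeArc.time).getD 0
  row _ := 0
  slab _ := 0
  wgt _ := 0

/-- The initial values of the variables. -/
def inputMem : Mem where
  s := 0
  t₀ := 0
  j := 0
  t := 0
  r := 0
  v := 0
  best _ := 0
  phi _ := 0
  out _ := 0
  sig _ := 0
  Y _ := 0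
  Z _ _ := 0

theorem input_eq : G.input Δ L = toState (inputConsts G Δ L) inputMem := by
  simp only [TemporalGraph.input, toState, State.mk.injEq, inputConsts, inputMem]
  refine ⟨?_, ?_, ?_⟩
  · funext x
    symm
    split <;> first | rfl | simp_all
  · funext a i
    symm
    split <;> first | rfl | simp_all
  · funext a i
    split <;> rfl

theorem length_eq_M (hnd : L.Nodup) (hL : ∀ e, e ∈ L ↔ e ∈ G.arcs) : L.length = G.M := by
  classical
  rw [← List.toFinset_card_of_nodup hnd]
  unfold TemporalGraph.M
  congr 1
  ext e
  rw [List.mem_toFinset, hL]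

theorem run_fill_row (hn : 1 ≤ K.n) (hv : μ.v = 0) (hQ : K.Q = 0) :
    Run (fillProg 0 3 5 (.reg 4)) (toState K μ) (20 * (K.n * 10)) (toState { K with
      Q := K.n * K.T1, row := fun v => if v < K.n then v * K.T1 else K.row v } μ) := by
  rw [← filled_row]
  exact run_fillProg hn (by decide) (by decide) (by decide) hv rfl hQ
    (fun st' h => h 4 (by decide) (by decide)) (by decide)

theorem run_fill_slab (hn : 1 ≤ K.n) (hv : μ.v = 0) (hacc : K.acc = 0) :
    Run (fillProg 0 4 9 (.reg 5)) (toState K μ) (20 * (K.n * 10)) (toState { K with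
      acc := K.n * K.Q, slab := fun v => if v < K.n then v * K.Q else K.slab v } μ) := by
  rw [← filled_slab]
  exact run_fillProg hn (by decide) (by decide) (by decide) hv rfl hacc
    (fun st' h => h 5 (by decide) (by decide)) (by decide)

theorem run_fill_wgt (hT : 1 ≤ K.T1) (hv : μ.v = 0) (hacc : K.acc = 0) :
    Run (fillProg 4 5 9 (.add (.reg 7) (.const 1))) (toState K μ) (20 * (K.T1 * 10))
      (toState { K with
        acc := K.T1 * (K.R + 1)
        wgt := fun v => if v < K.T1 then v * (K.R + 1) else K.wgt v } μ) := by
  rw [← filled_wgt]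
  exact run_fillProg hT (by decide) (by decide) (by decide) hv rfl hacc
    (fun st' h => congrArg (· + 1) (h 7 (by decide) (by decide))) (by decide)

theorem run_lim (c : Variant) (K : Consts) (μ : Mem) :
    Run (.assign 6 (if c.restless then .reg 3 else .reg 1)) (toState K μ) 2
      (toState { K with lim := c.lim K.T K.Δ } μ) := by
  have := Run.assign 6 (if c.restless then .reg 3 else .reg 1) (toState K μ)
  unfold Variant.lim
  split_ifs at this ⊢ <;> rw [setReg_lim] at this <;> exact this

theorem run_R (c : Variant) (K : Consts) (μ : Mem) (hQ : K.Q = K.n * (K.T + 1)) :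
    Run (.assign 7 (if c.restless || c.foremost then .add (.reg 5) (.const 3)
      else .add (.reg 0) (.const 3))) (toState K μ) 4
      (toState { K with R := c.rounds K.n K.T } μ) := by
  have := Run.assign 7 (if c.restless || c.foremost then .add (.reg 5) (.const 3)
      else .add (.reg 0) (.const 3)) (toState K μ)
  unfold Variant.rounds
  rw [← hQ]
  split_ifs at this ⊢ <;> rw [setReg_R] at this <;> exact this

theorem run_T0 (c : Variant) (K : Consts) (μ : Mem) :
    Run (.assign 8 (if c.multi then .reg 1 else .const 1)) (toState K μ) 2
      (toState { K with T0 := c.starts K.T } μ) := by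
  have := Run.assign 8 (if c.multi then .reg 1 else .const 1) (toState K μ)
  unfold Variant.starts
  split_ifs at this ⊢ <;> rw [setReg_T0] at this <;> exact this

theorem run_initProg (hnd : L.Nodup) (hL : ∀ e, e ∈ L ↔ e ∈ G.arcs) (hM : 1 ≤ G.M) (hn : 1 ≤ G.n)
    (hT : 1 ≤ G.T) : ∃ K, Ready c G.T Δ L K ∧
      Run (initProg c) (G.input Δ L) (1000 * (G.n + G.T)) (toState K inputMem) := by
  rw [input_eq]
  have r1 := Run.assign 4 (.add (.reg 1) (.const 1)) (toState (inputConsts G Δ L) inputMem)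
  rw [setReg_T1] at r1
  have r2 := run_fill_row (K := { inputConsts G Δ L with T1 := G.T + 1 }) (μ := inputMem) hn rfl rfl
  have r3 := run_fill_slab (K := { inputConsts G Δ L with
    T1 := G.T + 1
    Q := G.n * (G.T + 1)
    row := fun v => if v < G.n then v * (G.T + 1) else 0 }) (μ := inputMem) hn rfl rfl
  have r4 := Run.assign 9 (.const 0) (toState { inputConsts G Δ L with
    T1 := G.T + 1
    Q := G.n * (G.T + 1)
    acc := G.n * (G.n * (G.T + 1))
    row := fun v => if v < G.n then v * (G.T + 1) else 0
    slab := fun v => if v < G.n then v * (G.n * (G.T + 1)) else 0 } inputMem)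
  rw [setReg_acc] at r4
  refine ⟨_, ?_, (r1.seq (r2.seq (r3.seq (r4.seq ((run_lim c _ _).seq ((run_R c _ _ rfl).seq
    ((run_T0 c _ _).seq (run_fill_wgt ?_ rfl rfl)))))))).mono ?_⟩
  · constructor
    · rfl
    · rfl
    · exact (length_eq_M hnd hL).symm
    · rfl
    · rfl
    · rfl
    · rfl
    · intro j f hf
      change (L[j]?.map (fun e => (e.src : ℕ))).getD 0 = f.src
      rw [hf]; rfl
    · intro j f hf
      change (L[j]?.map (fun e => (e.dst : ℕ))).getD 0 = f.dst
      rw [hf]; rfl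
    · intro j f hf
      change (L[j]?.map TimeArc.time).getD 0 = f.time
      rw [hf]; rfl
    · exact fun v hv => if_pos hv
    · exact fun v hv => if_pos hv
    · exact fun d hd => if_pos (Nat.lt_succ_of_le hd)
    · exact fun f hf => G.time_le f ((hL f).1 hf)
    · rwa [length_eq_M hnd hL]
    · exact hT
    · exact hn
  · exact Nat.succ_pos _
  · change 4 + (20 * (G.n * 10) + (20 * (G.n * 10) + (2 + (2 + (4 + (2 +
      20 * ((G.T + 1) * 10))))))) ≤ 1000 * (G.n + G.T)
    omega

theorem one_le_of_mem {e : TimeArc G.n} (he : e ∈ G.arcs) : 1 ≤ G.M ∧ 1 ≤ G.n ∧ 1 ≤ G.T := by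
  have h1 := G.time_pos e he
  have h2 := G.time_le e he
  have h3 := e.src.2
  exact ⟨Finset.card_pos.2 ⟨e, he⟩, by omega, by omega⟩

/-- Without time arcs there are no walks. -/
theorem betweenness_eq_zero (hM : G.M = 0) (v : Fin G.n) : G.betweenness 𝒲 v = 0 := by
  have h : ∀ s z, G.walkCount 𝒲 s z = 0 := by
    intro s z
    unfold walkCount
    convert Set.ncard_empty (List (TimeArc G.n))
    rw [Set.eq_empty_iff_forall_notMem]
    rintro W ⟨-, ⟨h1, -⟩, h2, -⟩
    cases W with
    | nil => simp at h2
    | cons e W =>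
      have := Finset.card_pos.2 ⟨e, h1 e (by simp)⟩
      unfold TemporalGraph.M at hM
      omega
  unfold betweenness pairDependency
  simp [h]

/-- The outer loop adds up the pair dependencies of all starting points. -/
theorem Ready.run_sources (h : Ready c G.T Δ L K) (hG : Setup G c Δ 𝒲 L) (hμ : μ.AtSource 0)
    (hout : μ.out = fun _ => 0) :
    ∃ μ' : Mem, (∀ v : Fin G.n, μ'.out v = G.betweenness 𝒲 v) ∧
      Run (.forLoop 10 0 (sourceProg c)) (toState K μ)
        (20 * (G.n * (2000000000 * (c.starts G.T * (K.R * (L.length * (G.T + 1)))))))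
        (toState K μ') := by
  have hpos : 1 ≤ c.starts G.T * (K.R * (L.length * (G.T + 1))) :=
    Nat.mul_pos h.one_le_T0 h.one_le_cost
  set D : Fin G.n → Fin G.n → ℚ := fun v s =>
    ∑ z : Fin G.n, if s ≠ v ∧ z ≠ v then G.pairDependency 𝒲 s z v else 0 with hD
  obtain ⟨st', ⟨μ', rfl, h1, h2⟩, hrun⟩ := Run.forLoop_inv (x := 10) (y := 0) (N := G.n)
    (c := 2000000000 * (c.starts G.T * (K.R * (L.length * (G.T + 1))))) (p := sourceProg c)
    (by decide) h.one_le_n (by omega) (fun i st => ∃ μ' : Mem, st = toState K μ' ∧ μ'.AtSource 0 ∧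
      ∀ v : Fin G.n, μ'.out v = ∑ s : Fin G.n, if (s : ℕ) < i then D v s else 0)
    (by
      rintro i st ⟨μ', rfl, h1, -⟩
      exact ⟨h1.s, h.n_eq⟩)
    (by
      rintro i st hi ⟨μ', rfl, h1, h2⟩
      obtain ⟨μ'', h3, h4, hrun⟩ := h.run_source (s := ⟨i, hi⟩) hG (μ := { μ' with s := i })
        ⟨rfl, h1.t₀, h1.idle.j, h1.idle.t, h1.idle.r, h1.idle.v⟩
      refine ⟨toState K { μ'' with s := 0 }, ⟨_, rfl, ⟨rfl, h3.t₀, h3.idle.j, h3.idle.t, h3.idle.r,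
        h3.idle.v⟩, fun v => ?_⟩, ?_⟩
      · refine (h4 v).trans ?_
        rw [show ({ μ' with s := i } : Mem).out v = _ from h2 v]
        have : ∀ s : Fin G.n, (if (s : ℕ) < i + 1 then D v s else 0) =
            (if (s : ℕ) < i then D v s else 0) + if s = ⟨i, hi⟩ then D v s else 0 := by
          intro s
          by_cases hs : s = ⟨i, hi⟩
          · subst hs; simp
          · have h5 : (s : ℕ) ≠ i := fun h => hs (Fin.ext h)
            have h6 : (s : ℕ) < i + 1 ↔ (s : ℕ) < i := by omega
            simp only [h6, hs, if_false, add_zero]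
        rw [Finset.sum_congr rfl fun s _ => this s, Finset.sum_add_distrib,
          Finset.sum_ite_eq' Finset.univ, if_pos (Finset.mem_univ _)]
      · rw [setReg_s, setReg_s]
        obtain ⟨s', t₀, j, t, r, v, best, phi, out, sig, Y, Z⟩ := μ''
        obtain rfl : s' = i := h3.s
        exact hrun)
    (st := toState K μ) ⟨μ, rfl, hμ, fun v => by simp [hout]⟩
  refine ⟨μ', fun v => ?_, hrun⟩
  rw [h2]
  exact Finset.sum_congr rfl fun s _ => if_pos s.2

/-- The running time of the main part. -/
theorem cost_le {n T M : ℕ} (hn : 1 ≤ n) (hT : 1 ≤ T) (hM : 1 ≤ M)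
    (hm : c.multi = true → (c.restless || c.foremost) = false) :
    n * (c.starts T * (c.rounds n T * (M * (T + 1)))) ≤ 10 * (n ^ 2 * M * T ^ 2) ∧
      n + T ≤ 2 * (n ^ 2 * M * T ^ 2) := by
  have h1 : c.starts T * c.rounds n T ≤ 5 * (n * T) := by
    have h3 : n * 1 ≤ n * T := Nat.mul_le_mul_left n hT
    have h4 : 1 * T ≤ n * T := Nat.mul_le_mul_right T hn
    unfold Variant.starts Variant.rounds
    by_cases hmulti : c.multi = true
    · rw [if_pos hmulti, hm hmulti]
      simp only [Bool.false_eq_true, if_false]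
      nlinarith
    · rw [if_neg hmulti]
      split_ifs <;> nlinarith
  have h2 : M * (T + 1) ≤ M * (2 * T) := Nat.mul_le_mul_left M (by omega)
  constructor
  · calc n * (c.starts T * (c.rounds n T * (M * (T + 1))))
        = n * ((c.starts T * c.rounds n T) * (M * (T + 1))) := by ring
      _ ≤ n * ((5 * (n * T)) * (M * (2 * T))) :=
          Nat.mul_le_mul_left n (Nat.mul_le_mul h1 h2)
      _ = 10 * (n ^ 2 * M * T ^ 2) := by ring
  · have h5 : n * 1 ≤ n * (n * M * T ^ 2) :=
      Nat.mul_le_mul_left n (Nat.mul_pos (Nat.mul_pos hn hM) (by positivity))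
    have h6 : T * 1 ≤ T * (n ^ 2 * M * T) :=
      Nat.mul_le_mul_left T (Nat.mul_pos (Nat.mul_pos (by positivity) hM) hT)
    have h7 : n * (n * M * T ^ 2) = n ^ 2 * M * T ^ 2 := by ring
    have h8 : T * (n ^ 2 * M * T) = n ^ 2 * M * T ^ 2 := by ring
    omega

/-- The algorithm is correct for every class of walks that its variant realizes. The first
hypothesis excludes the combination of parameters for which both the number of departure classes and
the number of rounds grow with `T`. -/
theorem computesBetweennessWithin (hm : c.multi = true → (c.restless || c.foremost) = false)
    (hp : c.foremost = false → c.prefixOpt = false) (h : Realizes G c Δ 𝒲) :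
    G.ComputesBetweennessWithin Δ 𝒲 (mainProg c) (1000000000000 * G.timeScale) := by
  intro L hnd hL
  by_cases hM : G.M = 0
  · obtain ⟨k, hk, hexec⟩ := Run.ite_pos (b := .eq (.reg 2) (.const 0))
      (q := .seq (initProg c) (.forLoop 10 0 (sourceProg c))) (st := G.input Δ L) hM (Run.skip _)
    refine ⟨k, _, hexec, hk.trans ?_, fun v => (betweenness_eq_zero hM v).symm⟩
    have : G.n + 1 ≤ G.timeScale := le_max_right _ _
    simp only [Cond.cost, NatExpr.cost]
    omega
  · obtain ⟨e, he⟩ := Finset.card_pos.1 (Nat.pos_of_ne_zero hM)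
    obtain ⟨h1, h2, h3⟩ := one_le_of_mem he
    obtain ⟨K, hK, r1⟩ := run_initProg (c := c) (Δ := Δ) hnd hL h1 h2 h3
    obtain ⟨μ, hμ, r2⟩ := hK.run_sources ⟨hnd, hL, h, hp⟩ (μ := inputMem)
      ⟨rfl, rfl, rfl, rfl, rfl, rfl⟩ rfl
    obtain ⟨k, hk, hexec⟩ := Run.ite_neg (b := .eq (.reg 2) (.const 0)) (p := .skip)
      (st := G.input Δ L) hM (r1.seq r2)
    refine ⟨k, _, hexec, hk.trans ?_, hμ⟩
    have h4 : G.n ^ 2 * G.M * G.T ^ 2 ≤ G.timeScale := le_max_left _ _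
    obtain ⟨h5, h6⟩ := cost_le h2 h3 h1 hm
    have h7 : 1 ≤ G.n ^ 2 * G.M * G.T ^ 2 :=
      Nat.mul_pos (Nat.mul_pos (Nat.pow_pos h2) h1) (Nat.pow_pos h3)
    rw [hK.R_eq, length_eq_M hnd hL, mul_left_comm G.n]
    -- The bounds on the costs of the loop bodies are generous; the factor `20` of each loop and the
    -- factor `10` of `cost_le` bring the constant of `Ready.run_sources` to `4 * 10 ^ 11`.
    simp only [Cond.cost, NatExpr.cost]
    omega

end

end TemporalBetweenness

theorem mainTheorem4 :
    -- foremost temporal walks, whenever there are only finitely many of them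
    (∃ (p : RAM.Prog) (C : ℕ), ∀ G : TemporalGraph, G.foremostWalks.Finite →
      G.ComputesBetweennessWithin 0 G.foremostWalks p (C * G.timeScale)) ∧
    -- shortest temporal paths
    (∃ (p : RAM.Prog) (C : ℕ), ∀ G : TemporalGraph,
      G.ComputesBetweennessWithin 0 G.shortestPaths p (C * G.timeScale)) ∧
    -- shortest fastest temporal paths
    (∃ (p : RAM.Prog) (C : ℕ), ∀ G : TemporalGraph,
      G.ComputesBetweennessWithin 0 G.shortestFastestPaths p (C * G.timeScale)) ∧
    -- shortest restless temporal walks, uniformly in the waiting bound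
    (∃ (p : RAM.Prog) (C : ℕ), ∀ (G : TemporalGraph) (Δ : ℕ),
      G.ComputesBetweennessWithin Δ (G.shortestRestlessWalks Δ) p (C * G.timeScale)) ∧
    -- strict prefix-foremost temporal paths
    (∃ (p : RAM.Prog) (C : ℕ), ∀ G : TemporalGraph,
      G.ComputesBetweennessWithin 0 G.strictPrefixForemostPaths p (C * G.timeScale)) := by
  open TemporalBetweenness in
  exact ⟨⟨_, _, fun _ hfin => computesBetweennessWithin (by decide) (by decide)
      (realizes_foremostWalks hfin)⟩,
    ⟨_, _, fun _ => computesBetweennessWithin (by decide) (by decide) realizes_shortestPaths⟩,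
    ⟨_, _, fun _ => computesBetweennessWithin (by decide) (by decide)
      realizes_shortestFastestPaths⟩,
    ⟨_, _, fun _ _ => computesBetweennessWithin (by decide) (by decide)
      realizes_shortestRestlessWalks⟩,
    ⟨_, _, fun _ => computesBetweennessWithin (by decide) (by decide)
      realizes_strictPrefixForemostPaths⟩⟩
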